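/- Let $X\subset\mathbb{C}^n$ and $Y\subset\mathbb{C}^m$ be affine algebraic varieties, that is, closed algebraic subsets, possibly reducible. Let $\Gamma\subset X\times Y$ be a birational correspondence, i.e. the Zariski closure in $\mathbb{C}^n\times\mathbb{C}^m$ of the graph of a biregular isomorphism $U\to V$ between Zariski open dense subsets $U\subset X$ and $V\subset Y$. Assume that there exist compact sets $K\subset\mathbb{C}^n$ and $K'\subset\mathbb{C}^m$ such that the correspondence is defined as a continuous map outside $K$ and is bi-Lipschitz there: there are a bijection $f\colon X\setminus K\to Y\setminus K'$ whose graph is contained in $\Gamma$ and a constant $C>0$ such that $$C^{-1}\|x-x'\|\le\|f(x)-f(x')\|\le C\|x-x'\|\qquad\text{for all } x,x'\in X\setminus K,$$ where $\|\cdot\|$ denotes the Euclidean norm. Then $$\deg X=\deg Y.$$ Here $\deg X$ is the number of points in which a generic affine subspace of $\mathbb{C}^n$ of codimension $\dim X$ meets $X$. Generic means: for all pairs $(A,b)$, with $A$ a complex $(\dim X)\times n$ matrix and $b\in\mathbb{C}^{\dim X}$, outside the zero set of some nonzero polynomial in the entries, the set $\{x\in X: Ax=b\}$ has exactly $\deg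 X$ points. In particular, these generic numbers exist for $X$ and $Y$, and they coincide. (The empty set has degree $0$.) -/

import Mathlib

/-- Closed algebraic subsets of the affine space `ℂ^σ`. They may be reducible. -/
def IsAlgebraicSet {σ : Type*} (X : Set (σ → ℂ)) : Prop :=
  ∃ I : Ideal (MvPolynomial σ ℂ), X = MvPolynomial.zeroLocus ℂ I

/-- The Zariski closure of a subset of `ℂ^σ`. -/
def zariskiClosure {σ : Type*} (S : Set (σ → ℂ)) : Set (σ → ℂ) :=
  {x | ∀ p : MvPolynomial σ ℂ, (∀ s ∈ S, MvPolynomial.eval s p = 0) → MvPolynomial.eval x p = 0}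

/-- `U` is a Zariski open and Zariski dense subset of `X`. -/
def IsZariskiOpenDense {σ : Type*} (X U : Set (σ → ℂ)) : Prop :=
  (∃ Z : Set (σ → ℂ), IsAlgebraicSet Z ∧ U = X \ Z) ∧ X ⊆ zariskiClosure U

/-- `φ` restricted to the (locally closed) set `U` is a regular map to `ℂ^m`: near each point of
`U`, each coordinate of `φ` is a quotient of two polynomials. -/
def IsRegularOn {n m : ℕ} (U : Set (Fin n → ℂ)) (φ : (Fin n → ℂ) → (Fin m → ℂ)) : Prop :=
  ∀ x ∈ U, ∀ j : Fin m, ∃ p q : MvPolynomial (Fin n) ℂ, MvPolynomial.eval x q ≠ 0 ∧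
    ∀ u ∈ U, MvPolynomial.eval u q ≠ 0 →
      φ u j = MvPolynomial.eval u p / MvPolynomial.eval u q

/-- `Γ ⊆ ℂⁿ × ℂᵐ` is a birational correspondence from `X` to `Y`: the Zariski closure of the graph
of a biregular isomorphism `φ : U → V` between Zariski open dense subsets `U ⊆ X` and `V ⊆ Y`.
The point `(x, y)` of `ℂⁿ × ℂᵐ` is written `Sum.elim x y`. -/
def IsBirationalCorrespondence {n m : ℕ} (X : Set (Fin n → ℂ)) (Y : Set (Fin m → ℂ))
    (Γ : Set (Fin n ⊕ Fin m → ℂ)) : Prop :=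
  ∃ (U : Set (Fin n → ℂ)) (V : Set (Fin m → ℂ))
    (φ : (Fin n → ℂ) → (Fin m → ℂ)) (ψ : (Fin m → ℂ) → (Fin n → ℂ)),
    IsZariskiOpenDense X U ∧ IsZariskiOpenDense Y V ∧
    IsRegularOn U φ ∧ IsRegularOn V ψ ∧
    Set.MapsTo φ U V ∧ Set.MapsTo ψ V U ∧
    (∀ u ∈ U, ψ (φ u) = u) ∧ (∀ v ∈ V, φ (ψ v) = v) ∧
    Γ = zariskiClosure ((fun u => Sum.elim u (φ u)) '' U)

/-- The Euclidean distance on `ℂⁿ`. -/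
noncomputable def euclideanDist {n : ℕ} (x y : Fin n → ℂ) : ℝ :=
  dist (WithLp.toLp 2 x : EuclideanSpace ℂ (Fin n)) (WithLp.toLp 2 y)

/-- `f` restricts to a bi-Lipschitz homeomorphism from `A` onto `B`, for the Euclidean distances
(continuity in both directions follows from the two inequalities). -/
def IsBiLipschitzOnto {n m : ℕ} (f : (Fin n → ℂ) → (Fin m → ℂ))
    (A : Set (Fin n → ℂ)) (B : Set (Fin m → ℂ)) : Prop :=
  Set.BijOn f A B ∧ ∃ C : ℝ, 0 < C ∧ ∀ x ∈ A, ∀ x' ∈ A,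
    euclideanDist (f x) (f x') ≤ C * euclideanDist x x' ∧
    euclideanDist x x' ≤ C * euclideanDist (f x) (f x')

/-- The dimension of an algebraic set: the Krull dimension of its coordinate ring
(and `0` for the empty set). -/
noncomputable def algDim {n : ℕ} (X : Set (Fin n → ℂ)) : ℕ :=
  (ringKrullDim
    (MvPolynomial (Fin n) ℂ ⧸ MvPolynomial.vanishingIdeal ℂ X)).unbotD 0 |>.toNat

/-- `X` has degree `d`: with `k = dim X`, a generic affine subspace `{x | A x = b}` of codimension
`k` in `ℂⁿ` meets `X` in exactly `d` points. Generic means: for all pairs `(A, b)`, where `A` is a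
`k × n` matrix and `b ∈ ℂᵏ`, outside the zero set of some nonzero polynomial in the entries
of `A` and `b`. -/
def HasDegree {n : ℕ} (X : Set (Fin n → ℂ)) (d : ℕ) : Prop :=
  ∃ P : MvPolynomial ((Fin (algDim X) × Fin n) ⊕ Fin (algDim X)) ℂ, P ≠ 0 ∧
    ∀ (A : Matrix (Fin (algDim X)) (Fin n) ℂ) (b : Fin (algDim X) → ℂ),
      MvPolynomial.eval (Sum.elim (fun ij => A ij.1 ij.2) b) P ≠ 0 →
        {x ∈ X | A.mulVec x = b}.encard = d

/-- The degree is unique. -/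
theorem HasDegree.unique {n : ℕ} {X : Set (Fin n → ℂ)} {d e : ℕ}
    (hd : HasDegree X d) (he : HasDegree X e) : d = e := by
  obtain ⟨P, hP, hPd⟩ := hd
  obtain ⟨Q, hQ, hQe⟩ := he
  have hPQ : P * Q ≠ 0 := mul_ne_zero hP hQ
  obtain ⟨z, hz⟩ : ∃ z, MvPolynomial.eval z (P * Q) ≠ 0 := by
    by_contra h
    push Not at h
    exact hPQ (MvPolynomial.funext (fun z => by simpa using h z))
  have hz' : (Sum.elim (fun ij : Fin (algDim X) × Fin n =>
      (Matrix.of fun i j => z (Sum.inl (i, j))) ij.1 ij.2) (fun i => z (Sum.inr i))) = z := by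
    funext i
    rcases i with ⟨i, j⟩ | i <;> rfl
  rw [map_mul] at hz
  have h1 := hPd (Matrix.of fun i j => z (Sum.inl (i, j))) (fun i => z (Sum.inr i))
    (by rw [hz']; exact left_ne_zero_of_mul hz)
  have h2 := hQe (Matrix.of fun i j => z (Sum.inl (i, j))) (fun i => z (Sum.inr i))
    (by rw [hz']; exact right_ne_zero_of_mul hz)
  rw [h1] at h2
  exact_mod_cast h2

/-! The degree is a generic rank, and generic ranks can be compared by linear growth alone.

For `k = dim X` generic linear forms `l = A x`, the coordinate ring of `X` is integral over `ℂ[l]`,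
and its generic rank is the number of points in a generic fibre, that is, the degree. The degree
exists because the sections `A x = b` are the fibres of the single map `(A, x) ↦ (A, A x)`
(`exists_hasDegreeOfDim`). A birational correspondence gives a common localization `T` of the two
coordinate rings at nonzerodivisors (`exists_common_principalLocalization`). So `T` has generic rank
`deg X` over `ℂ[l]`, and generic rank `deg Y` over `ℂ[l']` for generic forms `l' = B y`
(`IsPrincipalLocalization.exists_isGenericBasisOver`). The bi-Lipschitz hypothesis enters only
through `‖x‖ = O(1 + ‖y‖)` and `‖y‖ = O(1 + ‖x‖)` at the points of `T` (`exists_linear_growth`).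
Since generic forms also bound the coordinates linearly, `l` and `l'` bound each other linearly.

Let `D` and `D'` be the ranks over `ℂ[l]` and `ℂ[l']`. Each `l i` is a root of its characteristic
polynomial over `ℂ(l')`. Above a point `s` the roots are values of `l i`, hence `O(1 + ‖s‖)`, so the
`j`-th coefficient is a polynomial of degree at most `D' - j` (`dvd_of_growth`,
`IsGenericBasis.exists_monic_of_growth`). Up to a fixed denominator, a monomial of degree `d` in `l`
therefore becomes a combination of finitely many fixed monomials with coefficients in `ℂ[l']` of
degree at most `d`. With `h d` the dimension of the polynomials of degree at most `d` in `k`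
variables, this gives `D * h d ≤ D' * h (d + c)` with `c` independent of `d`. As `h` grows
polynomially, `D ≤ D'` (`card_le_card_of_relations`, `le_of_mul_le_mul_shift`), and the situation is
symmetric.

Since `X` may be reducible, `T` need not be a domain and may have torsion over `ℂ[l]`. Bases are
therefore taken up to powers of a denominator `Q`, and transcendence degrees are used at primes of
`T`. -/

/-! ### Bases up to a denominator. -/

/-- For a maximal independent subset `J` of `F`, each element of `F` has a nonzero multiple in the
span of `J`; `q` is the product of the multipliers. -/
theorem exists_smul_mem_span_of_finset {S T : Type*} [CommRing S] [IsDomain S] [AddCommGroup T]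
    [Module S T] (F : Finset T) : ∃ J : Finset T, LinearIndepOn S id (J : Set T) ∧
      ∃ q : S, q ≠ 0 ∧ ∀ t ∈ Submodule.span S (F : Set T), q • t ∈ Submodule.span S (J : Set T) := by
  classical
  obtain ⟨J, hJ, hmax⟩ := (F.powerset.filter fun J : Finset T =>
    LinearIndepOn S id (J : Set T)).exists_maximal
    ⟨∅, by simp⟩
  simp only [Finset.mem_filter, Finset.mem_powerset] at hJ hmax
  refine ⟨J, hJ.2, ?_⟩
  have key : ∀ g ∈ F, ∃ q : S, q ≠ 0 ∧ q • g ∈ Submodule.span S (J : Set T) := by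
    intro g hg
    by_cases hgJ : g ∈ J
    · exact ⟨1, one_ne_zero, by simpa using Submodule.subset_span hgJ⟩
    have hdep : ¬ LinearIndepOn S id ((insert g J : Finset T) : Set T) := fun h =>
      hgJ (hmax ⟨Finset.insert_subset hg hJ.1, h⟩ (Finset.subset_insert g J)
        (Finset.mem_insert_self g J))
    rw [linearIndepOn_finset_iff] at hdep
    push Not at hdep
    obtain ⟨f, hf, i, hi, hfi⟩ := hdep
    rw [Finset.sum_insert hgJ] at hf
    have hfg : f g ≠ 0 := by
      intro h0
      rw [h0, zero_smul, zero_add] at hf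
      rcases Finset.mem_insert.1 hi with rfl | hi
      · exact hfi h0
      · exact hfi (linearIndepOn_finset_iff.1 hJ.2 f hf i hi)
    refine ⟨f g, hfg, ?_⟩
    rw [show f g • g = _ from eq_neg_of_add_eq_zero_left hf]
    exact Submodule.neg_mem _ (Submodule.sum_mem _ fun j hj =>
      Submodule.smul_mem _ _ (Submodule.subset_span hj))
  choose! q hq hqm using key
  refine ⟨∏ g ∈ F, q g, Finset.prod_ne_zero_iff.2 hq, fun t ht => ?_⟩
  induction ht using Submodule.span_induction with
  | mem x hx =>
    rw [← Finset.prod_erase_mul F q hx, mul_smul]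
    exact Submodule.smul_mem _ _ (hqm x hx)
  | zero => simp
  | add x y _ _ hx hy => rw [smul_add]; exact Submodule.add_mem _ hx hy
  | smul a x _ hx => rw [smul_comm]; exact Submodule.smul_mem _ _ hx

/-- The elements `s g • g` generate a subalgebra that is finite as a module, and powers of the
product of the `s g` carry all of `T` into it. -/
theorem exists_generic_basis {S T : Type*} [CommRing S] [IsDomain S] [CommRing T]
    [Algebra S T] (G : Finset T) (hG : Algebra.adjoin S (G : Set T) = ⊤)
    (h : ∀ t ∈ G, ∃ s : S, s ≠ 0 ∧ IsIntegral S (s • t)) :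
    ∃ (D : ℕ) (e : Fin D → T) (Q : S), Q ≠ 0 ∧ LinearIndependent S e ∧
      ∀ t, ∃ N : ℕ, Q ^ N • t ∈ Submodule.span S (Set.range e) := by
  classical
  choose! s hs hsi using h
  let A := Algebra.adjoin S ((fun g => s g • g) '' (G : Set T))
  have hfg : A.toSubmodule.FG := fg_adjoin_of_finite (G.finite_toSet.image _) (by
    rintro _ ⟨g, hg, rfl⟩; exact hsi g hg)
  obtain ⟨F, hF⟩ := hfg
  obtain ⟨J, hJ, q, hq, hqJ⟩ := exists_smul_mem_span_of_finset (S := S) F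
  let d := ∏ g ∈ G, s g
  have hd : ∀ t : T, ∃ N : ℕ, d ^ N • t ∈ A := by
    intro t
    have ht : t ∈ Algebra.adjoin S (G : Set T) := by rw [hG]; trivial
    induction ht using Algebra.adjoin_induction with
    | mem x hx =>
      refine ⟨1, ?_⟩
      rw [pow_one, show d = _ from (Finset.prod_erase_mul G s hx).symm, mul_smul]
      exact A.smul_mem (Algebra.subset_adjoin ⟨x, hx, rfl⟩) _
    | algebraMap r => exact ⟨0, by simp⟩
    | add x y _ _ hx hy =>
      obtain ⟨N, hN⟩ := hx
      obtain ⟨M, hM⟩ := hy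
      refine ⟨N + M, ?_⟩
      rw [smul_add]
      refine A.add_mem ?_ ?_
      · rw [pow_add, mul_comm, mul_smul]; exact A.smul_mem hN _
      · rw [pow_add, mul_smul]; exact A.smul_mem hM _
    | mul x y _ _ hx hy =>
      obtain ⟨N, hN⟩ := hx
      obtain ⟨M, hM⟩ := hy
      refine ⟨N + M, ?_⟩
      rw [pow_add, ← smul_mul_smul_comm]
      exact A.mul_mem hN hM
  refine ⟨J.card, fun i => (J.equivFin.symm i : T), d * q, mul_ne_zero
    (Finset.prod_ne_zero_iff.2 hs) hq, ?_, fun t => ?_⟩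
  · exact LinearIndependent.comp hJ _ J.equivFin.symm.injective
  · obtain ⟨N, hN⟩ := hd t
    have hr : Set.range (fun i => (J.equivFin.symm i : T)) = (J : Set T) := by
      ext x
      constructor
      · rintro ⟨i, rfl⟩; exact (J.equivFin.symm i).2
      · intro hx; exact ⟨J.equivFin ⟨x, hx⟩, by simp⟩
    refine ⟨N + 1, ?_⟩
    have : d ^ N • t ∈ Submodule.span S (F : Set T) := by rw [hF]; exact hN
    have h2 : (d * q) ^ (N + 1) • t = (d * q ^ N) • q • d ^ N • t := by
      simp only [smul_smul]; ring_nf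
    rw [hr, h2]
    exact Submodule.smul_mem _ _ (hqJ _ this)

/-! ### Points of finite complex algebras. -/

open scoped TensorProduct

theorem exists_algHom_complex_ker_eq {F : Type*} [CommRing F] [Algebra ℂ F] [Module.Finite ℂ F]
    (m : Ideal F) [m.IsMaximal] : ∃ w : F →ₐ[ℂ] ℂ, RingHom.ker w = m := by
  let := Ideal.Quotient.field m
  let v : F ⧸ m →ₐ[ℂ] ℂ := IsAlgClosed.lift
  refine ⟨v.comp (Ideal.Quotient.mkₐ ℂ m), ?_⟩
  ext x
  rw [RingHom.mem_ker]
  change v (Ideal.Quotient.mk m x) = 0 ↔ _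
  rw [map_eq_zero_iff v (RingHom.injective v.toRingHom), Ideal.Quotient.eq_zero_iff_mem]

/-- An eigenvector of multiplication by `g` is killed by `g - z`, so `g - z` is not a unit and lies
in a maximal ideal, whose residue field is `ℂ`. -/
theorem exists_algHom_eq_of_charpoly_root {F : Type*} [CommRing F] [Algebra ℂ F]
    [Module.Finite ℂ F] (g : F) (z : ℂ) (h : (Algebra.lmul ℂ F g).charpoly.IsRoot z) :
    ∃ w : F →ₐ[ℂ] ℂ, w g = z := by
  rw [← Module.End.hasEigenvalue_iff_isRoot_charpoly] at h
  obtain ⟨v, hv⟩ := h.exists_hasEigenvector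
  have hv1 : (g - algebraMap ℂ F z) * v = 0 := by
    have := hv.apply_eq_smul
    simp only [Algebra.coe_lmul_eq_mul, LinearMap.mul_apply'] at this
    rw [sub_mul, this, Algebra.smul_def, sub_self]
  have hnu : ¬ IsUnit (g - algebraMap ℂ F z) := fun hu => hv.2 (hu.mul_right_eq_zero.1 hv1)
  obtain ⟨m, hm, hgm⟩ := exists_max_ideal_of_mem_nonunits hnu
  obtain ⟨w, hw⟩ := exists_algHom_complex_ker_eq m
  refine ⟨w, ?_⟩
  rw [← hw, RingHom.mem_ker] at hgm
  simpa [sub_eq_zero] using hgm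

/-- Unramified over a field means étale, and over `ℂ` a finite étale algebra is a product of copies
of `ℂ` indexed by its primes. -/
theorem natCard_algHom_complex {F : Type*} [CommRing F] [Algebra ℂ F] [Module.Finite ℂ F]
    [Algebra.FormallyUnramified ℂ F] : Nat.card (F →ₐ[ℂ] ℂ) = Module.finrank ℂ F := by
  have : Algebra.FormallyEtale ℂ F := .of_formallyUnramified_of_field ℂ F
  have : IsArtinianRing F := isArtinian_of_tower ℂ inferInstance
  have : Finite (PrimeSpectrum F) := inferInstance
  have := Fintype.ofFinite (PrimeSpectrum F)
  rw [(Algebra.FormallyEtale.equivPiOfIsSepClosed ℂ F).toLinearEquiv.finrank_eq,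
    Module.finrank_pi, ← Nat.card_eq_fintype_card]
  refine Nat.card_congr (Equiv.ofBijective (fun w => ⟨RingHom.ker w, RingHom.ker_isPrime _⟩) ⟨?_, ?_⟩)
  · intro w w' h
    ext x
    have h1 : x - algebraMap ℂ F (w x) ∈ RingHom.ker w := by simp [RingHom.mem_ker]
    have h2 : RingHom.ker w = RingHom.ker w' := congrArg PrimeSpectrum.asIdeal h
    rw [h2, RingHom.mem_ker] at h1
    rw [map_sub, sub_eq_zero] at h1
    simpa using h1.symm
  · intro p
    have : p.asIdeal.IsMaximal := inferInstance
    obtain ⟨w, hw⟩ := exists_algHom_complex_ker_eq p.asIdeal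
    exact ⟨w, PrimeSpectrum.ext hw⟩

/-- Differentiating `f(g) = 0` gives `f'(g) • D g = 0`, where `f'(g)` is a unit by separability. So
`D` vanishes on generators. -/
theorem formallyUnramified_of_separable {K F : Type*} [Field K] [CommRing F] [Algebra K F]
    (G : Set F) (hG : Algebra.adjoin K G = ⊤)
    (h : ∀ g ∈ G, ∃ f : Polynomial K, f.Separable ∧ Polynomial.aeval g f = 0) :
    Algebra.FormallyUnramified K F := by
  have hD : KaehlerDifferential.D K F = 0 := by
    refine Derivation.ext_of_adjoin_eq_top G hG fun g hg => ?_
    obtain ⟨f, hf, hfg⟩ := h g hg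
    have h1 : Polynomial.aeval g (Polynomial.derivative f) • KaehlerDifferential.D K F g = 0 := by
      rw [← Derivation.map_aeval, hfg, map_zero]
    obtain ⟨a, b, hab⟩ := hf
    have h2 : Polynomial.aeval g b * Polynomial.aeval g (Polynomial.derivative f) = 1 := by
      have := congrArg (Polynomial.aeval g) hab
      simpa [hfg] using this
    rw [← one_smul F (KaehlerDifferential.D K F g), ← h2, mul_smul, h1, smul_zero]
    simp
  refine ⟨?_⟩
  rw [← Submodule.subsingleton_iff F, ← subsingleton_iff_bot_eq_top,
    ← KaehlerDifferential.span_range_derivation, hD]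
  symm
  rw [Submodule.span_eq_bot]
  rintro _ ⟨x, rfl⟩
  rfl

section
variable {S B : Type*} [CommRing S] [CommRing B] [Algebra S B] [Module.Free S B] [Module.Finite S B]

/-- Extensions of `ε` to `B` are the points of `ℂ ⊗[S] B`, and characteristic polynomials commute
with this base change. -/
theorem exists_ringHom_eq_of_charpoly_root (ε : S →+* ℂ) (g : B) (z : ℂ)
    (h : ((Algebra.lmul S B g).charpoly.map ε).IsRoot z) :
    ∃ w : B →+* ℂ, w.comp (algebraMap S B) = ε ∧ w g = z := by
  let := ε.toAlgebra
  have h1 : (Algebra.lmul ℂ (ℂ ⊗[S] B) (1 ⊗ₜ g)).charpoly.IsRoot z := by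
    rw [← Algebra.baseChange_lmul, LinearMap.charpoly_baseChange]
    exact h
  obtain ⟨w, hw⟩ := exists_algHom_eq_of_charpoly_root _ z h1
  refine ⟨(w.toRingHom).comp (Algebra.TensorProduct.includeRight : B →ₐ[S] ℂ ⊗[S] B).toRingHom,
    ?_, hw⟩
  ext s
  have h2 : (1 : ℂ) ⊗ₜ[S] (algebraMap S B s) = (algebraMap S ℂ s) ⊗ₜ 1 := by
    rw [Algebra.algebraMap_eq_smul_one, Algebra.algebraMap_eq_smul_one, TensorProduct.smul_tmul]
  have h3 : w ((algebraMap S ℂ s) ⊗ₜ 1) = algebraMap S ℂ s := w.commutes (algebraMap S ℂ s)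
  change w (1 ⊗ₜ algebraMap S B s) = ε s
  rw [h2, h3]; rfl

theorem encard_ringHom_eq_finrank (ε : S →+* ℂ) (G : Set B) (hG : Algebra.adjoin S G = ⊤)
    (h : ∀ g ∈ G, ∃ f : Polynomial S, (f.map ε).Separable ∧ Polynomial.aeval g f = 0) :
    {w : B →+* ℂ | w.comp (algebraMap S B) = ε}.encard = Module.finrank S B := by
  let := ε.toAlgebra
  have : Nontrivial S := ε.domain_nontrivial
  have hF : Algebra.FormallyUnramified ℂ (ℂ ⊗[S] B) := by
    refine formallyUnramified_of_separable
      ((Algebra.TensorProduct.includeRight : B →ₐ[S] ℂ ⊗[S] B) '' G) ?_ ?_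
    · exact Algebra.TensorProduct.adjoin_one_tmul_image_eq_top _ hG
    · rintro _ ⟨g, hg, rfl⟩
      obtain ⟨f, hf, hfg⟩ := h g hg
      refine ⟨f.map ε, hf, ?_⟩
      rw [show ε = algebraMap S ℂ from rfl, Polynomial.aeval_map_algebraMap,
        Polynomial.aeval_algHom_apply, hfg, map_zero]
  rw [← Module.finrank_baseChange (R := ℂ) (S := S), ← natCard_algHom_complex]
  have : Finite (ℂ ⊗[S] B →ₐ[ℂ] ℂ) := inferInstance
  rw [Set.encard]
  rw [← ENat.card_eq_coe_natCard]
  refine ENat.card_congr ?_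
  exact Equiv.trans (⟨fun w => { w.1 with commutes' := fun s => congrArg (fun v => v s) w.2 },
    fun w => ⟨w.toRingHom, RingHom.ext w.commutes⟩, fun w => rfl, fun w => rfl⟩ :
      {w : B →+* ℂ | w.comp (algebraMap S B) = ε} ≃ (B →ₐ[S] ℂ))
    (Algebra.TensorProduct.liftEquivRight ..)
end

/-! ### Growth, degree and divisibility of complex polynomials. -/

open MvPolynomial Filter Topology

theorem MvPolynomial.IsHomogeneous.eval_smul {σ R : Type*} [CommSemiring R]
    {p : MvPolynomial σ R} {n : ℕ} (hp : p.IsHomogeneous n) (c : R) (b : σ → R) :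
    eval (c • b) p = c ^ n * eval b p := by
  rw [eval_eq, eval_eq, Finset.mul_sum]
  refine Finset.sum_congr rfl fun d hd => ?_
  have h1 : ∑ i ∈ d.support, d i = n := by
    rw [← hp (mem_support_iff.1 hd), Finsupp.weight_apply, Finsupp.sum]
    simp
  simp only [Pi.smul_apply, smul_eq_mul, mul_pow, Finset.prod_mul_distrib,
    Finset.prod_pow_eq_pow_sum, h1]
  ring

section
variable {σ : Type*} [Fintype σ]

theorem dense_eval_ne_zero {P : MvPolynomial σ ℂ} (hP : P ≠ 0) :
    Dense {s : σ → ℂ | eval s P ≠ 0} := by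
  obtain ⟨z, hz⟩ : ∃ z, eval z P ≠ 0 := by
    by_contra! h
    exact hP (MvPolynomial.funext fun z => by simpa using h z)
  rw [dense_iff_inter_open]
  intro O hO ⟨y, hy⟩
  by_contra hne
  have h0 : (fun s : σ → ℂ => eval s P) =ᶠ[𝓝 y] 0 := by
    filter_upwards [hO.mem_nhds hy] with s hs
    by_contra h
    exact hne ⟨s, hs, h⟩
  have han : AnalyticOnNhd ℂ (fun s : σ → ℂ => eval s P) Set.univ := by
    have := AnalyticOnNhd.aeval_mvPolynomial (𝕜 := ℂ) (E := σ → ℂ) (B := ℂ)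
      (f := fun s i => s i) (s := Set.univ)
      (fun i => (ContinuousLinearMap.proj (R := ℂ) (φ := fun _ : σ => ℂ) i).analyticOnNhd _) P
    simpa [MvPolynomial.aeval_eq_eval] using this
  have := han.eq_of_eventuallyEq (g := 0) (fun x _ => analyticAt_const) h0
  exact hz (congrFun this z)

theorem le_of_generic_le {P : MvPolynomial σ ℂ} (hP : P ≠ 0) {f g : (σ → ℂ) → ℝ}
    (hf : Continuous f) (hg : Continuous g) (h : ∀ s, eval s P ≠ 0 → f s ≤ g s) (s : σ → ℂ) :
    f s ≤ g s := by
  have : closure {s : σ → ℂ | eval s P ≠ 0} ⊆ {s | f s ≤ g s} :=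
    closure_minimal h (isClosed_le hf hg)
  rw [(dense_eval_ne_zero hP).closure_eq] at this
  exact this (Set.mem_univ s)

theorem MvPolynomial.homogeneousComponent_totalDegree_ne_zero {σ R : Type*} [CommSemiring R]
    {p : MvPolynomial σ R} (hp : p ≠ 0) : homogeneousComponent p.totalDegree p ≠ 0 := by
  intro h0
  obtain ⟨m, hm, hmd⟩ := Finset.exists_mem_eq_sup p.support (support_nonempty.2 hp)
    (fun s => s.sum fun _ e => e)
  have h1 := congrArg (coeff m) h0
  rw [coeff_homogeneousComponent, if_pos (show m.degree = p.totalDegree from hmd.symm), coeff_zero] at h1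
  exact (mem_support_iff.1 hm) h1

/-- As `t → 0`, `t ^ d * r(b / t)` tends to the top homogeneous component at `b`, while the growth
bound makes it tend to `0` if `j < d`. -/
theorem totalDegree_le_of_growth (r : MvPolynomial σ ℂ) (C : ℝ) (j : ℕ)
    (h : ∀ s : σ → ℂ, ‖eval s r‖ ≤ C * (1 + ‖s‖) ^ j) : r.totalDegree ≤ j := by
  by_contra! hlt
  set d := r.totalDegree with hd
  have hC : 0 ≤ C := by
    have := (norm_nonneg _).trans (h 0)
    simpa using this
  have hr : r ≠ 0 := by rintro rfl; simp at hd; omega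
  have htop : homogeneousComponent d r ≠ 0 := homogeneousComponent_totalDegree_ne_zero hr
  obtain ⟨b, hb⟩ : ∃ z, eval z (homogeneousComponent d r) ≠ 0 := by
    by_contra! h
    exact htop (MvPolynomial.funext fun z => by simpa using h z)
  have hscale : ∀ t : ℂ, t ≠ 0 → t ^ d * eval (t⁻¹ • b) r =
      ∑ i ∈ Finset.range (d + 1), t ^ (d - i) * eval b (homogeneousComponent i r) := by
    intro t ht
    conv_lhs => rw [← sum_homogeneousComponent r]
    rw [map_sum, Finset.mul_sum]
    refine Finset.sum_congr rfl fun i hi => ?_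
    have : eval (t⁻¹ • b) (homogeneousComponent i r) =
        t⁻¹ ^ i * eval b (homogeneousComponent i r) :=
      (homogeneousComponent_isHomogeneous i r).eval_smul _ _
    rw [this, ← mul_assoc, inv_pow]
    congr 1
    rw [pow_sub₀ _ ht (by simp at hi; omega)]
  have hlim1 : Tendsto (fun t : ℂ => t ^ d * eval (t⁻¹ • b) r) (𝓝[≠] 0)
      (𝓝 (eval b (homogeneousComponent d r))) := by
    have hc : Continuous fun t : ℂ =>
        ∑ i ∈ Finset.range (d + 1), t ^ (d - i) * eval b (homogeneousComponent i r) := by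
      fun_prop
    have h0 := (hc.tendsto 0).mono_left (nhdsWithin_le_nhds (s := {0}ᶜ))
    rw [Finset.sum_range_succ, Finset.sum_eq_zero] at h0
    · simp only [tsub_self, pow_zero, one_mul, zero_add] at h0
      refine h0.congr' ?_
      filter_upwards [self_mem_nhdsWithin] with t ht
      exact (hscale t ht).symm
    · intro i hi
      rw [zero_pow (by simp at hi; omega), zero_mul]
  have hlim2 : Tendsto (fun t : ℂ => t ^ d * eval (t⁻¹ • b) r) (𝓝[≠] 0) (𝓝 0) := by
    have hc : Continuous fun t : ℂ => C * (‖t‖ ^ (d - j) * (‖t‖ + ‖b‖) ^ j) := by fun_prop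
    have h0 := (hc.tendsto 0).mono_left (nhdsWithin_le_nhds (s := {0}ᶜ))
    rw [norm_zero, zero_pow (by omega), zero_mul, mul_zero] at h0
    refine squeeze_zero_norm' ?_ h0
    filter_upwards [self_mem_nhdsWithin] with t ht
    have ht' : 0 < ‖t‖ := norm_pos_iff.2 ht
    rw [norm_mul, norm_pow]
    calc ‖t‖ ^ d * ‖eval (t⁻¹ • b) r‖ ≤ ‖t‖ ^ d * (C * (1 + ‖t⁻¹ • b‖) ^ j) := by
          gcongr; exact h _
      _ = C * (‖t‖ ^ (d - j) * (‖t‖ * (1 + ‖t⁻¹ • b‖)) ^ j) := by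
          rw [mul_pow, ← mul_assoc (‖t‖ ^ (d - j)), ← pow_add, Nat.sub_add_cancel hlt.le]; ring
      _ = _ := by
          rw [norm_smul, norm_inv, mul_add, mul_inv_cancel_left₀ ht'.ne', mul_one]
  exact hb (tendsto_nhds_unique hlim1 hlim2)

/-- The prime factors of `q` are removed one at a time. The bound makes `p` vanish where `π` does,
so `π ∣ p` by the Nullstellensatz. After cancelling `‖π‖` off its zeros, the bound for the quotients
extends by density. -/
theorem dvd_of_growth (q : MvPolynomial σ ℂ) (hq : q ≠ 0) (p : MvPolynomial σ ℂ) (C : ℝ) (j : ℕ)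
    (h : ∀ s : σ → ℂ, ‖eval s p‖ ≤ C * (‖eval s q‖ * (1 + ‖s‖) ^ j)) :
    ∃ r, p = q * r ∧ r.totalDegree ≤ j := by
  have hn : ∀ p : MvPolynomial σ ℂ, Continuous fun s : σ → ℂ => ‖eval s p‖ := fun p =>
    (MvPolynomial.continuous_eval p).norm
  induction q using UniqueFactorizationMonoid.induction_on_prime generalizing p with
  | h₁ => exact absurd rfl hq
  | h₂ u hu =>
    obtain ⟨v, rfl⟩ := hu
    refine ⟨↑v⁻¹ * p, by simp, ?_⟩
    obtain ⟨c, hc, hcv⟩ := (MvPolynomial.isUnit_iff_eq_C_of_isReduced).1 (v⁻¹).isUnit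
    obtain ⟨c', hc', hcv'⟩ := (MvPolynomial.isUnit_iff_eq_C_of_isReduced).1 v.isUnit
    refine totalDegree_le_of_growth _ (‖c‖ * (C * ‖c'‖)) j fun s => ?_
    have := h s
    rw [hcv', eval_C] at this
    rw [hcv, map_mul, eval_C, norm_mul]
    calc _ ≤ ‖c‖ * (C * (‖c'‖ * (1 + ‖s‖) ^ j)) := by gcongr
      _ = _ := by ring
  | h₃ a π ha hπ ih =>
    have hdvd : π ∣ p := by
      have : (Ideal.span {π}).IsPrime := (Ideal.span_singleton_prime hπ.ne_zero).2 hπ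
      rw [← Ideal.mem_span_singleton, ← MvPolynomial.IsPrime.vanishingIdeal_zeroLocus
        (K := ℂ) (Ideal.span {π}), mem_vanishingIdeal_iff]
      intro x hx
      have h0 : eval x π = 0 := by
        have := (mem_zeroLocus_iff.1 hx) π (Ideal.mem_span_singleton_self π)
        simpa [MvPolynomial.aeval_eq_eval] using this
      have := h x
      rw [map_mul, h0] at this
      simpa [MvPolynomial.aeval_eq_eval] using this
    obtain ⟨p', rfl⟩ := hdvd
    obtain ⟨r, hr, hrd⟩ := ih (right_ne_zero_of_mul hq) p' (le_of_generic_le hπ.ne_zero (hn _)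
      (continuous_const.mul ((hn _).mul (by fun_prop))) fun s hs => by
        have := h s
        rw [map_mul, map_mul, norm_mul, norm_mul] at this
        have hpos : 0 < ‖eval s π‖ := norm_pos_iff.2 hs
        refine le_of_mul_le_mul_left (this.trans (le_of_eq ?_)) hpos
        ring)
    exact ⟨r, by rw [hr, mul_assoc], hrd⟩
end

/-! ### Generic rank, size of fibres, and characteristic polynomials. -/

/-- A family `e` which is a basis of `T` over `S` up to denominators that are powers of `Q`. -/
structure IsGenericBasis {S T : Type*} [CommRing S] [CommRing T] [Algebra S T] {D : ℕ}
    (e : Fin D → T) (Q : S) : Prop where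
  ne_zero : Q ≠ 0
  linearIndependent : LinearIndependent S e
  exists_pow_smul_mem : ∀ t, ∃ N : ℕ, Q ^ N • t ∈ Submodule.span S (Set.range e)

/-- The radical of `f₀` over the fraction field is separable in characteristic zero, and a multiple
of it over `S` still kills `g` because `T` is reduced. Clearing denominators in the Bézout identity
yields `P`. -/
theorem exists_separable_annihilator {S T : Type*} [CommRing S] [IsDomain S] [CharZero S]
    [CommRing T] [IsReduced T] [Algebra S T] (g : T) (f₀ : Polynomial S) (hf₀ : f₀ ≠ 0)
    (h : Polynomial.aeval g f₀ = 0) :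
    ∃ (f a b : Polynomial S) (P : S), P ≠ 0 ∧ Polynomial.aeval g f = 0 ∧
      a * f + b * Polynomial.derivative f = Polynomial.C P := by
  classical
  let K := FractionRing S
  have hinj : Function.Injective (algebraMap S K) := IsFractionRing.injective S K
  have hinj' : Function.Injective (Polynomial.map (algebraMap S K)) :=
    Polynomial.map_injective _ hinj
  have clear : ∀ p : Polynomial K, ∃ (c : S) (p' : Polynomial S), c ≠ 0 ∧
      p'.map (algebraMap S K) = Polynomial.C (algebraMap S K c) * p := by
    intro p
    obtain ⟨c, hc0, hc⟩ := IsLocalization.integerNormalization_spec (nonZeroDivisors S) p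
    refine ⟨c, _, nonZeroDivisors.ne_zero hc0, hc.trans ?_⟩
    ext i
    simp [Algebra.smul_def]
  have hF0 : f₀.map (algebraMap S K) ≠ 0 := fun h0 => hf₀ (hinj' (by simpa using h0))
  have : CharZero K := charZero_of_injective_algebraMap hinj
  obtain ⟨c, r, hc, hr⟩ := clear (UniqueFactorizationMonoid.radical (f₀.map (algebraMap S K)))
  obtain ⟨n, F, hF⟩ := UniqueFactorizationMonoid.exists_dvd_radical_self_pow hF0
  obtain ⟨d, F', hd, hF'⟩ := clear F
  have hker : (Polynomial.C d * r) ^ (n + 1) = Polynomial.C d ^ n * Polynomial.C c ^ n * r *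
      F' * f₀ := by
    apply hinj'
    simp only [Polynomial.map_mul, Polynomial.map_pow, Polynomial.map_C, hF']
    have : (r.map (algebraMap S K)) ^ n = Polynomial.C (algebraMap S K c) ^ n *
        (f₀.map (algebraMap S K) * F) := by rw [hr, mul_pow, hF]
    rw [pow_succ, mul_pow, this]
    ring
  have hr0 : Polynomial.aeval g (Polynomial.C d * r) = 0 := by
    refine eq_zero_of_pow_eq_zero (n := n + 1) ?_
    rw [← map_pow, hker, map_mul, h, mul_zero]
  have hsep : ((Polynomial.C d * r).map (algebraMap S K)).Separable := by
    rw [PerfectField.separable_iff_squarefree, Polynomial.map_mul, hr, Polynomial.map_C]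
    have hu : ∀ x : S, x ≠ 0 → IsUnit (Polynomial.C (algebraMap S K x)) := fun x hx =>
      Polynomial.isUnit_C.2 (isUnit_iff_ne_zero.2 ((map_ne_zero_iff _ hinj).2 hx))
    refine Squarefree.squarefree_of_dvd
      (y := UniqueFactorizationMonoid.radical (f₀.map (algebraMap S K))) ?_
      UniqueFactorizationMonoid.squarefree_radical
    rw [(hu d hd).mul_left_dvd, (hu c hc).mul_left_dvd]
  generalize Polynomial.C d * r = p at hr0 hsep
  obtain ⟨a, b, hab⟩ := hsep
  obtain ⟨u, a', hu, ha'⟩ := clear a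
  obtain ⟨v, b', hv, hb'⟩ := clear b
  refine ⟨p, Polynomial.C v * a', Polynomial.C u * b', u * v, mul_ne_zero hu hv,
    hr0, hinj' ?_⟩
  rw [Polynomial.derivative_map] at hab
  simp only [Polynomial.map_add, Polynomial.map_mul, ha', hb', Polynomial.map_C] at hab ⊢
  rw [_root_.map_mul (algebraMap S K), Polynomial.C_mul, ← mul_one (Polynomial.C (algebraMap S K u) * Polynomial.C (algebraMap S K v)), ← hab]
  ring

section
variable {S T : Type*} [CommRing S] [CommRing T] [Algebra S T] {D : ℕ}
  {e : Fin D → T} {Q : S}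

theorem IsGenericBasis.exists_localization_basis (h : IsGenericBasis e Q) :
    ∃ b : Module.Basis (Fin D) (Localization (Submonoid.powers Q))
      (Localization (Algebra.algebraMapSubmonoid T (Submonoid.powers Q))),
      ∀ i, b i = algebraMap T _ (e i) := by
  let S₀ := Localization (Submonoid.powers Q)
  let B := Localization (Algebra.algebraMapSubmonoid T (Submonoid.powers Q))
  have hli : LinearIndependent S₀ (algebraMap T B ∘ e) :=
    h.linearIndependent.localization_localization S₀ (Submonoid.powers Q) B
  refine ⟨Module.Basis.mk hli ?_, fun i => by rw [Module.Basis.mk_apply]; rfl⟩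
  intro x _
  obtain ⟨⟨t, m⟩, hm⟩ := IsLocalization.surj (Algebra.algebraMapSubmonoid T (Submonoid.powers Q)) x
  obtain ⟨_, ⟨_, ⟨n, rfl⟩, rfl⟩⟩ := m
  obtain ⟨N, hN⟩ := h.exists_pow_smul_mem t
  have hmem : ∀ y ∈ Submodule.span S (Set.range e), algebraMap T B y ∈
      Submodule.span S₀ (Set.range (algebraMap T B ∘ e)) := by
    intro y hy
    induction hy using Submodule.span_induction with
    | mem x hx => obtain ⟨i, rfl⟩ := hx; exact Submodule.subset_span ⟨i, rfl⟩
    | zero => rw [map_zero]; exact Submodule.zero_mem _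
    | add x y _ _ hx hy => rw [map_add]; exact Submodule.add_mem _ hx hy
    | smul a x _ hx =>
      rw [Algebra.smul_def, map_mul, ← IsScalarTower.algebraMap_apply S T B,
        IsScalarTower.algebraMap_apply S S₀ B, ← Algebra.smul_def]
      exact Submodule.smul_mem _ _ hx
  have h1 := hmem _ hN
  have hQ : IsUnit (algebraMap S S₀ (Q ^ (N + n))) :=
    IsLocalization.map_units S₀ (⟨Q ^ (N + n), N + n, rfl⟩ : Submonoid.powers Q)
  have h2 : algebraMap S S₀ (Q ^ (N + n)) • x = algebraMap T B (Q ^ N • t) := by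
    rw [Algebra.smul_def, Algebra.smul_def, map_mul, ← IsScalarTower.algebraMap_apply S T B, ← hm,
      ← IsScalarTower.algebraMap_apply S S₀ B, IsScalarTower.algebraMap_apply S T B (Q ^ (N+n)),
      pow_add, map_mul, map_mul, IsScalarTower.algebraMap_apply S T B, mul_comm x, ← mul_assoc]
  rw [← h2] at h1
  exact (Submodule.smul_mem_iff_of_isUnit _ hQ).1 h1
end

section
variable {σ T : Type*} [CommRing T] [Algebra (MvPolynomial σ ℂ) T] {D : ℕ}
  {e : Fin D → T} {Q : MvPolynomial σ ℂ}

/-- The extension of an evaluation to the localization away from `Q`. -/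
noncomputable def evalAway (Q : MvPolynomial σ ℂ) (s : σ → ℂ) (hs : eval s Q ≠ 0) :
    Localization (Submonoid.powers Q) →+* ℂ :=
  IsLocalization.lift (M := Submonoid.powers Q) (g := eval s) (by
    rintro ⟨_, n, rfl⟩
    simpa using fun h => absurd h hs)

theorem evalAway_comp (Q : MvPolynomial σ ℂ) (s : σ → ℂ) (hs : eval s Q ≠ 0) :
    (evalAway Q s hs).comp (algebraMap _ _) = eval s := IsLocalization.lift_comp _

theorem ringHom_comp_eq_eval (s : σ → ℂ) (hs : eval s Q ≠ 0)
    (w : Localization (Algebra.algebraMapSubmonoid T (Submonoid.powers Q)) →+* ℂ)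
    (hw : w.comp (algebraMap (Localization (Submonoid.powers Q)) _) = evalAway Q s hs) :
    (w.comp (algebraMap T _)).comp (algebraMap _ T) = eval s := by
  have := congrArg (fun v => v.comp (algebraMap (MvPolynomial σ ℂ) _)) hw
  rw [evalAway_comp, RingHom.comp_assoc, ← IsScalarTower.algebraMap_eq] at this
  rw [RingHom.comp_assoc, ← IsScalarTower.algebraMap_eq, this]

/-- A point over `s` sends `Q` to `Q(s) ≠ 0`, so it extends uniquely to the localization. -/
theorem bijective_ringHom_comp (s : σ → ℂ) (hs : eval s Q ≠ 0) :
    Function.Bijective (fun w : {w : Localization (Algebra.algebraMapSubmonoid T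
        (Submonoid.powers Q)) →+* ℂ | w.comp (algebraMap (Localization (Submonoid.powers Q)) _) =
          evalAway Q s hs} =>
      (⟨w.1.comp (algebraMap T _), ringHom_comp_eq_eval s hs w.1 w.2⟩ :
        {w : T →+* ℂ | w.comp (algebraMap _ T) = eval s})) := by
  constructor
  · intro w w' h
    apply Subtype.ext
    refine IsLocalization.ringHom_ext (Algebra.algebraMapSubmonoid T (Submonoid.powers Q)) ?_
    exact congrArg Subtype.val h
  · rintro ⟨w, hw⟩
    have hu : ∀ y : Algebra.algebraMapSubmonoid T (Submonoid.powers Q), IsUnit (w y) := by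
      rintro ⟨_, _, ⟨n, rfl⟩, rfl⟩
      have := RingHom.congr_fun hw (Q ^ n)
      simp only [RingHom.comp_apply] at this
      rw [this, map_pow]
      exact (isUnit_iff_ne_zero.2 hs).pow n
    refine ⟨⟨IsLocalization.lift hu, ?_⟩, Subtype.ext (IsLocalization.lift_comp hu)⟩
    refine IsLocalization.ringHom_ext (Submonoid.powers Q) ?_
    rw [evalAway_comp, RingHom.comp_assoc, ← IsScalarTower.algebraMap_eq,
      IsScalarTower.algebraMap_eq _ T, ← RingHom.comp_assoc, IsLocalization.lift_comp]
    exact hw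

/-- Where `Q ≠ 0`, the fibre is that of a free algebra of rank `D`. Where the Bézout constants are
nonzero too, the generators satisfy separable equations, so the fibre is unramified and has `D`
points. -/
theorem IsGenericBasis.exists_encard_eq [IsReduced T] (h : IsGenericBasis e Q) (G : Finset T)
    (hG : Algebra.adjoin (MvPolynomial σ ℂ) (G : Set T) = ⊤)
    (hi : ∀ t ∈ G, ∃ s : MvPolynomial σ ℂ, s ≠ 0 ∧ IsIntegral (MvPolynomial σ ℂ) (s • t)) :
    ∃ P : MvPolynomial σ ℂ, P ≠ 0 ∧ ∀ s, eval s P ≠ 0 →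
      {w : T →+* ℂ | w.comp (algebraMap _ T) = eval s}.encard = D := by
  have hsep : ∀ g ∈ G, ∃ (f a b : Polynomial (MvPolynomial σ ℂ)) (P : MvPolynomial σ ℂ), P ≠ 0 ∧
      Polynomial.aeval g f = 0 ∧ a * f + b * Polynomial.derivative f = Polynomial.C P := by
    intro g hg
    obtain ⟨s, hs, p, hp, hps⟩ := hi g hg
    have hd : (Polynomial.C s * Polynomial.X).natDegree ≠ 0 := by
      rw [Polynomial.natDegree_C_mul_X _ hs]; exact one_ne_zero
    -- The monic equation of `s • g`, read as an equation of `g`; its leading coefficient is a power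
    -- of `s`.
    refine exists_separable_annihilator g (p.comp (Polynomial.C s * Polynomial.X)) ?_ ?_
    · rw [← Polynomial.leadingCoeff_ne_zero, Polynomial.leadingCoeff_comp hd, hp.leadingCoeff]
      simpa using pow_ne_zero _ hs
    · rw [Polynomial.aeval_comp, map_mul, Polynomial.aeval_C, Polynomial.aeval_X,
        ← Algebra.smul_def]
      exact hps
  choose! f a b P hP hf hab using hsep
  refine ⟨Q * ∏ g ∈ G, P g, mul_ne_zero h.ne_zero (Finset.prod_ne_zero_iff.2 hP), fun s hs => ?_⟩
  rw [map_mul, map_prod] at hs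
  have hsQ := left_ne_zero_of_mul hs
  have hsP : ∀ g ∈ G, eval s (P g) ≠ 0 := Finset.prod_ne_zero_iff.1 (right_ne_zero_of_mul hs)
  obtain ⟨bas, -⟩ := h.exists_localization_basis
  let S₀ := Localization (Submonoid.powers Q)
  let B := Localization (Algebra.algebraMapSubmonoid T (Submonoid.powers Q))
  have : Module.Free S₀ B := .of_basis bas
  have : Module.Finite S₀ B := .of_basis bas
  have : Nontrivial S₀ := (evalAway Q s hsQ).domain_nontrivial
  have hD : Module.finrank S₀ B = D := by rw [Module.finrank_eq_card_basis bas]; simp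
  rw [Set.encard, ← ENat.card_congr (Equiv.ofBijective _
    (bijective_ringHom_comp (T := T) s hsQ)), ← hD]
  refine encard_ringHom_eq_finrank (evalAway Q s hsQ) (algebraMap T B '' G) ?_ ?_
  · rw [eq_top_iff]
    intro x _
    have hT : ∀ t : T, algebraMap T B t ∈ Algebra.adjoin S₀ (algebraMap T B '' G) := by
      intro t
      have ht : t ∈ Algebra.adjoin (MvPolynomial σ ℂ) (G : Set T) := by rw [hG]; trivial
      induction ht using Algebra.adjoin_induction with
      | mem x hx => exact Algebra.subset_adjoin ⟨x, hx, rfl⟩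
      | algebraMap r =>
        rw [← IsScalarTower.algebraMap_apply, IsScalarTower.algebraMap_apply _ S₀]
        exact Subalgebra.algebraMap_mem _ _
      | add x y _ _ hx hy => rw [map_add]; exact Subalgebra.add_mem _ hx hy
      | mul x y _ _ hx hy => rw [map_mul]; exact Subalgebra.mul_mem _ hx hy
    obtain ⟨⟨t, m⟩, hm⟩ :=
      IsLocalization.surj (Algebra.algebraMapSubmonoid T (Submonoid.powers Q)) x
    obtain ⟨_, ⟨_, ⟨n, rfl⟩, rfl⟩⟩ := m
    have hQ : IsUnit (algebraMap _ S₀ (Q ^ n)) :=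
      IsLocalization.map_units S₀ (⟨Q ^ n, n, rfl⟩ : Submonoid.powers Q)
    rw [← Subalgebra.mem_toSubmodule, ← Submodule.smul_mem_iff_of_isUnit _ hQ, Algebra.smul_def,
      ← IsScalarTower.algebraMap_apply, IsScalarTower.algebraMap_apply _ T B, mul_comm]
    exact hm ▸ hT t
  · rintro _ ⟨g, hg, rfl⟩
    refine ⟨(f g).map (algebraMap _ S₀), ?_, ?_⟩
    · rw [Polynomial.map_map, evalAway_comp]
      have hu := hsP g hg
      refine ⟨Polynomial.C (eval s (P g))⁻¹ * (a g).map (eval s),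
        Polynomial.C (eval s (P g))⁻¹ * (b g).map (eval s), ?_⟩
      have := congrArg (Polynomial.map (eval s)) (hab g hg)
      rw [Polynomial.map_add, Polynomial.map_mul, Polynomial.map_mul, Polynomial.map_C] at this
      rw [Polynomial.derivative_map, mul_assoc, mul_assoc, ← mul_add, this, ← Polynomial.C_mul,
        inv_mul_cancel₀ hu, Polynomial.C_1]
    · rw [Polynomial.aeval_map_algebraMap, Polynomial.aeval_algebraMap_apply, hf g hg, map_zero]

/-- `f` is the characteristic polynomial of `g` on the localized free module. Its coefficients a
priori have denominators `Q ^ N`; the growth of the roots, which are values of `g` on fibres, shows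
that these divide out. -/
theorem IsGenericBasis.exists_monic_of_growth [Fintype σ] (h : IsGenericBasis e Q) (g : T) (c : ℝ)
    (P : MvPolynomial σ ℂ) (hP : P ≠ 0)
    (hg : ∀ (s : σ → ℂ) (w : T →+* ℂ), eval s P ≠ 0 → w.comp (algebraMap _ T) = eval s →
      ‖w g‖ ≤ c * (1 + ‖s‖)) :
    ∃ f : Polynomial (MvPolynomial σ ℂ), f.Monic ∧ f.natDegree = D ∧
      (∀ i, (f.coeff i).totalDegree ≤ D - i) ∧ ∃ N : ℕ, Q ^ N • Polynomial.aeval g f = 0 := by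
  obtain ⟨bas, -⟩ := h.exists_localization_basis
  let S₀ := Localization (Submonoid.powers Q)
  let B := Localization (Algebra.algebraMapSubmonoid T (Submonoid.powers Q))
  have : Module.Free S₀ B := .of_basis bas
  have : Module.Finite S₀ B := .of_basis bas
  have : IsDomain S₀ := IsLocalization.isDomain_localization
    (powers_le_nonZeroDivisors_of_noZeroDivisors h.ne_zero)
  have hinj : Function.Injective (algebraMap (MvPolynomial σ ℂ) S₀) :=
    IsLocalization.injective _ (powers_le_nonZeroDivisors_of_noZeroDivisors h.ne_zero)
  have hD : Module.finrank S₀ B = D := by rw [Module.finrank_eq_card_basis bas]; simp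
  let χ := (Algebra.lmul S₀ B (algebraMap T B g)).charpoly
  have hχm : χ.Monic := LinearMap.charpoly_monic _
  have hχd : χ.natDegree = D := by rw [← hD]; exact LinearMap.charpoly_natDegree _
  obtain ⟨p, N, hp⟩ : ∃ (p : ℕ → MvPolynomial σ ℂ) (N : ℕ), ∀ i ∈ Finset.range (D + 1),
      algebraMap _ S₀ (p i) = algebraMap _ S₀ (Q ^ N) * χ.coeff i := by
    obtain ⟨⟨_, N, rfl⟩, hb⟩ := IsLocalization.exist_integer_multiples (Submonoid.powers Q)
      (Finset.range (D + 1)) χ.coeff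
    choose! p hp using hb
    exact ⟨p, N, fun i hi => by rw [hp i hi, Algebra.smul_def]⟩
  have hbound : ∀ i ∈ Finset.range (D + 1), ∃ r, p i = Q ^ N * r ∧ r.totalDegree ≤ D - i := by
    intro i hi
    -- The constant is Vieta's bound: the `i`-th coefficient is a sum of `D.choose i` products of `D
    -- - i` roots.
    refine dvd_of_growth (Q ^ N) (pow_ne_zero _ h.ne_zero) (p i)
      (c ^ (D - i) * (D.choose i : ℝ)) (D - i) ?_
    refine le_of_generic_le (mul_ne_zero h.ne_zero hP) (MvPolynomial.continuous_eval _).norm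
      (continuous_const.mul ((MvPolynomial.continuous_eval _).norm.mul (by fun_prop))) ?_
    intro s hs
    rw [map_mul] at hs
    have hsQ := left_ne_zero_of_mul hs
    have hev : ∀ q : MvPolynomial σ ℂ, evalAway Q s hsQ (algebraMap _ S₀ q) = eval s q := fun q =>
      RingHom.congr_fun (evalAway_comp Q s hsQ) q
    have h1 := Polynomial.coeff_le_of_roots_le (p := χ.map (evalAway Q s hsQ)) (f := RingHom.id ℂ)
      (B := c * (1 + ‖s‖)) i (hχm.map _) (IsAlgClosed.splits _) (by
        intro z hz
        rw [Polynomial.map_id] at hz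
        obtain ⟨w, hw, hwz⟩ := exists_ringHom_eq_of_charpoly_root (evalAway Q s hsQ)
          (algebraMap T B g) z (Polynomial.isRoot_of_mem_roots hz)
        rw [← hwz]
        exact hg s (w.comp (algebraMap T B)) (right_ne_zero_of_mul hs)
          (ringHom_comp_eq_eval s hsQ w hw))
    rw [Polynomial.map_id, hχm.natDegree_map, hχd, Polynomial.coeff_map] at h1
    rw [← hev (p i), hp i hi, map_mul, hev, norm_mul]
    calc _ ≤ ‖eval s (Q ^ N)‖ * ((c * (1 + ‖s‖)) ^ (D - i) * (D.choose i : ℝ)) := by gcongr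
      _ = _ := by rw [mul_pow]; ring
  choose! r hr hrd using hbound
  have hcoe : ∀ i ∈ Finset.range (D + 1), algebraMap _ S₀ (r i) = χ.coeff i := by
    intro i hi
    have hQ : algebraMap _ S₀ (Q ^ N) ≠ 0 := by
      rw [← map_zero (algebraMap (MvPolynomial σ ℂ) S₀)]
      exact hinj.ne (pow_ne_zero _ h.ne_zero)
    refine mul_left_cancel₀ hQ ?_
    rw [← hp i hi, hr i hi, map_mul]
  let f : Polynomial (MvPolynomial σ ℂ) :=
    ∑ i ∈ Finset.range (D + 1), Polynomial.monomial i (r i)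
  have hfc : ∀ i, f.coeff i = if i ∈ Finset.range (D + 1) then r i else 0 := by
    intro i
    simp only [f, Polynomial.finsetSum_coeff, Polynomial.coeff_monomial, Finset.sum_ite_eq']
  have hfχ : f.map (algebraMap _ S₀) = χ := by
    ext i
    rw [Polynomial.coeff_map, hfc]
    split_ifs with hi
    · exact hcoe i hi
    · rw [map_zero, Polynomial.coeff_eq_zero_of_natDegree_lt]
      rw [hχd]; simpa using hi
  refine ⟨f, Polynomial.monic_of_injective hinj (hfχ ▸ hχm), ?_, ?_, ?_⟩
  · rw [← Polynomial.natDegree_map_eq_of_injective hinj, hfχ, hχd]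
  · intro i
    rw [hfc]
    split_ifs with hi
    · exact hrd i hi
    · simp
  -- Cayley–Hamilton, applied to the element `1`.
  · have h0 : algebraMap T B (Polynomial.aeval g f) = 0 := by
      have := LinearMap.aeval_self_charpoly (Algebra.lmul S₀ B (algebraMap T B g))
      rw [Polynomial.aeval_algHom_apply] at this
      have h2 := congrArg (fun F => F 1) this
      simp only [Algebra.coe_lmul_eq_mul, LinearMap.mul_apply', mul_one, LinearMap.zero_apply] at h2
      rw [← Polynomial.aeval_algebraMap_apply, ← Polynomial.aeval_map_algebraMap S₀, hfχ]
      exact h2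
    rw [IsLocalization.map_eq_zero_iff (Algebra.algebraMapSubmonoid T (Submonoid.powers Q))] at h0
    obtain ⟨⟨_, _, ⟨n, rfl⟩, rfl⟩, hn⟩ := h0
    exact ⟨n, by rw [Algebra.smul_def]; exact hn⟩
end

/-! ### Comparison of generic ranks by counting dimensions. -/

section
variable {σ : Type*} [Fintype σ]

theorem finite_exponents_le (d : ℕ) : Finite {n : σ →₀ ℕ | ∀ i, n i ≤ d} := by
  refine Finite.of_injective (fun n => fun i : σ => (⟨n.1 i, Nat.lt_succ_of_le (n.2 i)⟩ : Fin (d + 1)))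
    fun n m h => Subtype.ext (Finsupp.ext fun i => ?_)
  simpa using congrFun h i

theorem natCard_exponents_le (d : ℕ) :
    Nat.card {n : σ →₀ ℕ | ∀ i, n i ≤ d} ≤ (d + 1) ^ Fintype.card σ := by
  classical
  have h := Nat.card_le_card_of_injective
    (fun n : {n : σ →₀ ℕ | ∀ i, n i ≤ d} => fun i : σ =>
      (⟨n.1 i, Nat.lt_succ_of_le (n.2 i)⟩ : Fin (d + 1)))
    fun n m h => Subtype.ext (Finsupp.ext fun i => by simpa using congrFun h i)
  simpa using h

instance finite_restrictTotalDegree (d : ℕ) : Module.Finite ℂ (restrictTotalDegree σ ℂ d) := by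
  have := finite_exponents_le (σ := σ) d
  have h1 : Module.Finite ℂ (restrictDegree σ ℂ d) := Module.Finite.of_basis (basisRestrictSupport ℂ _)
  exact Submodule.finiteDimensional_of_le (restrictTotalDegree_le_restrictDegree _ _ _)

theorem finrank_restrictTotalDegree_le (d : ℕ) :
    Module.finrank ℂ (restrictTotalDegree σ ℂ d) ≤ (d + 1) ^ Fintype.card σ := by
  have := finite_exponents_le (σ := σ) d
  have h1 : Module.Finite ℂ (restrictDegree σ ℂ d) := Module.Finite.of_basis (basisRestrictSupport ℂ _)
  refine (Submodule.finrank_mono (restrictTotalDegree_le_restrictDegree _ _ _)).trans ?_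
  have h2 : Module.finrank ℂ (restrictDegree σ ℂ d) = Nat.card {n : σ →₀ ℕ | ∀ i, n i ≤ d} :=
    Module.finrank_eq_nat_card_basis (basisRestrictSupport ℂ _)
  rw [h2]
  exact natCard_exponents_le d

theorem finrank_restrictTotalDegree_zero_pos :
    0 < Module.finrank ℂ (restrictTotalDegree σ ℂ 0) := by
  rw [Module.finrank_pos_iff]
  refine ⟨⟨0, ⟨1, by rw [mem_restrictTotalDegree]; simp⟩, fun h => ?_⟩⟩
  exact zero_ne_one (congrArg Subtype.val h)
end

/-- Iterating from `0` in steps of `c` gives `D ^ j ≤ D' ^ j * h (c * j)`; if `D' < D`, exponential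
growth would be bounded by a polynomial. -/
theorem le_of_mul_le_mul_shift (D D' c k : ℕ) (h : ℕ → ℕ) (h0 : 0 < h 0)
    (hpoly : ∀ d, h d ≤ (d + 1) ^ k) (hle : ∀ d, D * h d ≤ D' * h (d + c)) : D ≤ D' := by
  by_contra! hlt
  have hind : ∀ j, D ^ j ≤ D' ^ j * h (c * j) := by
    intro j
    induction j with
    | zero => simpa using Nat.succ_le_of_lt h0
    | succ j ih =>
      calc D ^ (j + 1) = D * D ^ j := pow_succ' _ _
        _ ≤ D * (D' ^ j * h (c * j)) := by gcongr
        _ = D' ^ j * (D * h (c * j)) := by ring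
        _ ≤ D' ^ j * (D' * h (c * j + c)) := Nat.mul_le_mul_left _ (hle _)
        _ = _ := by rw [pow_succ, mul_add_one]; ring
  have hD : (0 : ℝ) < D := by exact_mod_cast (Nat.zero_le _).trans_lt hlt
  set r : ℝ := D' / D with hr
  have hr1 : |r| < 1 := by
    rw [abs_of_nonneg (by positivity), hr, div_lt_one hD]; exact_mod_cast hlt
  have ht := (tendsto_pow_const_mul_const_pow_of_abs_lt_one k hr1).const_mul (((c : ℝ) + 1) ^ k)
  rw [mul_zero] at ht
  have hge : ∀ᶠ j : ℕ in atTop, (1 : ℝ) ≤ (c + 1) ^ k * ((j : ℝ) ^ k * r ^ j) := by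
    filter_upwards [eventually_ge_atTop 1] with j hj
    have h1 : ((D : ℝ)) ^ j ≤ (D' : ℝ) ^ j * ((c : ℝ) * j + 1) ^ k := by
      have := (hind j).trans (Nat.mul_le_mul_left _ (hpoly (c * j)))
      exact_mod_cast this
    have hj' : (1 : ℝ) ≤ j := by exact_mod_cast hj
    have h2 : ((c : ℝ) * j + 1) ^ k ≤ ((c + 1) * j) ^ k := by
      gcongr
      nlinarith
    have hDj : (0 : ℝ) < (D : ℝ) ^ j := by positivity
    rw [hr, div_pow, ← mul_assoc, ← mul_pow, mul_div_assoc', le_div_iff₀ hDj, one_mul]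
    calc _ ≤ _ := h1
      _ ≤ (D' : ℝ) ^ j * ((c + 1) * j) ^ k := by gcongr
      _ = _ := by ring
  exact absurd (ge_of_tendsto ht hge) (by norm_num)

section
variable {σ T : Type*} [CommRing T] [Algebra ℂ T]

/-- Combinations of bounded monomials in `l` with coefficients in `ℂ[l']`, of total degree at most
`d` in both families. -/
noncomputable def boundedCombinations (l l' : σ → T) (r d : ℕ) : Submodule ℂ T :=
  Submodule.span ℂ {t | ∃ (p : MvPolynomial σ ℂ) (α : σ →₀ ℕ), (∀ i, α i ≤ r) ∧
    p.totalDegree + α.degree ≤ d ∧ t = aeval l' p * aeval l (monomial α (1 : ℂ))}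

theorem boundedCombinations_mono (l l' : σ → T) (r : ℕ) {d d' : ℕ} (h : d ≤ d') :
    boundedCombinations l l' r d ≤ boundedCombinations l l' r d' :=
  Submodule.span_mono fun _ ⟨p, α, h1, h2, h3⟩ => ⟨p, α, h1, h2.trans h, h3⟩

theorem mul_mem_boundedCombinations (l l' : σ → T) (r : ℕ) {d d' : ℕ} (q : MvPolynomial σ ℂ)
    (hq : q.totalDegree + d ≤ d') {t : T} (ht : t ∈ boundedCombinations l l' r d) :
    aeval l' q * t ∈ boundedCombinations l l' r d' := by
  induction ht using Submodule.span_induction with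
  | mem x hx =>
    obtain ⟨p, α, h1, h2, rfl⟩ := hx
    refine Submodule.subset_span ⟨q * p, α, h1, ?_, by rw [map_mul, mul_assoc]⟩
    have := totalDegree_mul q p
    omega
  | zero => rw [mul_zero]; exact Submodule.zero_mem _
  | add x y _ _ hx hy => rw [mul_add]; exact Submodule.add_mem _ hx hy
  | smul a x _ hx => rw [mul_smul_comm]; exact Submodule.smul_mem _ _ hx

/-- A factor `l i ^ r` is replaced by lower powers of `l i` through the monic relation. The bound `r
- j` on the `j`-th coefficient keeps the total degree from growing. -/
theorem exists_boundedCombination (l l' : σ → T) (q : T) (r : ℕ)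
    (hrel : ∀ i, ∃ f : Polynomial (MvPolynomial σ ℂ), f.Monic ∧ f.natDegree = r ∧
      (∀ j, (f.coeff j).totalDegree ≤ r - j) ∧ q * f.eval₂ (aeval l').toRingHom (l i) = 0)
    (α : σ →₀ ℕ) : ∃ g ∈ boundedCombinations l l' r α.degree,
      q * aeval l (monomial α (1 : ℂ)) = q * g := by
  induction hn : α.degree using Nat.strong_induction_on generalizing α with
  | h n ih =>
  subst hn
  by_cases hbox : ∀ i, α i ≤ r
  · exact ⟨_, Submodule.subset_span ⟨1, α, hbox, by simp, by rw [map_one (aeval l'), one_mul]⟩, rfl⟩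
  push Not at hbox
  obtain ⟨i, hi⟩ := hbox
  obtain ⟨f, hfm, hfd, hfc, hf⟩ := hrel i
  obtain ⟨β, hβ⟩ : ∃ β : σ →₀ ℕ, α = β + Finsupp.single i r :=
    ⟨α - Finsupp.single i r, (tsub_add_cancel_of_le (by
      rw [Finsupp.single_le_iff]; exact hi.le)).symm⟩
  have hdeg : ∀ j, (β + Finsupp.single i j).degree = β.degree + j := fun j => by
    rw [map_add, Finsupp.degree_single]
  have hmon : ∀ j, aeval l (monomial (β + Finsupp.single i j) (1 : ℂ)) =
      aeval l (monomial β (1 : ℂ)) * l i ^ j := by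
    intro j
    rw [← mul_one (1 : ℂ), ← monomial_mul, map_mul, mul_one]
    congr 1
    rw [← X_pow_eq_monomial, map_pow, aeval_X]
  have hstep : ∀ j : ℕ, ∃ g ∈ boundedCombinations l l' r (β.degree + j), j < r →
      q * aeval l (monomial (β + Finsupp.single i j) (1 : ℂ)) = q * g := by
    intro j
    by_cases hj : j < r
    · obtain ⟨g, hg, hg'⟩ := ih (β + Finsupp.single i j).degree
        (by rw [hdeg, hβ, hdeg]; omega) (β + Finsupp.single i j) rfl
      rw [hdeg] at hg
      exact ⟨g, hg, fun _ => hg'⟩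
    · exact ⟨0, Submodule.zero_mem _, fun h => absurd h hj⟩
  choose g hg hgeq using hstep
  refine ⟨-∑ j ∈ Finset.range r, aeval l' (f.coeff j) * g j,
    Submodule.neg_mem _ (Submodule.sum_mem _ fun j hj => ?_), ?_⟩
  · refine mul_mem_boundedCombinations l l' r _ ?_ (hg j)
    have := hfc j
    have hj' := Finset.mem_range.1 hj
    rw [hβ, hdeg]; omega
  · rw [Polynomial.eval₂_eq_sum_range, hfd, Finset.sum_range_succ,
      show f.coeff r = 1 by rw [← hfd]; exact hfm, map_one, one_mul, mul_add] at hf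
    have hf' := eq_neg_of_add_eq_zero_right hf
    rw [hβ, hmon, mul_left_comm, hf', mul_neg, mul_neg, Finset.mul_sum, Finset.mul_sum,
      Finset.mul_sum]
    congr 1
    refine Finset.sum_congr rfl fun j hj => ?_
    have := hgeq j (Finset.mem_range.1 hj)
    rw [hmon] at this
    change _ * (q * (aeval l' (f.coeff j) * _)) = _
    linear_combination aeval l' (f.coeff j) * this

/-- Multiplication by `Q(l') ^ N` embeds the combinations of `e` of degree at most `d` in `l` into
the combinations of `e'` of degree at most `d + c₀` in `l'`. -/
theorem card_le_card_of_relations [Fintype σ] (l l' : σ → T) {D D' : ℕ} (e : Fin D → T) (e' : Fin D' → T)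
    (Q : MvPolynomial σ ℂ)
    (he : ∀ c : Fin D → MvPolynomial σ ℂ, ∑ i, aeval l (c i) * e i = 0 → c = 0)
    (he' : ∀ t, ∃ (N : ℕ) (c : Fin D' → MvPolynomial σ ℂ),
      aeval l' (Q ^ N) * t = ∑ j, aeval l' (c j) * e' j)
    (hreg : ∃ (z : T) (s : MvPolynomial σ ℂ), s ≠ 0 ∧ aeval l' Q * z = aeval l s)
    (hrel : ∀ i, ∃ f : Polynomial (MvPolynomial σ ℂ), f.Monic ∧ f.natDegree = D' ∧
      (∀ j, (f.coeff j).totalDegree ≤ D' - j) ∧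
        ∃ N : ℕ, aeval l' (Q ^ N) * f.eval₂ (aeval l').toRingHom (l i) = 0) :
    D ≤ D' := by
  classical
  have hbox : Finite {n : σ →₀ ℕ | ∀ i, n i ≤ D'} := finite_exponents_le D'
  have := Fintype.ofFinite {n : σ →₀ ℕ | ∀ i, n i ≤ D'}
  choose f hfm hfd hfc N₁ hfN using hrel
  choose N₂ c hc using he'
  let M (p : {n : σ →₀ ℕ | ∀ i, n i ≤ D'} × Fin D) : T := aeval l (monomial p.1.1 (1 : ℂ)) * e p.2
  -- One exponent for the finitely many relations and the finitely many products of box monomials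
  -- with basis elements.
  let N := ∑ i, N₁ i + ∑ p, N₂ (M p)
  have hN₁ : ∀ i, aeval l' (Q ^ N) * (f i).eval₂ (aeval l').toRingHom (l i) = 0 := by
    intro i
    have : N₁ i ≤ N := (Finset.single_le_sum (fun _ _ => Nat.zero_le _)
      (Finset.mem_univ i)).trans (Nat.le_add_right _ _)
    rw [← Nat.sub_add_cancel this, pow_add, map_mul, mul_assoc, hfN, mul_zero]
  let cc (p : {n : σ →₀ ℕ | ∀ i, n i ≤ D'} × Fin D) (j : Fin D') : MvPolynomial σ ℂ :=
    Q ^ (N - N₂ (M p)) * c (M p) j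
  have hcc : ∀ p, aeval l' (Q ^ N) * M p = ∑ j, aeval l' (cc p j) * e' j := by
    intro p
    have : N₂ (M p) ≤ N := (Finset.single_le_sum (f := fun p => N₂ (M p)) (fun _ _ => Nat.zero_le _)
      (Finset.mem_univ p)).trans (Nat.le_add_left _ _)
    rw [← Nat.sub_add_cancel this, pow_add, map_mul, mul_assoc, hc, Finset.mul_sum]
    simp only [cc, map_mul, mul_assoc]
  -- The degree lost when box monomials are expanded in `e'`; it does not depend on `d`.
  let c₀ := ∑ p, ∑ j, (cc p j).totalDegree
  have hc₀ : ∀ p j, (cc p j).totalDegree ≤ c₀ := fun p j =>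
    (Finset.single_le_sum (f := fun j => (cc p j).totalDegree) (fun _ _ => Nat.zero_le _)
      (Finset.mem_univ j)).trans (Finset.single_le_sum
        (f := fun p => ∑ j, (cc p j).totalDegree) (fun _ _ => Nat.zero_le _) (Finset.mem_univ p))
  let L' : (Fin D' → MvPolynomial σ ℂ) →ₗ[ℂ] T :=
    ∑ j, ((LinearMap.mulRight ℂ (e' j)).comp (aeval l').toLinearMap).comp (LinearMap.proj j)
  have hL' : ∀ c, L' c = ∑ j, aeval l' (c j) * e' j := fun c => by
    simp [L', LinearMap.sum_apply]
  let L : (Fin D → MvPolynomial σ ℂ) →ₗ[ℂ] T :=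
    ∑ j, ((LinearMap.mulRight ℂ (e j)).comp (aeval l).toLinearMap).comp (LinearMap.proj j)
  have hL : ∀ c, L c = ∑ j, aeval l (c j) * e j := fun c => by
    simp [L, LinearMap.sum_apply]
  let R (d : ℕ) := restrictTotalDegree σ ℂ d
  let W (d : ℕ) : Submodule ℂ T :=
    LinearMap.range (L'.comp ((R d).subtype.compLeft (Fin D')))
  have hW : ∀ d p i, p ∈ restrictTotalDegree σ ℂ d → aeval l' (Q ^ N) * (aeval l p * e i) ∈
      W (d + c₀) := by
    intro d p i hp
    rw [mem_restrictTotalDegree] at hp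
    have hmono : ∀ α : σ →₀ ℕ, α.degree ≤ d →
        aeval l' (Q ^ N) * (aeval l (monomial α (1 : ℂ)) * e i) ∈ W (d + c₀) := by
      intro α hα
      obtain ⟨g, hg, hg'⟩ := exists_boundedCombination l l' (aeval l' (Q ^ N)) D'
        (fun i => ⟨f i, hfm i, hfd i, hfc i, hN₁ i⟩) α
      rw [← mul_assoc, hg', mul_assoc]
      have hg2 := boundedCombinations_mono l l' D' hα hg
      clear hg hg'
      induction hg2 using Submodule.span_induction with
      | mem x hx =>
        obtain ⟨p, β, h1, h2, rfl⟩ := hx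
        refine ⟨fun j => ⟨p * cc ⟨⟨β, h1⟩, i⟩ j, ?_⟩, ?_⟩
        · change p * cc ⟨⟨β, h1⟩, i⟩ j ∈ restrictTotalDegree σ ℂ (d + c₀)
          rw [mem_restrictTotalDegree]
          have := totalDegree_mul p (cc ⟨⟨β, h1⟩, i⟩ j)
          have := hc₀ ⟨⟨β, h1⟩, i⟩ j
          omega
        · have := hcc ⟨⟨β, h1⟩, i⟩
          rw [LinearMap.comp_apply, hL']
          simp only [LinearMap.compLeft_apply, Function.comp_apply, Submodule.subtype_apply, map_mul, mul_assoc]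
          rw [← Finset.mul_sum, ← this]
          simp only [M]
          ring
      | zero => rw [zero_mul, mul_zero]; exact Submodule.zero_mem _
      | add x y _ _ hx hy => rw [add_mul, mul_add]; exact Submodule.add_mem _ hx hy
      | smul a x _ hx => rw [smul_mul_assoc, mul_smul_comm]; exact Submodule.smul_mem _ _ hx
    rw [p.as_sum, map_sum, Finset.sum_mul, Finset.mul_sum]
    refine Submodule.sum_mem _ fun α hα => ?_
    have hα1 : monomial α (coeff α p) = coeff α p • monomial α (1 : ℂ) := by
      rw [smul_monomial, smul_eq_mul, mul_one]
    rw [hα1, map_smul, smul_mul_assoc, mul_smul_comm]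
    refine Submodule.smul_mem _ _ (hmono α ?_)
    exact (le_totalDegree hα).trans hp
  -- `Q(l')` divides a nonzero element of `ℂ[l]`, over which `e` is independent.
  have hinj : ∀ c, aeval l' (Q ^ N) * L c = 0 → c = 0 := by
    intro c h0
    obtain ⟨z, s, hs, hz⟩ := hreg
    have h1 : aeval l (s ^ N) * L c = 0 := by
      rw [map_pow, ← hz, mul_pow, mul_comm (_ ^ N), mul_assoc, ← map_pow, h0, mul_zero]
    rw [hL, Finset.mul_sum] at h1
    have h2 := he (fun i => s ^ N * c i) (by
      rw [← h1]; refine Finset.sum_congr rfl fun i _ => ?_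
      rw [map_mul, mul_assoc])
    funext i
    exact (mul_eq_zero.1 (congrFun h2 i)).resolve_left (pow_ne_zero _ hs)
  refine le_of_mul_le_mul_shift D D' c₀ (Fintype.card σ)
    (fun d => Module.finrank ℂ (restrictTotalDegree σ ℂ d)) finrank_restrictTotalDegree_zero_pos
    finrank_restrictTotalDegree_le fun d => ?_
  let Φ : (Fin D → R d) →ₗ[ℂ] W (d + c₀) :=
    (((LinearMap.mulLeft ℂ (aeval l' (Q ^ N))).comp L).comp
      ((R d).subtype.compLeft (Fin D))).codRestrict _ (fun c => by
        simp only [LinearMap.comp_apply, hL, LinearMap.mulLeft_apply, Finset.mul_sum]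
        exact Submodule.sum_mem _ fun i _ => hW d _ i (c i).2)
  have hΦ : Function.Injective Φ := by
    rw [← LinearMap.ker_eq_bot, LinearMap.ker_eq_bot']
    intro c h0
    have h1 := hinj _ (congrArg Subtype.val h0)
    funext i
    exact Subtype.ext (congrFun h1 i)
  have h1 := LinearMap.finrank_le_finrank_of_injective hΦ
  have h2 := LinearMap.finrank_range_le (L'.comp ((R (d + c₀)).subtype.compLeft (Fin D')))
  rw [Module.finrank_pi_fintype, Finset.sum_const, Finset.card_univ, Fintype.card_fin,
    smul_eq_mul] at h1 h2
  exact h1.trans h2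
end

/-! ### Transcendence degree at the primes of an algebra. -/

theorem card_le_of_algebraicIndependent {L : Type*} [Field L] [Algebra ℂ L] {k k' : ℕ}
    (x : Fin k → L) (y : Fin k' → L) (hx : Algebra.IsAlgebraic (Algebra.adjoin ℂ (Set.range x)) L)
    (hy : AlgebraicIndependent ℂ y) : k' ≤ k ∧ (k = k' → AlgebraicIndependent ℂ x) := by
  have h1 := hy.lift_cardinalMk_le_trdeg
  constructor
  · have h2 := Algebra.IsAlgebraic.trdeg_le_cardinalMk ℂ (Set.range x)
    have h3 := Cardinal.mk_range_le_lift (f := x)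
    have h4 := h1.trans (Cardinal.lift_le.2 h2)
    simp only [Cardinal.mk_fin, Cardinal.lift_natCast, Cardinal.lift_uzero] at h3 h4
    exact_mod_cast h4.trans h3
  · rintro rfl
    exact (Algebra.IsAlgebraic.isTranscendenceBasis_of_lift_le_trdeg_of_finite ℂ x
      (by simpa using h1)).1

/-- Every element of `T` is algebraic over `ℂ[l]` at all field valued points of `T`. -/
def IsPointwiseAlgebraic {T : Type*} [CommRing T] [Algebra ℂ T] {k : ℕ} (l : Fin k → T) : Prop :=
  ∀ (P : Ideal T) (_ : P.IsPrime) (t : T),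
    IsAlgebraic (Algebra.adjoin ℂ (Set.range fun i => algebraMap T (FractionRing (T ⧸ P)) (l i)))
      (algebraMap T (FractionRing (T ⧸ P)) t)

theorem aeval_algebraMap_comp {T L : Type*} [CommRing T] [Algebra ℂ T] [CommRing L] [Algebra ℂ L]
    [Algebra T L] [IsScalarTower ℂ T L] {σ : Type*} (l : σ → T) (s : MvPolynomial σ ℂ) :
    aeval (fun i => algebraMap T L (l i)) s = algebraMap T L (aeval l s) := by
  rw [← IsScalarTower.coe_toAlgHom' ℂ T L, ← AlgHom.comp_apply, comp_aeval]

/-- `P` is a prime containing `I` and disjoint from the multiplicative set of nonzero polynomials in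
`l`. -/
theorem exists_prime_algebraicIndependent {T : Type*} [CommRing T] [Algebra ℂ T] {k : ℕ}
    (l : Fin k → T) (I : Ideal T) (hI : ∀ s : MvPolynomial (Fin k) ℂ, aeval l s ∈ I → s = 0) :
    ∃ (P : Ideal T) (_ : P.IsPrime), I ≤ P ∧
      AlgebraicIndependent ℂ (fun i => algebraMap T (FractionRing (T ⧸ P)) (l i)) := by
  let M : Submonoid T := (nonZeroDivisors (MvPolynomial (Fin k) ℂ)).map (aeval l)
  have hd : Disjoint (I : Set T) M := by
    rw [Set.disjoint_left]
    rintro _ h1 ⟨s, hs, rfl⟩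
    exact nonZeroDivisors.ne_zero hs (hI s h1)
  obtain ⟨P, hP, hIP, hPM⟩ := Ideal.exists_le_prime_disjoint I M hd
  refine ⟨P, hP, hIP, ?_⟩
  rw [algebraicIndependent_iff]
  intro s hs
  rw [aeval_algebraMap_comp, IsScalarTower.algebraMap_apply T (T ⧸ P),
    FaithfulSMul.algebraMap_eq_zero_iff, Ideal.Quotient.algebraMap_eq,
    Ideal.Quotient.eq_zero_iff_mem] at hs
  by_contra h0
  exact Set.disjoint_left.1 hPM hs ⟨s, mem_nonZeroDivisors_of_ne_zero h0, rfl⟩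

theorem IsPointwiseAlgebraic.isAlgebraic_fractionRing {T : Type*} [CommRing T] [Algebra ℂ T] {k : ℕ}
    {l : Fin k → T} (h : IsPointwiseAlgebraic l) (P : Ideal T) [hP : P.IsPrime] :
    Algebra.IsAlgebraic (Algebra.adjoin ℂ
      (Set.range fun i => algebraMap T (FractionRing (T ⧸ P)) (l i))) (FractionRing (T ⧸ P)) := by
  refine ⟨fun x => ?_⟩
  obtain ⟨a, b, -, rfl⟩ := IsFractionRing.div_surjective (A := T ⧸ P) x
  obtain ⟨a, rfl⟩ := Ideal.Quotient.mk_surjective a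
  obtain ⟨b, rfl⟩ := Ideal.Quotient.mk_surjective b
  rw [div_eq_mul_inv]
  exact (h P hP a).mul (h P hP b).inv

theorem IsPointwiseAlgebraic.card_le {T : Type*} [CommRing T] [Algebra ℂ T] {k k' : ℕ}
    {l : Fin k → T} {l' : Fin k' → T} (hl : AlgebraicIndependent ℂ l)
    (hl' : IsPointwiseAlgebraic l') : k ≤ k' := by
  obtain ⟨P, hP, -, hPl⟩ := exists_prime_algebraicIndependent l ⊥ (fun s hs =>
    (algebraicIndependent_iff.1 hl) s (by simpa using hs))
  exact (card_le_of_algebraicIndependent _ _ (hl'.isAlgebraic_fractionRing P) hPl).1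

/-- Otherwise some prime contains `q(l')` and keeps `l` independent. There the transcendence degree
is `k`, so `l'` is independent as well, contradicting `q(l') = 0`. -/
theorem IsPointwiseAlgebraic.exists_mul_eq {T : Type*} [CommRing T] [Algebra ℂ T] {k : ℕ}
    {l l' : Fin k → T} (hl' : IsPointwiseAlgebraic l') (q : MvPolynomial (Fin k) ℂ) (hq : q ≠ 0) :
    ∃ (z : T) (s : MvPolynomial (Fin k) ℂ), s ≠ 0 ∧ aeval l' q * z = aeval l s := by
  by_contra! hcon
  obtain ⟨P, hP, hqP, hPl⟩ := exists_prime_algebraicIndependent l (Ideal.span {aeval l' q})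
    (fun s hs => by
      obtain ⟨z, hz⟩ := Ideal.mem_span_singleton.1 hs
      by_contra h0
      exact hcon z s h0 hz.symm)
  have h1 := (card_le_of_algebraicIndependent _ _ (hl'.isAlgebraic_fractionRing P) hPl).2 rfl
  refine hq ((algebraicIndependent_iff.1 h1) q ?_)
  rw [aeval_algebraMap_comp, IsScalarTower.algebraMap_apply T (T ⧸ P),
    FaithfulSMul.algebraMap_eq_zero_iff, Ideal.Quotient.algebraMap_eq,
    Ideal.Quotient.eq_zero_iff_mem]
  exact hqP (Ideal.mem_span_singleton_self _)

/-! ### Generic rank over a family of elements. -/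

/-- The fibre of `Hom(T, ℂ)` over a point, for the map given by the elements `l` of `T`. -/
def pointFibre {T : Type*} [CommRing T] [Algebra ℂ T] {σ : Type*} (l : σ → T) (s : σ → ℂ) :
    Set (T →ₐ[ℂ] ℂ) := {w | ∀ i, w (l i) = s i}

theorem encard_pointFibre {T : Type*} [CommRing T] [Algebra ℂ T] {σ : Type*} (l : σ → T)
    (s : σ → ℂ) :
    {w : T →+* ℂ | w.comp (aeval l : MvPolynomial σ ℂ →ₐ[ℂ] T).toRingHom = eval s}.encard =
      (pointFibre l s).encard := by
  symm
  refine Set.encard_congr (Equiv.ofBijective (fun w => ⟨w.1.toRingHom, ?_⟩) ⟨?_, ?_⟩)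
  · refine MvPolynomial.ringHom_ext (fun c => ?_) (fun i => ?_)
    · simp
    · simpa using w.2 i
  · intro w w' h
    exact Subtype.ext (AlgHom.coe_ringHom_injective (congrArg Subtype.val h))
  · rintro ⟨w, hw⟩
    refine ⟨⟨{ w with commutes' := fun c => ?_ }, fun i => ?_⟩, rfl⟩
    · simpa using RingHom.congr_fun hw (C c)
    · simpa using RingHom.congr_fun hw (X i)

theorem adjoin_eq_top_of_tower {S T : Type*} [CommRing S] [CommRing T] [Algebra ℂ S] [Algebra S T]
    [Algebra ℂ T] [IsScalarTower ℂ S T] {G : Set T} (hG : Algebra.adjoin ℂ G = ⊤) :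
    Algebra.adjoin S G = ⊤ := by
  have h : Algebra.adjoin ℂ G ≤ (Algebra.adjoin S G).restrictScalars ℂ :=
    Algebra.adjoin_le Algebra.subset_adjoin
  rw [hG] at h
  exact eq_top_iff.2 fun t _ => h (Algebra.mem_top (R := ℂ) (x := t))

/-- `e` is a basis of `T` over `ℂ[l]` up to denominators that are powers of `Q`. -/
def IsGenericBasisOver {T : Type*} [CommRing T] [Algebra ℂ T] {σ : Type*} (l : σ → T) {D : ℕ}
    (e : Fin D → T) (Q : MvPolynomial σ ℂ) : Prop :=
  @IsGenericBasis (MvPolynomial σ ℂ) T _ _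
    (aeval l : MvPolynomial σ ℂ →ₐ[ℂ] T).toRingHom.toAlgebra D e Q

/-- Generic fibres have constant cardinality, and this cardinality is a generic rank. -/
theorem exists_generic_rank {T : Type*} [CommRing T] [IsReduced T] [Algebra ℂ T]
    {σ : Type*} (l : σ → T) (G : Finset T) (hG : Algebra.adjoin ℂ (G : Set T) = ⊤)
    (hi : ∀ t ∈ G, ∃ s : MvPolynomial σ ℂ, s ≠ 0 ∧
      (aeval l : MvPolynomial σ ℂ →ₐ[ℂ] T).toRingHom.IsIntegralElem (aeval l s * t)) :
    ∃ (D : ℕ) (e : Fin D → T) (Q P : MvPolynomial σ ℂ), P ≠ 0 ∧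
      IsGenericBasisOver l e Q ∧ ∀ s, eval s P ≠ 0 → (pointFibre l s).encard = D := by
  let := (aeval l : MvPolynomial σ ℂ →ₐ[ℂ] T).toRingHom.toAlgebra
  have : IsScalarTower ℂ (MvPolynomial σ ℂ) T := .of_algebraMap_eq fun c =>
    ((aeval l : MvPolynomial σ ℂ →ₐ[ℂ] T).commutes c).symm
  have hG' : Algebra.adjoin (MvPolynomial σ ℂ) (G : Set T) = ⊤ := adjoin_eq_top_of_tower hG
  have hi' : ∀ t ∈ G, ∃ s : MvPolynomial σ ℂ, s ≠ 0 ∧ IsIntegral (MvPolynomial σ ℂ) (s • t) := by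
    intro t ht
    obtain ⟨s, hs, hst⟩ := hi t ht
    exact ⟨s, hs, hst⟩
  obtain ⟨D, e, Q, hQ, hli, hsp⟩ := exists_generic_basis G hG' hi'
  have hb : IsGenericBasis e Q := ⟨hQ, hli, hsp⟩
  obtain ⟨P, hP, hPs⟩ := hb.exists_encard_eq G hG' hi'
  exact ⟨D, e, Q, P, hP, hb, fun s hs => by rw [← encard_pointFibre]; exact hPs s hs⟩

/-- `T` is an algebra over the same polynomial ring in two ways, through `l` and through `l'`; each
step below selects one of them locally. -/
theorem generic_rank_le {T : Type*} [CommRing T] [Algebra ℂ T] {k : ℕ} (l l' : Fin k → T)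
    (hl' : IsPointwiseAlgebraic l') {D D' : ℕ} (e : Fin D → T) (e' : Fin D' → T)
    (Q Q' : MvPolynomial (Fin k) ℂ)
    (he : IsGenericBasisOver l e Q)
    (he' : IsGenericBasisOver l' e' Q') (c : ℝ)
    (hc : ∀ (w : T →ₐ[ℂ] ℂ) i, ‖w (l i)‖ ≤ c * (1 + ‖fun i => w (l' i)‖)) : D ≤ D' := by
  have hQ' : Q' ≠ 0 := by
    let := (aeval l' : MvPolynomial (Fin k) ℂ →ₐ[ℂ] T).toRingHom.toAlgebra
    have hb : IsGenericBasis e' Q' := he'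
    exact hb.ne_zero
  refine card_le_card_of_relations l l' e e' Q' ?_ ?_ (hl'.exists_mul_eq Q' hQ') ?_
  · intro a ha
    let := (aeval l : MvPolynomial (Fin k) ℂ →ₐ[ℂ] T).toRingHom.toAlgebra
    have hb : IsGenericBasis e Q := he
    exact funext (Fintype.linearIndependent_iff.1 hb.linearIndependent a ha)
  · intro t
    let := (aeval l' : MvPolynomial (Fin k) ℂ →ₐ[ℂ] T).toRingHom.toAlgebra
    have hb : IsGenericBasis e' Q' := he'
    obtain ⟨N, hN⟩ := hb.exists_pow_smul_mem t
    obtain ⟨a, ha⟩ := (Submodule.mem_span_range_iff_exists_fun _).1 hN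
    exact ⟨N, a, ha.symm⟩
  · intro i
    let := (aeval l' : MvPolynomial (Fin k) ℂ →ₐ[ℂ] T).toRingHom.toAlgebra
    have hb : IsGenericBasis e' Q' := he'
    obtain ⟨f, h1, h2, h3, N, h4⟩ := hb.exists_monic_of_growth (l i) c 1 one_ne_zero (by
      intro s w _ hw
      let w' : T →ₐ[ℂ] ℂ := { w with
        commutes' := fun c => by
          have := RingHom.congr_fun hw (C c)
          change w (aeval l' (C c)) = _ at this
          simpa using this }
      have hs : (fun i => w' (l' i)) = s := by
        funext i
        have := RingHom.congr_fun hw (X i)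
        change w (aeval l' (X i)) = _ at this
        rw [aeval_X, eval_X] at this
        exact this
      rw [← hs]
      exact hc w' i)
    exact ⟨f, h1, h2, h3, N, h4⟩

/-! ### Noether normalization by linear forms, respecting degrees. -/

section
variable {R : Type*} [CommRing R] [Algebra ℂ R]

/-- The span of `1` and of the members of a family. -/
def spanOne {ι : Type*} (y : ι → R) : Submodule ℂ R := Submodule.span ℂ (insert 1 (Set.range y))

theorem one_mem_spanOne {ι : Type*} (y : ι → R) : 1 ∈ spanOne y :=
  Submodule.subset_span (Set.mem_insert _ _)

theorem mem_spanOne {ι : Type*} (y : ι → R) (i : ι) : y i ∈ spanOne y :=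
  Submodule.subset_span (Set.mem_insert_of_mem _ ⟨i, rfl⟩)

theorem spanOne_pow_mono {ι : Type*} (y : ι → R) {a b : ℕ} (h : a ≤ b) :
    spanOne y ^ a ≤ spanOne y ^ b :=
  pow_le_pow_right₀ (Submodule.one_le.2 (one_mem_spanOne y)) h

/-- The linear forms in `x` given by the rows of a matrix. -/
def linForms {k n : ℕ} (A : Matrix (Fin k) (Fin n) ℂ) (x : Fin n → R) (i : Fin k) : R :=
  ∑ j, A i j • x j

theorem linForms_mul {k l n : ℕ} (B : Matrix (Fin k) (Fin l) ℂ) (A : Matrix (Fin l) (Fin n) ℂ)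
    (x : Fin n → R) : linForms (B * A) x = linForms B (linForms A x) := by
  funext i
  simp only [linForms, Matrix.mul_apply, Finset.sum_smul, Finset.smul_sum, smul_smul]
  exact Finset.sum_comm

theorem linForms_one {n : ℕ} (x : Fin n → R) : linForms (1 : Matrix (Fin n) (Fin n) ℂ) x = x := by
  funext i
  simp [linForms, Matrix.one_apply, ite_smul]

theorem spanOne_linForms_le {k n : ℕ} (A : Matrix (Fin k) (Fin n) ℂ) (x : Fin n → R) :
    spanOne (linForms A x) ≤ spanOne x := by
  refine Submodule.span_le.2 ?_
  rintro _ (rfl | ⟨i, rfl⟩)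
  · exact one_mem_spanOne x
  · exact Submodule.sum_mem _ fun j _ => Submodule.smul_mem _ _ (mem_spanOne x j)

theorem Finsupp.induction_add_single_one {ι : Type*} {motive : (ι →₀ ℕ) → Prop} (α : ι →₀ ℕ)
    (zero : motive 0) (add_one : ∀ α i, motive α → motive (α + Finsupp.single i 1)) :
    motive α := by
  induction α using Finsupp.induction₂ with
  | zero => exact zero
  | add_single i b f _ _ hf =>
    clear * - hf add_one
    induction b with
    | zero => simpa using hf
    | succ b ih => rw [Finsupp.single_add, ← add_assoc]; exact add_one _ _ ih

theorem monomial_add_single_one {ι : Type*} (α : ι →₀ ℕ) (i : ι) :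
    (monomial (α + Finsupp.single i 1) (1 : ℂ)) = monomial α (1 : ℂ) * X i := by
  rw [X, monomial_mul, one_mul]

theorem aeval_monomial_mem_spanOne_pow {ι : Type*} (y : ι → R) (α : ι →₀ ℕ) :
    aeval y (monomial α (1 : ℂ)) ∈ spanOne y ^ α.degree := by
  induction α using Finsupp.induction_add_single_one with
  | zero => simpa using Submodule.mem_one.2 ⟨1, by simp⟩
  | add_one α i ih =>
    rw [map_add, Finsupp.degree_single, monomial_add_single_one, map_mul, pow_succ, aeval_X]
    exact Submodule.mul_mem_mul ih (mem_spanOne y i)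

/-- Replacing the factors `y i` by `c i • z` one at a time, each error has one factor in `Λ`. -/
theorem monomial_sub_mem {ι : Type*} (y : ι → R) (c : ι → ℂ) (z : R) (Λ : Submodule ℂ R)
    (hz : z ∈ spanOne y) (h : ∀ i, y i - c i • z ∈ Λ) (α : ι →₀ ℕ) :
    aeval y (monomial α (1 : ℂ)) - eval c (monomial α (1 : ℂ)) • z ^ α.degree ∈
      Λ * spanOne y ^ (α.degree - 1) := by
  induction α using Finsupp.induction_add_single_one with
  | zero => simp
  | add_one α i ih =>
    rw [map_add, Finsupp.degree_single, monomial_add_single_one, map_mul, map_mul, aeval_X, eval_X,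
      Nat.add_sub_cancel]
    have h1 : aeval y (monomial α (1 : ℂ)) * y i -
        (eval c (monomial α (1 : ℂ)) * c i) • z ^ (α.degree + 1) =
        (y i - c i • z) * aeval y (monomial α (1 : ℂ)) +
        c i • ((aeval y (monomial α (1 : ℂ)) - eval c (monomial α (1 : ℂ)) • z ^ α.degree) * z) := by
      simp only [Algebra.smul_def, map_mul]
      ring
    rw [h1]
    refine Submodule.add_mem _ (Submodule.mul_mem_mul (h i) (aeval_monomial_mem_spanOne_pow y α))
      (Submodule.smul_mem _ _ ?_)
    rcases Nat.eq_zero_or_pos α.degree with h0 | h0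
    · rw [(Finsupp.degree_eq_zero_iff α).1 h0]; simp
    · have := Submodule.mul_mem_mul ih hz
      rwa [mul_assoc, ← pow_succ, Nat.sub_add_cancel h0] at this

/-- Modulo `Λ * spanOne y ^ e`, every product of `e + 1` factors is a multiple of `z ^ (e + 1)`. -/
theorem spanOne_pow_le_of_pow_mem {ι : Type*} (y : ι → R) (z : R) (Λ : Submodule ℂ R)
    (hz : z ∈ spanOne y) (h : spanOne y ≤ Λ ⊔ Submodule.span ℂ {z}) (d : ℕ)
    (hd : z ^ (d + 1) ∈ Λ * spanOne y ^ d) : spanOne y ^ (d + 1) ≤ Λ * spanOne y ^ d := by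
  have key : ∀ e, spanOne y ^ (e + 1) ≤ Λ * spanOne y ^ e ⊔ Submodule.span ℂ {z ^ (e + 1)} := by
    intro e
    induction e with
    | zero => simpa using h
    | succ e ih =>
      have hz1 : Submodule.span ℂ {z} ≤ spanOne y := by
        rw [Submodule.span_singleton_le_iff_mem]; exact hz
      calc spanOne y ^ (e + 1 + 1) = spanOne y * spanOne y ^ (e + 1) := pow_succ' _ _
        _ ≤ (Λ ⊔ Submodule.span ℂ {z}) * spanOne y ^ (e + 1) := by gcongr
        _ = Λ * spanOne y ^ (e + 1) ⊔ Submodule.span ℂ {z} * spanOne y ^ (e + 1) :=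
          Submodule.sup_mul _ _ _
        _ ≤ Λ * spanOne y ^ (e + 1) ⊔ Submodule.span ℂ {z} *
            (Λ * spanOne y ^ e ⊔ Submodule.span ℂ {z ^ (e + 1)}) := by gcongr
        _ = Λ * spanOne y ^ (e + 1) ⊔ (Λ * (Submodule.span ℂ {z} * spanOne y ^ e) ⊔
            Submodule.span ℂ {z ^ (e + 1 + 1)}) := by
          rw [Submodule.mul_sup, Submodule.span_mul_span, Set.singleton_mul_singleton,
            ← pow_succ', ← mul_assoc, mul_comm _ Λ, mul_assoc]
        _ ≤ Λ * spanOne y ^ (e + 1) ⊔ (Λ * (spanOne y * spanOne y ^ e) ⊔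
            Submodule.span ℂ {z ^ (e + 1 + 1)}) := by gcongr
        _ = _ := by rw [← pow_succ', ← sup_assoc, sup_idem]
  refine (key d).trans (sup_le le_rfl ?_)
  rwa [Submodule.span_singleton_le_iff_mem]

/-- Linear projection from a point `c` at infinity where the top form of `F` does not vanish. The
new forms are `y j - c j • y i₀`, and `F(y) = 0` expresses `y i₀ ^ (d + 1)` through terms with a
factor among them or `1`. -/
theorem exists_linForms_of_relation [Nontrivial R] {k : ℕ} (y : Fin k → R)
    (F : MvPolynomial (Fin k) ℂ) (hF : F ≠ 0) (hFy : aeval y F = 0) :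
    ∃ (k' : ℕ) (_ : k' < k) (B : Matrix (Fin k') (Fin k) ℂ) (d : ℕ),
      spanOne y ^ (d + 1) ≤ spanOne (linForms B y) * spanOne y ^ d := by
  have hdeg : F.totalDegree ≠ 0 := by
    intro h0
    rw [totalDegree_eq_zero_iff_eq_C] at h0
    rw [h0, aeval_C, FaithfulSMul.algebraMap_eq_zero_iff] at hFy
    rw [hFy, C_0] at h0
    exact hF h0
  obtain ⟨d, hd⟩ := Nat.exists_eq_succ_of_ne_zero hdeg
  obtain ⟨c₀, hc₀⟩ : ∃ z, eval z (homogeneousComponent (d + 1) F) ≠ 0 := by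
    by_contra! h
    refine homogeneousComponent_totalDegree_ne_zero hF ?_
    rw [hd]
    exact MvPolynomial.funext fun z => by simpa using h z
  have hhom := homogeneousComponent_isHomogeneous (d + 1) F
  obtain ⟨i₀, hi₀⟩ : ∃ i, c₀ i ≠ 0 := by
    by_contra! h
    refine hc₀ ?_
    have : c₀ = (0 : ℂ) • c₀ := by funext i; simp [h i]
    rw [this, hhom.eval_smul, zero_pow (Nat.succ_ne_zero d), zero_mul]
  obtain ⟨k, rfl⟩ : ∃ k', k = k' + 1 := ⟨k - 1, by have := i₀.2; omega⟩
  set c : Fin (k + 1) → ℂ := (c₀ i₀)⁻¹ • c₀ with hc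
  have hcF : eval c (homogeneousComponent (d + 1) F) ≠ 0 := by
    rw [hc, hhom.eval_smul]
    exact mul_ne_zero (pow_ne_zero _ (inv_ne_zero hi₀)) hc₀
  have hci : c i₀ = 1 := by simp [hc, hi₀]
  let B : Matrix (Fin k) (Fin (k + 1)) ℂ := fun i =>
    Pi.single (i₀.succAbove i) 1 - c (i₀.succAbove i) • Pi.single i₀ 1
  have hB : ∀ i, linForms B y i = y (i₀.succAbove i) - c (i₀.succAbove i) • y i₀ := by
    intro i
    simp [linForms, B, sub_smul, Finset.sum_sub_distrib, Pi.single_apply, ite_smul]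
  refine ⟨k, Nat.lt_succ_self k, B, d, ?_⟩
  have hΛ : ∀ j, y j - c j • y i₀ ∈ spanOne (linForms B y) := by
    intro j
    rcases Fin.eq_self_or_eq_succAbove i₀ j with rfl | ⟨i, rfl⟩
    · rw [hci, one_smul, sub_self]; exact Submodule.zero_mem _
    · rw [← hB]; exact mem_spanOne _ _
  have hΛ1 := one_mem_spanOne (linForms B y)
  refine spanOne_pow_le_of_pow_mem y (y i₀) _ (mem_spanOne y i₀) ?_ d ?_
  · refine Submodule.span_le.2 ?_
    rintro _ (rfl | ⟨j, rfl⟩)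
    · exact Submodule.mem_sup_left hΛ1
    · rw [← sub_add_cancel (y j) (c j • y i₀)]
      exact Submodule.add_mem_sup (hΛ j)
        (Submodule.smul_mem _ _ (Submodule.mem_span_singleton_self _))
  · have hterm : ∀ α ∈ F.support, aeval y (monomial α (coeff α F)) -
        (if α.degree = d + 1 then eval c (monomial α (coeff α F)) else 0) • y i₀ ^ (d + 1) ∈
          spanOne (linForms B y) * spanOne y ^ d := by
      intro α hα
      have hα1 : monomial α (coeff α F) = coeff α F • monomial α (1 : ℂ) := by
        rw [smul_monomial, smul_eq_mul, mul_one]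
      split_ifs with hαd
      · have := monomial_sub_mem y c (y i₀) _ (mem_spanOne y i₀) hΛ α
        rw [hαd, Nat.add_sub_cancel] at this
        rw [hα1, map_smul, smul_eval, mul_smul, ← smul_sub]
        exact Submodule.smul_mem _ _ this
      · rw [zero_smul, sub_zero, hα1, map_smul]
        refine Submodule.smul_mem _ _ ?_
        have hle : α.degree ≤ d := by
          have : α.degree ≤ F.totalDegree := le_totalDegree hα
          omega
        have h1 := spanOne_pow_mono y hle (aeval_monomial_mem_spanOne_pow y α)
        simpa using Submodule.mul_mem_mul hΛ1 h1
    have hsum := Submodule.sum_mem _ hterm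
    rw [Finset.sum_sub_distrib, ← map_sum, ← F.as_sum, hFy, ← Finset.sum_smul, zero_sub,
      ← Finset.sum_filter, ← map_sum] at hsum
    have htop : ∑ α ∈ F.support with α.degree = d + 1, monomial α (coeff α F) =
        homogeneousComponent (d + 1) F := by
      rw [homogeneousComponent_apply]
    rw [htop, Submodule.neg_mem_iff, Submodule.smul_mem_iff _ hcF] at hsum
    exact hsum

/-- Forms are eliminated until they are independent. The inclusion is an integrality statement that
also controls degrees; it survives each elimination because it can be iterated `d + 1` times. -/
theorem exists_noether_normalization [Nontrivial R] {n : ℕ} (x : Fin n → R) :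
    ∃ (k : ℕ) (A : Matrix (Fin k) (Fin n) ℂ) (M : ℕ),
      AlgebraicIndependent ℂ (linForms A x) ∧
      spanOne x ^ (M + 1) ≤ spanOne (linForms A x) * spanOne x ^ M := by
  suffices ∀ (k : ℕ) (A : Matrix (Fin k) (Fin n) ℂ) (M : ℕ),
      spanOne x ^ (M + 1) ≤ spanOne (linForms A x) * spanOne x ^ M →
      ∃ (k : ℕ) (A : Matrix (Fin k) (Fin n) ℂ) (M : ℕ),
        AlgebraicIndependent ℂ (linForms A x) ∧
        spanOne x ^ (M + 1) ≤ spanOne (linForms A x) * spanOne x ^ M from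
    this n 1 0 (by rw [linForms_one]; simp)
  intro k
  induction k using Nat.strong_induction_on with
  | h k ih =>
  intro A M hA
  by_cases hind : AlgebraicIndependent ℂ (linForms A x)
  · exact ⟨k, A, M, hind, hA⟩
  rw [algebraicIndependent_iff] at hind
  push Not at hind
  obtain ⟨F, hFy, hF⟩ := hind
  obtain ⟨k', hk', B, d, hB⟩ := exists_linForms_of_relation _ F hF hFy
  refine ih k' hk' (B * A) (M + d) ?_
  have hiter : ∀ j, spanOne x ^ (M + j) ≤ spanOne (linForms A x) ^ j * spanOne x ^ M := by
    intro j
    induction j with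
    | zero => simp
    | succ j ihj =>
      calc spanOne x ^ (M + (j + 1)) = spanOne x ^ (M + j) * spanOne x := by
            rw [← add_assoc, pow_succ]
        _ ≤ spanOne (linForms A x) ^ j * spanOne x ^ M * spanOne x := by gcongr
        _ = spanOne (linForms A x) ^ j * spanOne x ^ (M + 1) := by rw [mul_assoc, pow_succ]
        _ ≤ spanOne (linForms A x) ^ j * (spanOne (linForms A x) * spanOne x ^ M) := by gcongr
        _ = _ := by rw [pow_succ, mul_assoc]
  rw [linForms_mul]
  calc spanOne x ^ (M + d + 1) ≤ spanOne (linForms A x) ^ (d + 1) * spanOne x ^ M := by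
        rw [add_assoc]; exact hiter _
    _ ≤ spanOne (linForms B (linForms A x)) * spanOne (linForms A x) ^ d * spanOne x ^ M := by
        gcongr
    _ ≤ spanOne (linForms B (linForms A x)) * spanOne x ^ d * spanOne x ^ M := by
        gcongr; exact spanOne_linForms_le A x
    _ = _ := by rw [mul_assoc, ← pow_add, add_comm d]
end

/-! ### Generic linear forms: integrality, linear bounds and dimension. -/

theorem exists_eq_add_sum_mul_of_mem {R : Type*} [CommRing R] [Algebra ℂ R] {k : ℕ}
    (y : Fin k → R) (W : Submodule ℂ R) {t : R} (ht : t ∈ spanOne y * W) :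
    ∃ (r₀ : R) (r : Fin k → R), r₀ ∈ W ∧ (∀ j, r j ∈ W) ∧ t = r₀ + ∑ j, y j * r j := by
  induction ht using Submodule.mul_induction_on' with
  | mem_mul_mem a ha w hw =>
    obtain ⟨c₀, a', ha', rfl⟩ := Submodule.mem_span_insert.1 ha
    obtain ⟨c, rfl⟩ := (Submodule.mem_span_range_iff_exists_fun ℂ).1 ha'
    refine ⟨c₀ • w, fun j => c j • w, W.smul_mem _ hw, fun j => W.smul_mem _ hw, ?_⟩
    rw [add_mul, smul_mul_assoc, one_mul, Finset.sum_mul]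
    simp only [smul_mul_assoc, mul_smul_comm]
  | add x _ y' _ hx hy =>
    obtain ⟨a, b, ha, hb, rfl⟩ := hx
    obtain ⟨a', b', ha', hb', rfl⟩ := hy
    refine ⟨a + a', fun j => b j + b' j, W.add_mem ha ha', fun j => W.add_mem (hb j) (hb' j), ?_⟩
    simp only [mul_add, Finset.sum_add_distrib]
    ring

/-- If the linear forms of `A₀` are a Noether normalization which respects degrees, then so are
those of a generic `A`; the conclusion is an identity over the coordinate ring of all `A`. -/
theorem exists_generic_normalization {R : Type*} [CommRing R] [Algebra ℂ R] {k n M : ℕ}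
    (x : Fin n → R) (A₀ : Matrix (Fin k) (Fin n) ℂ)
    (h : spanOne x ^ (M + 1) ≤ spanOne (linForms A₀ x) * spanOne x ^ M) :
    ∃ (δ : MvPolynomial (Fin k × Fin n) ℂ) (_ : δ ≠ 0) (m : ℕ) (v r₀ : Fin m → R)
      (r : Fin m → Fin k → R) (G : Matrix (Fin m) (Fin m) (MvPolynomial (Fin k × Fin n) ℂ)),
      Submodule.span ℂ (Set.range v) = spanOne x ^ (M + 1) ∧ (∀ i, r₀ i ∈ spanOne x ^ M) ∧
      (∀ i j, r i j ∈ spanOne x ^ M) ∧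
      ∀ (S B : Type) [CommRing S] [CommRing B] [Algebra ℂ S] [Algebra S B] [Algebra ℂ B]
        [IsScalarTower ℂ S B] (ι : R →ₐ[ℂ] B) (A : Fin k × Fin n → S) (b : Fin k → S),
        (∀ j, algebraMap S B (b j) = ∑ t, A (j, t) • ι (x t)) → ∀ i,
          aeval A δ • ι (v i) = ∑ l, aeval A (G i l) • (ι (r₀ l) + ∑ j, b j • ι (r l j)) := by
  classical
  have hfg : (spanOne x ^ (M + 1)).FG := Submodule.FG.pow
    (Submodule.fg_span ((Set.finite_range x).insert 1)) _
  obtain ⟨m, v, hv⟩ := Submodule.fg_iff_exists_fin_generating_family.1 hfg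
  have hdec : ∀ i, ∃ (r₀ : R) (r : Fin k → R), r₀ ∈ spanOne x ^ M ∧
      (∀ j, r j ∈ spanOne x ^ M) ∧ v i = r₀ + ∑ j, linForms A₀ x j * r j := fun i =>
    exists_eq_add_sum_mul_of_mem _ _ (h (hv ▸ Submodule.subset_span ⟨i, rfl⟩))
  choose r₀ r hr₀ hr hvr using hdec
  have hH : ∀ t i j, ∃ c : Fin m → ℂ, ∑ l, c l • v l = x t * r i j := by
    intro t i j
    rw [← Submodule.mem_span_range_iff_exists_fun, hv, pow_succ']
    exact Submodule.mul_mem_mul (mem_spanOne x t) (hr i j)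
  choose H hH using hH
  -- The matrix expressing `r₀ + ∑ (A x)_j * r_j` in the generators `v`. It is the identity at `A =
  -- A₀`, so its determinant is not zero; the adjugate inverts it up to that determinant.
  let N : Matrix (Fin m) (Fin m) (MvPolynomial (Fin k × Fin n) ℂ) :=
    1 + Matrix.of fun i l => ∑ j, ∑ t, C (H t i j l) * (X (j, t) - C (A₀ j t))
  refine ⟨N.det, ?_, m, v, r₀, r, N.adjugate, hv, hr₀, hr, ?_⟩
  · intro h0
    have h1 := congrArg (eval fun p : Fin k × Fin n => A₀ p.1 p.2) h0
    rw [RingHom.map_det] at h1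
    have h2 : (eval fun p : Fin k × Fin n => A₀ p.1 p.2).mapMatrix N = 1 := by
      ext i l
      simp [N, Matrix.one_apply, apply_ite]
    rw [h2, Matrix.det_one, map_zero] at h1
    exact one_ne_zero h1
  · intro S B _ _ _ _ _ _ ι A b hb i
    have hw : ∀ l, ι (r₀ l) + ∑ j, b j • ι (r l j) = ∑ p, aeval A (N l p) • ι (v p) := by
      intro l
      have h1 : ∀ j, b j • ι (r l j) = ∑ t, A (j, t) • ι (x t * r l j) := by
        intro j
        rw [Algebra.smul_def, hb, Finset.sum_mul]
        simp only [map_mul, smul_mul_assoc]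
      have h2 : ι (v l) = ι (r₀ l) + ∑ j, ∑ t, algebraMap ℂ S (A₀ j t) • ι (x t * r l j) := by
        rw [hvr, map_add, map_sum]
        congr 1
        refine Finset.sum_congr rfl fun j _ => ?_
        rw [linForms, Finset.sum_mul, map_sum]
        refine Finset.sum_congr rfl fun t _ => ?_
        rw [smul_mul_assoc, map_smul, algebraMap_smul]
      have h3 : ∑ p, aeval A (N l p) • ι (v p) = ι (v l) +
          ∑ j, ∑ t, (A (j, t) - algebraMap ℂ S (A₀ j t)) • ι (x t * r l j) := by
        simp only [N, Matrix.add_apply, Matrix.of_apply, map_add, add_smul, Finset.sum_add_distrib]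
        congr 1
        · simp [Matrix.one_apply, apply_ite, ite_smul]
        · simp only [map_sum, Finset.sum_smul]
          rw [Finset.sum_comm]
          refine Finset.sum_congr rfl fun j _ => ?_
          rw [Finset.sum_comm]
          refine Finset.sum_congr rfl fun t _ => ?_
          rw [← hH, map_sum, Finset.smul_sum]
          refine Finset.sum_congr rfl fun p _ => ?_
          rw [map_mul, map_sub, aeval_C, aeval_X, aeval_C, map_smul, mul_comm, mul_smul,
            algebraMap_smul]
      rw [h3, h2, add_assoc, ← Finset.sum_add_distrib]
      congr 1
      refine Finset.sum_congr rfl fun j _ => ?_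
      rw [h1, ← Finset.sum_add_distrib]
      refine Finset.sum_congr rfl fun t _ => ?_
      rw [← add_smul]
      congr 1
      ring
    simp only [hw, Finset.smul_sum, smul_smul]
    rw [Finset.sum_comm]
    have h4 : ∀ p, ∑ l, aeval A (N.adjugate i l) * aeval A (N l p) =
        if i = p then aeval A N.det else 0 := by
      intro p
      have h5 := congrArg (aeval A) (congrFun (congrFun N.adjugate_mul i) p)
      rw [Matrix.mul_apply, map_sum] at h5
      simp only [map_mul] at h5
      rw [h5, Matrix.smul_apply, Matrix.one_apply]
      split_ifs <;> simp
    simp only [← Finset.sum_smul, h4, ite_smul, zero_smul, Finset.sum_ite_eq, Finset.mem_univ,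
      if_true]

/-- Cayley–Hamilton for multiplication by `z` on `N`, evaluated at `1 ∈ N`. -/
theorem isIntegral_of_mul_mem {S B : Type*} [CommRing S] [CommRing B] [Algebra S B]
    (N : Submodule S B) (hN : N.FG) (h1 : 1 ∈ N) (z : B) (hz : ∀ y ∈ N, z * y ∈ N) :
    IsIntegral S z := by
  have : Module.Finite S N := Module.Finite.iff_fg.2 hN
  let f : N →ₗ[S] N := (LinearMap.mulLeft S z).restrict hz
  obtain ⟨p, hp, hpf⟩ := LinearMap.exists_monic_and_aeval_eq_zero S f
  refine ⟨p, hp, ?_⟩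
  have key : ∀ (q : Polynomial S) (y : N), ((Polynomial.aeval f q) y : B) =
      Polynomial.aeval z q * y := by
    intro q
    induction q using Polynomial.induction_on' with
    | add p q hp hq => intro y; simp [hp, hq, add_mul]
    | monomial n a =>
      have hpow : ∀ y : N, ((f ^ n) y : B) = z ^ n * y := by
        induction n with
        | zero => intro y; simp
        | succ n ih =>
          intro y
          rw [pow_succ', Module.End.mul_apply]
          change z * ((f ^ n) y : B) = _
          rw [ih]; ring
      intro y
      simp [Polynomial.aeval_monomial, hpow, Algebra.smul_def, mul_assoc]
  have := key p ⟨1, h1⟩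
  rw [hpf] at this
  rw [← Polynomial.aeval_def]
  simpa using this.symm

theorem exists_norm_le_of_mem_span {R : Type*} [CommRing R] [Algebra ℂ R] (s : Set R)
    (g : (R →ₐ[ℂ] ℂ) → ℝ) (h : ∀ y ∈ s, ∃ c : ℝ, 0 ≤ c ∧ ∀ w, ‖w y‖ ≤ c * g w) {y : R}
    (hy : y ∈ Submodule.span ℂ s) : ∃ c : ℝ, 0 ≤ c ∧ ∀ w, ‖w y‖ ≤ c * g w := by
  induction hy using Submodule.span_induction with
  | mem y hy => exact h y hy
  | zero => exact ⟨0, le_rfl, by simp⟩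
  | add a b _ _ ha hb =>
    obtain ⟨c, hc, hcw⟩ := ha
    obtain ⟨d, hd, hdw⟩ := hb
    refine ⟨c + d, add_nonneg hc hd, fun w => ?_⟩
    rw [map_add, add_mul]
    exact (norm_add_le _ _).trans (add_le_add (hcw w) (hdw w))
  | smul a y _ hy =>
    obtain ⟨c, hc, hcw⟩ := hy
    refine ⟨‖a‖ * c, mul_nonneg (norm_nonneg _) hc, fun w => ?_⟩
    rw [map_smul, norm_smul, mul_assoc]
    exact mul_le_mul_of_nonneg_left (hcw w) (norm_nonneg _)

open scoped Pointwise in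
theorem exists_norm_le_of_mem_spanOne_pow {R : Type*} [CommRing R] [Algebra ℂ R] {n : ℕ}
    (x : Fin n → R) (j : ℕ) {y : R} (hy : y ∈ spanOne x ^ j) :
    ∃ c : ℝ, 0 ≤ c ∧ ∀ w : R →ₐ[ℂ] ℂ, ‖w y‖ ≤ c * (1 + ‖fun t => w (x t)‖) ^ j := by
  rw [spanOne, Submodule.span_pow] at hy
  refine exists_norm_le_of_mem_span _ _ (fun y hy => ⟨1, zero_le_one, fun w => ?_⟩) hy
  rw [one_mul]
  clear * - hy
  induction j generalizing y with
  | zero => simp_all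
  | succ j ih =>
    rw [pow_succ] at hy ⊢
    obtain ⟨a, ha, b, hb, rfl⟩ := hy
    simp only [map_mul, norm_mul]
    refine mul_le_mul (ih _ ha) ?_ (norm_nonneg _) (by positivity)
    rcases hb with rfl | ⟨t, rfl⟩
    · simp
    · exact (norm_le_pi_norm (fun t => w (x t)) t).trans (by simp)

/-- The consequences of a degree respecting Noether normalization for generic linear forms:
finiteness over any base, and properness for the points. -/
theorem exists_generic_normalization_properties {R : Type} [CommRing R] [Algebra ℂ R] {k n M : ℕ}
    (x : Fin n → R) (A₀ : Matrix (Fin k) (Fin n) ℂ)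
    (h : spanOne x ^ (M + 1) ≤ spanOne (linForms A₀ x) * spanOne x ^ M) :
    ∃ δ : MvPolynomial (Fin k × Fin n) ℂ, δ ≠ 0 ∧
      (∀ (S B : Type) [CommRing S] [CommRing B] [Algebra ℂ S] [Algebra S B] [Algebra ℂ B]
        [IsScalarTower ℂ S B] (ι : R →ₐ[ℂ] B) (A : Fin k × Fin n → S) (b : Fin k → S),
        (∀ j, algebraMap S B (b j) = ∑ t, A (j, t) • ι (x t)) →
          ∀ t, IsIntegral S (aeval A δ • ι (x t))) ∧
      ∀ A : Matrix (Fin k) (Fin n) ℂ, eval (fun p => A p.1 p.2) δ ≠ 0 → ∃ c : ℝ, 0 ≤ c ∧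
        ∀ w : R →ₐ[ℂ] ℂ, ‖fun t => w (x t)‖ ≤ c * (1 + ‖fun j => w (linForms A x j)‖) := by
  classical
  obtain ⟨δ, hδ, m, v, r₀, r, G, hv, hr₀, hr, key⟩ := exists_generic_normalization x A₀ h
  refine ⟨δ, hδ, ?_, ?_⟩
  · intro S B _ _ _ _ _ _ ι A b hb t
    -- By `key`, this finitely generated module is stable under multiplication by `δ(A) x t`.
    let N : Submodule S B := Submodule.span S (ι '' (spanOne x ^ M : Submodule ℂ R))
    have hfg : (spanOne x ^ M).FG := Submodule.FG.pow
      (Submodule.fg_span ((Set.finite_range x).insert 1)) _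
    have hmem : ∀ y ∈ spanOne x ^ M, ι y ∈ N := fun y hy => Submodule.subset_span ⟨y, hy, rfl⟩
    have hmem1 : ∀ y ∈ spanOne x ^ (M + 1), aeval A δ • ι y ∈ N := by
      intro y hy
      rw [← hv] at hy
      induction hy using Submodule.span_induction with
      | mem y hy =>
        obtain ⟨i, rfl⟩ := hy
        rw [key S B ι A b hb]
        exact Submodule.sum_mem _ fun l _ => Submodule.smul_mem _ _ (Submodule.add_mem _
          (hmem _ (hr₀ l)) (Submodule.sum_mem _ fun j _ => Submodule.smul_mem _ _ (hmem _ (hr l j))))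
      | zero => rw [map_zero, smul_zero]; exact Submodule.zero_mem _
      | add a b _ _ ha hb => rw [map_add, smul_add]; exact Submodule.add_mem _ ha hb
      | smul a y _ hy =>
        rw [map_smul, smul_comm, ← algebraMap_smul S a]; exact Submodule.smul_mem _ _ hy
    refine isIntegral_of_mul_mem N ?_ ?_ _ ?_
    · obtain ⟨F, hF⟩ := hfg
      refine ⟨F.image ι, le_antisymm ?_ ?_⟩
      · refine Submodule.span_mono ?_
        rw [Finset.coe_image, ← hF]
        exact Set.image_mono Submodule.subset_span
      · refine Submodule.span_le.2 ?_
        rintro _ ⟨y, hy, rfl⟩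
        rw [← hF] at hy
        rw [Finset.coe_image]
        have : ι y ∈ Submodule.span ℂ (ι '' (F : Set R)) := by
          rw [← AlgHom.coe_toLinearMap, Submodule.span_image]
          exact ⟨y, hy, rfl⟩
        exact Submodule.span_le_restrictScalars ℂ S _ this
    · rw [← map_one ι]
      exact hmem 1 (Submodule.one_le.1 (one_le_pow₀ (Submodule.one_le.2 (one_mem_spanOne x))))
    · intro y hy
      induction hy using Submodule.span_induction with
      | mem y hy =>
        obtain ⟨y, hy, rfl⟩ := hy
        rw [smul_mul_assoc, ← map_mul]
        refine hmem1 _ ?_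
        rw [pow_succ']
        exact Submodule.mul_mem_mul (mem_spanOne x t) hy
      | zero => rw [mul_zero]; exact Submodule.zero_mem _
      | add a b _ _ ha hb => rw [mul_add]; exact Submodule.add_mem _ ha hb
      | smul a y _ hy => rw [mul_smul_comm]; exact Submodule.smul_mem _ _ hy
  · intro A hA
    choose! c hc hcw using fun y (hy : y ∈ spanOne x ^ M) => exists_norm_le_of_mem_spanOne_pow x M hy
    have hv1 : ∀ i, ∃ C : ℝ, 0 ≤ C ∧ ∀ w : R →ₐ[ℂ] ℂ, ‖w (v i)‖ ≤
        C * ((1 + ‖fun t => w (x t)‖) ^ M * (1 + ‖fun j => w (linForms A x j)‖)) := by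
      intro i
      refine ⟨‖(eval (fun p => A p.1 p.2) δ)⁻¹‖ * ∑ l, ‖eval (fun p => A p.1 p.2) (G i l)‖ *
        (c (r₀ l) + ∑ j, c (r l j)), mul_nonneg (norm_nonneg _) (Finset.sum_nonneg fun l _ =>
          mul_nonneg (norm_nonneg _) (add_nonneg (hc _ (hr₀ l))
            (Finset.sum_nonneg fun j _ => hc _ (hr l j)))), fun w => ?_⟩
      have h1 := key ℂ ℂ w (fun p => A p.1 p.2) (fun j => w (linForms A x j))
        (fun j => by simp [linForms]) i
      simp only [aeval_eq_eval, smul_eq_mul] at h1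
      rw [← inv_mul_cancel_left₀ hA (w (v i)), h1, norm_mul, mul_assoc]
      refine mul_le_mul_of_nonneg_left ?_ (norm_nonneg _)
      rw [Finset.sum_mul]
      refine (norm_sum_le _ _).trans (Finset.sum_le_sum fun l _ => ?_)
      rw [norm_mul, mul_assoc]
      refine mul_le_mul_of_nonneg_left ?_ (norm_nonneg _)
      set X := (1 + ‖fun t => w (x t)‖) ^ M
      set Y := 1 + ‖fun j => w (linForms A x j)‖ with hY
      have hX : 0 ≤ X := by positivity
      have hY1 : 1 ≤ Y := by simp [Y]
      rw [add_mul, Finset.sum_mul]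
      refine (norm_add_le _ _).trans (add_le_add ?_ ((norm_sum_le _ _).trans
        (Finset.sum_le_sum fun j _ => ?_)))
      · calc ‖w (r₀ l)‖ ≤ c (r₀ l) * X := hcw _ (hr₀ l) w
          _ ≤ c (r₀ l) * (X * Y) := mul_le_mul_of_nonneg_left (le_mul_of_one_le_right hX hY1)
            (hc _ (hr₀ l))
      · rw [norm_mul]
        have h2 : ‖w (linForms A x j)‖ ≤ Y :=
          (norm_le_pi_norm (fun j => w (linForms A x j)) j).trans (by simp [Y])
        calc _ ≤ Y * (c (r l j) * X) := mul_le_mul h2 (hcw _ (hr l j) w) (norm_nonneg _)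
              (by linarith)
          _ = _ := by ring
    have hv2 : ∀ y ∈ spanOne x ^ (M + 1), ∃ C : ℝ, 0 ≤ C ∧ ∀ w : R →ₐ[ℂ] ℂ, ‖w y‖ ≤
        C * ((1 + ‖fun t => w (x t)‖) ^ M * (1 + ‖fun j => w (linForms A x j)‖)) := by
      intro y hy
      rw [← hv] at hy
      exact exists_norm_le_of_mem_span _ _ (by rintro _ ⟨i, rfl⟩; exact hv1 i) hy
    have hx1 : ∀ t, x t ^ (M + 1) ∈ spanOne x ^ (M + 1) := fun t =>
      Submodule.pow_mem_pow _ (mem_spanOne x t) _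
    choose C hC hCw using fun t => hv2 _ (hx1 t)
    obtain ⟨C₁, hC₁, hC₁w⟩ := hv2 1
      (Submodule.one_le.1 (one_le_pow₀ (Submodule.one_le.2 (one_mem_spanOne x))))
    have hCs : 0 ≤ ∑ t, C t := Finset.sum_nonneg fun t _ => hC t
    refine ⟨2 ^ M * (C₁ + ∑ t, C t), by positivity, fun w => ?_⟩
    set X := ‖fun t => w (x t)‖ with hX
    set Y := 1 + ‖fun j => w (linForms A x j)‖ with hY
    have hY0 : 0 ≤ Y := by positivity
    have hX0 : 0 ≤ X := norm_nonneg _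
    have h1 : ∀ t, C t ≤ C₁ + ∑ t, C t := fun t => by
      linarith [Finset.single_le_sum (fun t _ => hC t) (Finset.mem_univ t)]
    -- With `max 1 X` in place of `X`, division by the `M`-th power is possible even for small `X`.
    -- The constant `C₁` for the element `1` covers that case.
    have hmax : max 1 X ^ (M + 1) ≤ (C₁ + ∑ t, C t) * ((1 + X) ^ M * Y) := by
      rcases le_total X 1 with h | h
      · rw [max_eq_left h, one_pow]
        have h2 := hC₁w w
        rw [map_one, norm_one] at h2
        exact h2.trans (mul_le_mul_of_nonneg_right (by linarith) (by positivity))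
      · rw [max_eq_right h]
        obtain ⟨t, ht⟩ : ∃ t, ‖w (x t)‖ = X := by
          have hne : (Finset.univ : Finset (Fin n)).Nonempty := by
            by_contra hne
            have : IsEmpty (Fin n) := Finset.univ_eq_empty_iff.1 (Finset.not_nonempty_iff_eq_empty.1 hne)
            have : X = 0 := by rw [hX, Subsingleton.elim (fun t => w (x t)) 0, norm_zero]
            linarith
          obtain ⟨t, -, ht⟩ := Finset.exists_max_image Finset.univ (fun t => ‖w (x t)‖) hne
          exact ⟨t, le_antisymm (norm_le_pi_norm (fun t => w (x t)) t)
            ((pi_norm_le_iff_of_nonneg (norm_nonneg _)).2 fun s => ht s (Finset.mem_univ s))⟩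
        have h2 := hCw t w
        rw [map_pow, norm_pow, ht] at h2
        exact h2.trans (mul_le_mul_of_nonneg_right (h1 t) (by positivity))
    have h3 : (1 + X) ^ M ≤ 2 ^ M * max 1 X ^ M := by
      rw [← mul_pow]
      exact pow_le_pow_left₀ (by positivity)
        (by linarith [le_max_left 1 X, le_max_right 1 X]) _
    have hp : 0 < max 1 X ^ M := by positivity
    refine (le_max_right 1 X).trans (le_of_mul_le_mul_left ?_ hp)
    calc max 1 X ^ M * max 1 X = max 1 X ^ (M + 1) := (pow_succ _ _).symm
      _ ≤ (C₁ + ∑ t, C t) * ((1 + X) ^ M * Y) := hmax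
      _ ≤ (C₁ + ∑ t, C t) * ((2 ^ M * max 1 X ^ M) * Y) := by gcongr
      _ = _ := by ring

/-- Chains of primes contract strictly by incomparability and lift by lying over and going up. -/
theorem ringKrullDim_eq_of_isIntegral {R S : Type*} [CommRing R] [CommRing S] [Algebra R S]
    [Algebra.IsIntegral R S] (h : Function.Injective (algebraMap R S)) :
    ringKrullDim S = ringKrullDim R := by
  apply le_antisymm
  · refine Order.krullDim_le_of_strictMono (PrimeSpectrum.comap (algebraMap R S)) ?_
    intro P Q hPQ
    exact Ideal.IsIntegral.comap_lt_comap (R := R) (I := P.asIdeal) (J := Q.asIdeal) hPQ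
  · refine iSup_le fun l => ?_
    obtain ⟨P, -, hP, hPl⟩ := Ideal.exists_ideal_over_prime_of_isIntegral (S := S)
      (RelSeries.head l).asIdeal ⊥ (by
        rw [← RingHom.ker_eq_comap_bot, (RingHom.injective_iff_ker_eq_bot _).1 h]; exact bot_le)
    have : P.LiesOver (RelSeries.head l).asIdeal := ⟨hPl.symm⟩
    have := Algebra.HasGoingUp.of_isIntegral (R := R) (S := S)
    obtain ⟨L, hL, -⟩ := Ideal.exists_ltSeries_of_hasGoingUp l P
    rw [← hL]
    exact le_iSup (fun p : LTSeries (PrimeSpectrum S) => (p.length : WithBot ℕ∞)) L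

theorem IsPointwiseAlgebraic.algebraicIndependent {T : Type*} [CommRing T] [Algebra ℂ T] {k : ℕ}
    {l l' : Fin k → T} (hl : IsPointwiseAlgebraic l) (hl' : AlgebraicIndependent ℂ l') :
    AlgebraicIndependent ℂ l := by
  obtain ⟨P, hP, -, hPl⟩ := exists_prime_algebraicIndependent l' ⊥ (fun s hs =>
    (algebraicIndependent_iff.1 hl') s (by simpa using hs))
  have h1 := (card_le_of_algebraicIndependent _ _ (hl.isAlgebraic_fractionRing P) hPl).2 rfl
  refine algebraicIndependent_iff.2 fun s hs => (algebraicIndependent_iff.1 h1) s ?_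
  rw [aeval_algebraMap_comp, hs, map_zero]

theorem isIntegral_of_generators {S B R : Type*} [CommRing S] [CommRing B] [CommRing R]
    [Algebra ℂ R] [Algebra ℂ S] [Algebra S B] [Algebra ℂ B] [IsScalarTower ℂ S B] {ι : Type*}
    {x : ι → R} (hx : Algebra.adjoin ℂ (Set.range x) = ⊤) (f : R →ₐ[ℂ] B)
    (h : ∀ i, IsIntegral S (f (x i))) (r : R) : IsIntegral S (f r) := by
  have h1 : Algebra.adjoin ℂ (Set.range x) ≤
      ((integralClosure S B).restrictScalars ℂ).comap f :=
    Algebra.adjoin_le (by rintro _ ⟨i, rfl⟩; exact h i)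
  rw [hx] at h1
  exact h1 (Algebra.mem_top (R := ℂ) (x := r))

theorem isPointwiseAlgebraic_of_isIntegral {R : Type*} [CommRing R] [Algebra ℂ R] {k : ℕ}
    (l : Fin k → R) (h : (aeval l : MvPolynomial (Fin k) ℂ →ₐ[ℂ] R).toRingHom.IsIntegral) :
    IsPointwiseAlgebraic l := by
  intro P hP t
  let L := FractionRing (R ⧸ P)
  obtain ⟨p, hp, hpt⟩ := h t
  refine IsIntegral.isAlgebraic ?_
  let g : MvPolynomial (Fin k) ℂ →ₐ[ℂ]
      Algebra.adjoin ℂ (Set.range fun i => algebraMap R L (l i)) :=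
    aeval fun i => ⟨_, Algebra.subset_adjoin ⟨i, rfl⟩⟩
  refine ⟨p.map g.toRingHom, hp.map _, ?_⟩
  have h1 : (algebraMap (Algebra.adjoin ℂ (Set.range fun i => algebraMap R L (l i))) L).comp
      g.toRingHom = (algebraMap R L).comp (aeval l : MvPolynomial (Fin k) ℂ →ₐ[ℂ] R).toRingHom := by
    refine MvPolynomial.ringHom_ext (fun c => ?_) (fun i => ?_)
    · simp [g, ← IsScalarTower.algebraMap_apply]
    · simp [g]
  rw [Polynomial.eval₂_map, h1, ← Polynomial.hom_eval₂, hpt, map_zero]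

/-- `k` linear forms with generic coefficients `A` form a Noether normalization of an affine algebra
of dimension `k`, which moreover is proper on points with a linear bound. The polynomial `δ`
describes the exceptional coefficients. -/
theorem exists_generic_noether_normalization {R : Type} [CommRing R] [Nontrivial R] [Algebra ℂ R]
    {n : ℕ} (x : Fin n → R) (hx : Algebra.adjoin ℂ (Set.range x) = ⊤) :
    ∃ (k : ℕ) (δ : MvPolynomial (Fin k × Fin n) ℂ), ringKrullDim R = k ∧ δ ≠ 0 ∧
      (∀ t, (aeval (Sum.elim X fun j => ∑ t, X (j, t) * C (x t)) :
        MvPolynomial (Fin k × Fin n ⊕ Fin k) ℂ →ₐ[ℂ] MvPolynomial (Fin k × Fin n) R).toRingHom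
          |>.IsIntegralElem (aeval X δ * C (x t))) ∧
      ∀ A : Matrix (Fin k) (Fin n) ℂ, eval (fun p => A p.1 p.2) δ ≠ 0 →
        (aeval (linForms A x) : MvPolynomial (Fin k) ℂ →ₐ[ℂ] R).toRingHom.IsIntegral ∧
        AlgebraicIndependent ℂ (linForms A x) ∧
        ∃ c : ℝ, 0 ≤ c ∧
          ∀ w : R →ₐ[ℂ] ℂ, ‖fun t => w (x t)‖ ≤ c * (1 + ‖fun j => w (linForms A x j)‖) := by
  obtain ⟨k, A₀, M, hA₀, hM⟩ := exists_noether_normalization x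
  obtain ⟨δ, hδ, hint, hgr⟩ := exists_generic_normalization_properties x A₀ hM
  have hint' : ∀ A : Matrix (Fin k) (Fin n) ℂ, eval (fun p => A p.1 p.2) δ ≠ 0 →
      (aeval (linForms A x) : MvPolynomial (Fin k) ℂ →ₐ[ℂ] R).toRingHom.IsIntegral := by
    intro A hA
    let := (aeval (linForms A x) : MvPolynomial (Fin k) ℂ →ₐ[ℂ] R).toRingHom.toAlgebra
    have : IsScalarTower ℂ (MvPolynomial (Fin k) ℂ) R := .of_algebraMap_eq fun c =>
      ((aeval (linForms A x) : MvPolynomial (Fin k) ℂ →ₐ[ℂ] R).commutes c).symm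
    intro r
    refine isIntegral_of_generators (S := MvPolynomial (Fin k) ℂ) hx (AlgHom.id ℂ R) (fun t => ?_) r
    have h1 := hint (MvPolynomial (Fin k) ℂ) R (AlgHom.id ℂ R) (fun p => C (A p.1 p.2)) X (fun j => by
      change aeval (linForms A x) (X j) = _
      rw [aeval_X, linForms]
      refine Finset.sum_congr rfl fun t _ => ?_
      rw [← algebraMap_eq, algebraMap_smul]; rfl) t
    have h2 : aeval (fun p : Fin k × Fin n => (C (A p.1 p.2) : MvPolynomial (Fin k) ℂ)) δ =
        C (eval (fun p => A p.1 p.2) δ) := by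
      rw [← aeval_eq_eval, ← algebraMap_eq, ← aeval_algebraMap_apply]; rfl
    rw [h2, ← algebraMap_eq, algebraMap_smul] at h1
    have h3 := h1.smul (eval (fun p => A p.1 p.2) δ)⁻¹
    rwa [smul_smul, inv_mul_cancel₀ hA, one_smul] at h3
  have hind : ∀ A : Matrix (Fin k) (Fin n) ℂ, eval (fun p => A p.1 p.2) δ ≠ 0 →
      AlgebraicIndependent ℂ (linForms A x) := fun A hA =>
    (isPointwiseAlgebraic_of_isIntegral _ (hint' A hA)).algebraicIndependent hA₀
  refine ⟨k, δ, ?_, hδ, ?_, fun A hA => ⟨hint' A hA, hind A hA, hgr A hA⟩⟩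
  · obtain ⟨a, ha⟩ : ∃ a, eval a δ ≠ 0 := by
      by_contra! h
      exact hδ (MvPolynomial.funext fun a => by simpa using h a)
    let A : Matrix (Fin k) (Fin n) ℂ := Matrix.of fun i j => a (i, j)
    let := (aeval (linForms A x) : MvPolynomial (Fin k) ℂ →ₐ[ℂ] R).toRingHom.toAlgebra
    have : Algebra.IsIntegral (MvPolynomial (Fin k) ℂ) R := ⟨hint' A ha⟩
    rw [ringKrullDim_eq_of_isIntegral (R := MvPolynomial (Fin k) ℂ) (hind A ha)]
    simp
  · intro t
    let f : MvPolynomial (Fin k × Fin n ⊕ Fin k) ℂ →ₐ[ℂ] MvPolynomial (Fin k × Fin n) R :=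
      aeval (Sum.elim X fun j => ∑ t, X (j, t) * C (x t))
    let := f.toRingHom.toAlgebra
    have : IsScalarTower ℂ (MvPolynomial (Fin k × Fin n ⊕ Fin k) ℂ)
      (MvPolynomial (Fin k × Fin n) R) := .of_algebraMap_eq fun c => (f.commutes c).symm
    have h1 := hint (MvPolynomial (Fin k × Fin n ⊕ Fin k) ℂ) (MvPolynomial (Fin k × Fin n) R)
      (IsScalarTower.toAlgHom ℂ R _) (fun p => X (Sum.inl p)) (fun j => X (Sum.inr j)) (fun j => by
        change f (X (Sum.inr j)) = _
        simp only [Algebra.smul_def]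
        change _ = ∑ t, f (X (Sum.inl (j, t))) * C (x t)
        simp [f]) t
    rw [Algebra.smul_def] at h1
    have h2 : algebraMap (MvPolynomial (Fin k × Fin n ⊕ Fin k) ℂ) (MvPolynomial (Fin k × Fin n) R)
        (aeval (fun p => X (Sum.inl p)) δ) = aeval X δ := by
      change f _ = _
      rw [← AlgHom.comp_apply, comp_aeval]
      simp [f]
    rw [h2] at h1
    exact h1

/-! ### Coordinate rings and their points. -/

/-- The coordinate ring of a subset of affine space. -/
abbrev CoordinateRing {n : ℕ} (X : Set (Fin n → ℂ)) : Type :=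
  MvPolynomial (Fin n) ℂ ⧸ vanishingIdeal ℂ X

theorem isReduced_coordinateRing {n : ℕ} (X : Set (Fin n → ℂ)) : IsReduced (CoordinateRing X) := by
  refine (Ideal.isRadical_iff_quotient_reduced _).1 ?_
  rintro p ⟨N, hp⟩ x hx
  have := hp x hx
  rw [map_pow] at this
  exact pow_eq_zero_iff (by rintro rfl; simp at this) |>.1 this

theorem nontrivial_coordinateRing {n : ℕ} {X : Set (Fin n → ℂ)} (hX : X.Nonempty) :
    Nontrivial (CoordinateRing X) := by
  refine Ideal.Quotient.nontrivial_iff.2 fun h => ?_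
  obtain ⟨x, hx⟩ := hX
  have : (1 : MvPolynomial (Fin n) ℂ) ∈ vanishingIdeal ℂ X := h ▸ Submodule.mem_top
  simpa using this x hx

/-- The coordinate functions. -/
noncomputable def coord {n : ℕ} (X : Set (Fin n → ℂ)) (t : Fin n) : CoordinateRing X :=
  Ideal.Quotient.mk _ (MvPolynomial.X t)

theorem aeval_coord {n : ℕ} (X : Set (Fin n → ℂ)) (p : MvPolynomial (Fin n) ℂ) :
    aeval (coord X) p = Ideal.Quotient.mk _ p := by
  have : aeval (coord X) = Ideal.Quotient.mkₐ ℂ (vanishingIdeal ℂ X) := by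
    ext i; simp [coord]
  rw [this]; rfl

theorem adjoin_coord {n : ℕ} (X : Set (Fin n → ℂ)) :
    Algebra.adjoin ℂ (Set.range (coord X)) = ⊤ := by
  rw [Algebra.adjoin_range_eq_range_aeval, AlgHom.range_eq_top]
  intro r
  obtain ⟨p, rfl⟩ := Ideal.Quotient.mk_surjective r
  exact ⟨p, aeval_coord X p⟩

/-- Evaluation at a point. -/
noncomputable def evalAt {n : ℕ} {X : Set (Fin n → ℂ)} (x : X) : CoordinateRing X →ₐ[ℂ] ℂ :=
  Ideal.Quotient.liftₐ _ (aeval x.1) fun _ hp => hp x.1 x.2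

theorem evalAt_mk {n : ℕ} {X : Set (Fin n → ℂ)} (x : X) (p : MvPolynomial (Fin n) ℂ) :
    evalAt x (Ideal.Quotient.mk _ p) = eval x.1 p := by
  simp [evalAt, ← aeval_eq_eval]

theorem evalAt_coord {n : ℕ} {X : Set (Fin n → ℂ)} (x : X) (t : Fin n) :
    evalAt x (coord X t) = x.1 t := by simp [coord, evalAt_mk]

theorem coordinateRing_algHom_ext {n : ℕ} {X : Set (Fin n → ℂ)} {B : Type*} [CommRing B]
    [Algebra ℂ B] {w w' : CoordinateRing X →ₐ[ℂ] B} (h : ∀ t, w (coord X t) = w' (coord X t)) :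
    w = w' :=
  AlgHom.ext_of_adjoin_eq_top (adjoin_coord X) (by rintro _ ⟨t, rfl⟩; exact h t)

theorem IsAlgebraicSet.mem_of_forall {n : ℕ} {X : Set (Fin n → ℂ)} (hX : IsAlgebraicSet X)
    {x : Fin n → ℂ} (h : ∀ p ∈ vanishingIdeal ℂ X, eval x p = 0) : x ∈ X := by
  obtain ⟨I, rfl⟩ := hX
  intro p hp
  rw [aeval_eq_eval]
  exact h p (le_vanishingIdeal_zeroLocus I hp)

theorem IsAlgebraicSet.coord_mem {n : ℕ} {X : Set (Fin n → ℂ)} (hX : IsAlgebraicSet X)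
    (w : CoordinateRing X →ₐ[ℂ] ℂ) : (fun t => w (coord X t)) ∈ X := by
  refine hX.mem_of_forall fun p hp => ?_
  have h : w (Ideal.Quotient.mk _ p) = eval (fun t => w (coord X t)) p := by
    rw [← aeval_coord, ← aeval_eq_eval]
    change (w.comp (aeval (coord X))) p = _
    rw [comp_aeval]
  rw [← h, Ideal.Quotient.eq_zero_iff_mem.2 hp, map_zero]

theorem evalAt_linForms {k n : ℕ} {X : Set (Fin n → ℂ)} (x : X) (A : Matrix (Fin k) (Fin n) ℂ)
    (i : Fin k) : evalAt x (linForms A (coord X) i) = A.mulVec x.1 i := by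
  simp [linForms, evalAt_coord, Matrix.mulVec, dotProduct]

/-! ### Existence of the degree. -/

/-- `HasDegree` with the number of equations as a parameter. -/
def HasDegreeOfDim {n : ℕ} (X : Set (Fin n → ℂ)) (k d : ℕ) : Prop :=
  ∃ P : MvPolynomial ((Fin k × Fin n) ⊕ Fin k) ℂ, P ≠ 0 ∧
    ∀ (A : Matrix (Fin k) (Fin n) ℂ) (b : Fin k → ℂ),
      eval (Sum.elim (fun ij => A ij.1 ij.2) b) P ≠ 0 → {x ∈ X | A.mulVec x = b}.encard = d

/-- `T` is the coordinate ring of the universal family of pairs `(A, x)`, mapped to `(A, b)` by `b =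
A x`. The fibre over `(A, b)` is the linear section of `X`, so the generic fibre count applies with
`A` and `b` varying together. -/
theorem exists_hasDegreeOfDim {n k : ℕ} {X : Set (Fin n → ℂ)} (hX : IsAlgebraicSet X)
    (δ : MvPolynomial (Fin k × Fin n) ℂ) (hδ : δ ≠ 0)
    (h : ∀ t, (aeval (Sum.elim MvPolynomial.X fun j => ∑ t, MvPolynomial.X (j, t) * C (coord X t)) :
        MvPolynomial (Fin k × Fin n ⊕ Fin k) ℂ →ₐ[ℂ]
          MvPolynomial (Fin k × Fin n) (CoordinateRing X)).toRingHom
          |>.IsIntegralElem (aeval MvPolynomial.X δ * C (coord X t))) :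
    ∃ d, HasDegreeOfDim X k d := by
  classical
  have := isReduced_coordinateRing X
  let T := MvPolynomial (Fin k × Fin n) (CoordinateRing X)
  let l : Fin k × Fin n ⊕ Fin k → T :=
    Sum.elim MvPolynomial.X fun j => ∑ t, MvPolynomial.X (j, t) * C (coord X t)
  obtain ⟨D, -, -, P, hP, -, hPD⟩ := exists_generic_rank l
    (Finset.univ.image (MvPolynomial.X) ∪ Finset.univ.image fun t => C (coord X t)) (by
      rw [eq_top_iff]
      rintro p -
      set G : Set T := ((Finset.univ.image (MvPolynomial.X) ∪
        Finset.univ.image fun t => C (coord X t) : Finset T) : Set T) with hG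
      induction p using MvPolynomial.induction_on with
      | C a =>
        have h1 : Algebra.adjoin ℂ (Set.range (coord X)) ≤
            (Algebra.adjoin ℂ G).comap (IsScalarTower.toAlgHom ℂ (CoordinateRing X) T) :=
          Algebra.adjoin_le (by
            rintro _ ⟨t, rfl⟩
            exact Algebra.subset_adjoin (by rw [hG, Finset.mem_coe, Finset.mem_union]; exact Or.inr (Finset.mem_image_of_mem _ (Finset.mem_univ t))))
        rw [adjoin_coord] at h1
        exact h1 (Algebra.mem_top (R := ℂ) (x := a))
      | add p q hp hq => exact add_mem hp hq
      | mul_X p i hp => exact mul_mem hp (Algebra.subset_adjoin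
        (by rw [hG, Finset.mem_coe, Finset.mem_union]; exact Or.inl (Finset.mem_image_of_mem _ (Finset.mem_univ i))))) (by
      intro t ht
      rcases Finset.mem_union.1 ht with ht | ht
      · obtain ⟨p, -, rfl⟩ := Finset.mem_image.1 ht
        refine ⟨1, one_ne_zero, ?_⟩
        have h1 : aeval l (1 : MvPolynomial (Fin k × Fin n ⊕ Fin k) ℂ) * MvPolynomial.X p =
            (aeval l : MvPolynomial (Fin k × Fin n ⊕ Fin k) ℂ →ₐ[ℂ] T).toRingHom
              (MvPolynomial.X (Sum.inl p)) := by
          rw [map_one, one_mul]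
          exact (aeval_X l (Sum.inl p)).symm
        rw [h1]
        exact RingHom.isIntegralElem_map _
      · obtain ⟨t, -, rfl⟩ := Finset.mem_image.1 ht
        refine ⟨rename Sum.inl δ, ?_, ?_⟩
        · rw [Ne, map_eq_zero_iff _ (rename_injective _ Sum.inl_injective)]; exact hδ
        · rw [aeval_rename]; exact h t)
  refine ⟨D, P, hP, fun A b hAb => ?_⟩
  rw [← hPD _ hAb]
  have hA : ∀ w ∈ pointFibre l (Sum.elim (fun ij => A ij.1 ij.2) b), ∀ p,
      w (MvPolynomial.X p) = A p.1 p.2 := fun w hw p => hw (Sum.inl p)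
  symm
  rw [← Set.InjOn.encard_image (f := fun (w : T →ₐ[ℂ] ℂ) t => w (C (coord X t)))]
  · congr 1
    ext x
    constructor
    · rintro ⟨w, hw, rfl⟩
      refine ⟨hX.coord_mem (w.comp (IsScalarTower.toAlgHom ℂ (CoordinateRing X) T)), ?_⟩
      funext j
      have := hw (Sum.inr j)
      simp only [l, Sum.elim_inr, map_sum, map_mul, hA w hw] at this
      exact this
    · rintro ⟨hx, hAx⟩
      let w : T →ₐ[ℂ] ℂ := aevalTower (evalAt ⟨x, hx⟩) (fun p => A p.1 p.2)
      have hw1 : ∀ p, w (MvPolynomial.X p) = A p.1 p.2 := aevalTower_X _ _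
      have hw2 : ∀ t, w (C (coord X t)) = x t := fun t =>
        (aevalTower_C _ _ _).trans (evalAt_coord _ t)
      refine ⟨w, ?_, funext hw2⟩
      rintro (p | j)
      · exact hw1 p
      · simp [l, hw1, hw2, ← hAx, Matrix.mulVec, dotProduct]
  · intro w hw w' hw' h
    refine MvPolynomial.algHom_ext' ?_ ?_
    · exact coordinateRing_algHom_ext fun t => congrFun h t
    · intro p
      rw [hA w hw, hA w' hw']

/-! ### Principal localizations. -/

/-- `π` identifies `T` with the localization of `R` away from the nonzerodivisor `h`. -/
structure IsPrincipalLocalization {R T : Type*} [CommRing R] [CommRing T] [Algebra ℂ R]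
    [Algebra ℂ T] (π : R →ₐ[ℂ] T) (h : R) : Prop where
  injective : Function.Injective π
  isUnit : IsUnit (π h)
  exists_pow_mul_eq : ∀ t, ∃ (N : ℕ) (p : R), π h ^ N * t = π p

namespace IsPrincipalLocalization

variable {R T : Type*} [CommRing R] [CommRing T] [Algebra ℂ R] [Algebra ℂ T] {π : R →ₐ[ℂ] T} {h : R}

theorem eq_zero_of_mul_eq_zero (hπ : IsPrincipalLocalization π h) {z : R} (hz : z * h = 0) :
    z = 0 := by
  refine hπ.injective ?_
  rw [map_zero, ← hπ.isUnit.mul_left_eq_zero, ← map_mul, hz, map_zero]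

theorem algHom_ext (hπ : IsPrincipalLocalization π h) {B : Type*} [CommRing B] [Algebra ℂ B]
    {w w' : T →ₐ[ℂ] B} (hw : w.comp π = w'.comp π) : w = w' := by
  ext t
  obtain ⟨N, p, hp⟩ := hπ.exists_pow_mul_eq t
  have hw' : ∀ r, w (π r) = w' (π r) := fun r => AlgHom.congr_fun hw r
  have h1 := congrArg w hp
  have h2 := congrArg w' hp
  rw [map_mul, map_pow, hw'] at h1
  rw [map_mul, map_pow, ← hw' p, ← h1] at h2
  exact ((((hπ.isUnit.map w').pow N).mul_left_cancel) h2).symm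

theorem exists_algHom_of_ne_zero (hπ : IsPrincipalLocalization π h) {w : R →ₐ[ℂ] ℂ}
    (hw : w h ≠ 0) : ∃ w' : T →ₐ[ℂ] ℂ, w'.comp π = w := by
  let := π.toRingHom.toAlgebra
  have hloc : IsLocalization.Away h T := by
    refine ⟨fun y => ?_, fun t => ?_, fun hxy => ⟨1, by rw [hπ.injective hxy]⟩⟩
    · obtain ⟨_, N, rfl⟩ := y
      change IsUnit (π (h ^ N))
      rw [map_pow]
      exact hπ.isUnit.pow N
    · obtain ⟨N, p, hp⟩ := hπ.exists_pow_mul_eq t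
      refine ⟨(p, ⟨h ^ N, N, rfl⟩), ?_⟩
      change t * π (h ^ N) = π p
      rw [map_pow, mul_comm, hp]
  let w' : T →+* ℂ := IsLocalization.Away.lift (S := T) h (g := (w : R →+* ℂ))
    (isUnit_iff_ne_zero.2 hw)
  have hw' : ∀ r, w' (π r) = w r := fun r => IsLocalization.Away.lift_eq h _ r
  refine ⟨{ w' with commutes' := fun c => ?_ }, AlgHom.ext hw'⟩
  change w' (algebraMap ℂ T c) = _
  rw [← π.commutes, hw', w.commutes]

theorem isPointwiseAlgebraic (hπ : IsPrincipalLocalization π h) {k : ℕ} {l : Fin k → R}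
    (hl : (aeval l : MvPolynomial (Fin k) ℂ →ₐ[ℂ] R).toRingHom.IsIntegral) :
    IsPointwiseAlgebraic fun i => π (l i) := by
  intro P hP t
  let L := FractionRing (T ⧸ P)
  have hR : ∀ r : R, IsAlgebraic
      (Algebra.adjoin ℂ (Set.range fun i => algebraMap T L (π (l i)))) (algebraMap T L (π r)) := by
    intro r
    obtain ⟨p, hp, hpt⟩ := hl r
    refine IsIntegral.isAlgebraic ?_
    let g : MvPolynomial (Fin k) ℂ →ₐ[ℂ]
        Algebra.adjoin ℂ (Set.range fun i => algebraMap T L (π (l i))) :=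
      aeval fun i => ⟨_, Algebra.subset_adjoin ⟨i, rfl⟩⟩
    refine ⟨p.map g.toRingHom, hp.map _, ?_⟩
    have h1 : (algebraMap (Algebra.adjoin ℂ (Set.range fun i => algebraMap T L (π (l i)))) L).comp
        g.toRingHom = ((algebraMap T L).comp π.toRingHom).comp
          (aeval l : MvPolynomial (Fin k) ℂ →ₐ[ℂ] R).toRingHom := by
      refine MvPolynomial.ringHom_ext (fun c => ?_) (fun i => ?_)
      · simp [g, ← IsScalarTower.algebraMap_apply]
      · simp [g]
    have h2 : algebraMap T L (π r) = ((algebraMap T L).comp π.toRingHom) r := rfl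
    rw [Polynomial.eval₂_map, h1, h2, ← Polynomial.hom_eval₂, hpt, map_zero]
  obtain ⟨N, p, hp⟩ := hπ.exists_pow_mul_eq t
  have h3 : algebraMap T L t = (algebraMap T L (π h) ^ N)⁻¹ * algebraMap T L (π p) := by
    rw [← hp, map_mul, map_pow, inv_mul_cancel_left₀]
    exact pow_ne_zero _ (hπ.isUnit.map (algebraMap T L)).ne_zero
  change IsAlgebraic _ (algebraMap T L t)
  rw [h3]
  exact ((hR h).pow N).inv.mul (hR p)

theorem algebraicIndependent (hπ : IsPrincipalLocalization π h) {k : ℕ} {l : Fin k → R}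
    (hl : AlgebraicIndependent ℂ l) : AlgebraicIndependent ℂ fun i => π (l i) :=
  hl.map' hπ.injective

/-- A nonzerodivisor which is integral over `ℂ[l]` divides a nonzero element of `ℂ[l]`. -/
theorem exists_aeval_eq_mul (hπ : IsPrincipalLocalization π h) [Nontrivial R] {k : ℕ}
    {l : Fin k → R} (hl : (aeval l : MvPolynomial (Fin k) ℂ →ₐ[ℂ] R).toRingHom.IsIntegral) :
    ∃ (s : MvPolynomial (Fin k) ℂ) (a : R), s ≠ 0 ∧ aeval l s = h * a := by
  obtain ⟨p, hp, hph⟩ := hl h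
  obtain ⟨i, hi, hmem⟩ := Ideal.exists_coeff_ne_zero_mem_comap_of_non_zero_divisor_root_mem
    (I := Ideal.span {h}) (f := (aeval l : MvPolynomial (Fin k) ℂ →ₐ[ℂ] R).toRingHom)
    (fun {x} hx => hπ.eq_zero_of_mul_eq_zero hx) (Ideal.mem_span_singleton_self h) hp.ne_zero hph
  obtain ⟨a, ha⟩ := Ideal.mem_span_singleton'.1 hmem
  exact ⟨_, a, hi, by rw [mul_comm, ha]; rfl⟩

end IsPrincipalLocalization

theorem MvPolynomial.exists_eval_ne_zero {σ : Type*} {p : MvPolynomial σ ℂ} (hp : p ≠ 0) :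
    ∃ s, eval s p ≠ 0 := by
  by_contra! h
  exact hp (MvPolynomial.funext fun s => by simpa using h s)

/-- The generic rank `D` of `T` is identified with `d` by counting the points over one suitable `b`.
-/
theorem IsPrincipalLocalization.exists_isGenericBasisOver {n k : ℕ} {X : Set (Fin n → ℂ)}
    (hX : IsAlgebraicSet X) [Nontrivial (CoordinateRing X)] {T : Type*} [CommRing T] [IsReduced T]
    [Algebra ℂ T] {π : CoordinateRing X →ₐ[ℂ] T} {h : CoordinateRing X}
    (hπ : IsPrincipalLocalization π h) (A : Matrix (Fin k) (Fin n) ℂ)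
    (hA : (aeval (linForms A (coord X)) :
      MvPolynomial (Fin k) ℂ →ₐ[ℂ] CoordinateRing X).toRingHom.IsIntegral) (d : ℕ)
    (p : MvPolynomial (Fin k) ℂ) (hp : p ≠ 0)
    (hd : ∀ b, eval b p ≠ 0 → {x ∈ X | A.mulVec x = b}.encard = d) :
    ∃ (e : Fin d → T) (Q : MvPolynomial (Fin k) ℂ),
      IsGenericBasisOver (fun i => π (linForms A (coord X) i)) e Q := by
  classical
  set l : Fin k → T := fun i => π (linForms A (coord X) i) with hl
  have hlπ : ∀ s : MvPolynomial (Fin k) ℂ, aeval l s = π (aeval (linForms A (coord X)) s) := by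
    intro s
    change _ = (π.comp (aeval (linForms A (coord X)))) s
    rw [comp_aeval]
  have hint : ∀ r, (aeval l : MvPolynomial (Fin k) ℂ →ₐ[ℂ] T).toRingHom.IsIntegralElem (π r) := by
    intro r
    obtain ⟨f, hf, hfr⟩ := hA r
    refine ⟨f, hf, ?_⟩
    have : (aeval l : MvPolynomial (Fin k) ℂ →ₐ[ℂ] T).toRingHom =
      π.toRingHom.comp (aeval (linForms A (coord X)) :
        MvPolynomial (Fin k) ℂ →ₐ[ℂ] CoordinateRing X).toRingHom := RingHom.ext hlπ
    rw [this]
    change Polynomial.eval₂ _ (π.toRingHom r) f = 0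
    rw [← Polynomial.hom_eval₂, hfr, map_zero]
  obtain ⟨s, a, hs, hsa⟩ := hπ.exists_aeval_eq_mul hA
  obtain ⟨u, hu⟩ := hπ.isUnit
  obtain ⟨D, e, Q, P, hP, he, hD⟩ := exists_generic_rank l
    (insert (↑u⁻¹ : T) (Finset.univ.image fun t => π (coord X t))) (by
      rw [eq_top_iff]
      rintro t -
      have hmem : ∀ r, π r ∈ Algebra.adjoin ℂ
          ((insert (↑u⁻¹ : T) (Finset.univ.image fun t => π (coord X t)) : Finset T) : Set T) := by
        intro r
        have h1 : Algebra.adjoin ℂ (Set.range (coord X)) ≤ (Algebra.adjoin ℂ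
          ((insert (↑u⁻¹ : T) (Finset.univ.image fun t => π (coord X t)) :
            Finset T) : Set T)).comap π := Algebra.adjoin_le (by
          rintro _ ⟨t, rfl⟩
          exact Algebra.subset_adjoin (by simp))
        rw [adjoin_coord] at h1
        exact h1 (Algebra.mem_top (R := ℂ) (x := r))
      obtain ⟨N, q, hq⟩ := hπ.exists_pow_mul_eq t
      have ht : t = (↑u⁻¹ : T) ^ N * π q := by
        rw [← hq, ← hu, ← mul_assoc, ← mul_pow, Units.inv_mul, one_pow, one_mul]
      rw [ht]
      exact mul_mem (pow_mem (Algebra.subset_adjoin (by simp)) N) (hmem q)) (by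
      intro t ht
      rcases Finset.mem_insert.1 ht with rfl | ht
      · refine ⟨s, hs, ?_⟩
        have h1 : aeval l s * (↑u⁻¹ : T) = π a := by
          rw [hlπ, hsa, map_mul, ← hu, mul_right_comm, Units.mul_inv, one_mul]
        rw [h1]
        exact hint a
      · obtain ⟨t, -, rfl⟩ := Finset.mem_image.1 ht
        exact ⟨1, one_ne_zero, by rw [map_one, one_mul]; exact hint _⟩)
  suffices hDd : D = d by subst hDd; exact ⟨e, Q, he⟩
  obtain ⟨b, hb⟩ := MvPolynomial.exists_eval_ne_zero (mul_ne_zero (mul_ne_zero hp hP) hs)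
  rw [map_mul, map_mul] at hb
  have hb1 := left_ne_zero_of_mul (left_ne_zero_of_mul hb)
  have hb2 := right_ne_zero_of_mul (left_ne_zero_of_mul hb)
  have hb3 := right_ne_zero_of_mul hb
  have hcard := hd b hb1
  rw [← ENat.natCast_inj, ← hD b hb2, ← hcard]
  rw [← Set.InjOn.encard_image (f := fun (w : T →ₐ[ℂ] ℂ) t => w (π (coord X t)))]
  · congr 1
    ext x
    constructor
    · rintro ⟨w, hw, rfl⟩
      refine ⟨hX.coord_mem (w.comp π), funext fun i => ?_⟩
      rw [← hw i]
      simp [l, linForms, Matrix.mulVec, dotProduct]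
    · rintro ⟨hx, hxb⟩
      -- `h` divides `s(l)` and `s(b) ≠ 0`, so no point of the section is lost in the localization.
      have hh : evalAt ⟨x, hx⟩ h ≠ 0 := by
        intro h0
        have h1 := congrArg (evalAt ⟨x, hx⟩) hsa
        rw [map_mul, h0, zero_mul, ← AlgHom.comp_apply, comp_aeval, aeval_eq_eval] at h1
        refine hb3 ?_
        rw [← h1]
        congr 2
        funext i
        rw [evalAt_linForms, ← hxb]
      obtain ⟨w, hw⟩ := hπ.exists_algHom_of_ne_zero hh
      have hw' : ∀ r, w (π r) = evalAt ⟨x, hx⟩ r := fun r => AlgHom.congr_fun hw r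
      refine ⟨w, fun i => ?_, funext fun t => ?_⟩
      · rw [hl, hw', evalAt_linForms, ← hxb]
      · exact (hw' _).trans (evalAt_coord _ t)
  · intro w _ w' _ hww
    exact hπ.algHom_ext (coordinateRing_algHom_ext fun t => congrFun hww t)

/-! ### Regular functions and common denominators. -/

section
variable {n m : ℕ}

/-- The functions which are regular on `U`. -/
def regularFunctions (U : Set (Fin n → ℂ)) : Subalgebra ℂ ((Fin n → ℂ) → ℂ) where
  carrier := {g | ∀ u ∈ U, ∃ p q : MvPolynomial (Fin n) ℂ, eval u q ≠ 0 ∧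
    ∀ v ∈ U, eval v q * g v = eval v p}
  mul_mem' := by
    intro f g hf hg u hu
    obtain ⟨p, q, hq, h⟩ := hf u hu
    obtain ⟨p', q', hq', h'⟩ := hg u hu
    refine ⟨p * p', q * q', by rw [map_mul]; exact mul_ne_zero hq hq', fun v hv => ?_⟩
    rw [map_mul, map_mul, Pi.mul_apply, ← h v hv, ← h' v hv]; ring
  add_mem' := by
    intro f g hf hg u hu
    obtain ⟨p, q, hq, h⟩ := hf u hu
    obtain ⟨p', q', hq', h'⟩ := hg u hu
    refine ⟨q' * p + q * p', q * q', by rw [map_mul]; exact mul_ne_zero hq hq', fun v hv => ?_⟩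
    rw [map_mul, map_add, map_mul, map_mul, Pi.add_apply, ← h v hv, ← h' v hv]; ring
  algebraMap_mem' c := fun u _ => ⟨C c, 1, by simp, fun v _ => by simp⟩

theorem IsRegularOn.apply_mem {U : Set (Fin n → ℂ)} {φ : (Fin n → ℂ) → (Fin m → ℂ)}
    (h : IsRegularOn U φ) (j : Fin m) : (fun u => φ u j) ∈ regularFunctions U := by
  intro u hu
  obtain ⟨p, q, hq, hpq⟩ := h u hu j
  -- The extra factor `q` makes the identity hold at the zeros of `q` too, where the quotient says
  -- nothing about `φ`.
  refine ⟨q * p, q * q, by rw [map_mul]; exact mul_ne_zero hq hq, fun v hv => ?_⟩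
  rw [map_mul, map_mul]
  by_cases h0 : eval v q = 0
  · simp [h0]
  · change eval v q * eval v q * φ v j = _
    rw [hpq v hv h0]; field_simp

theorem IsRegularOn.eval_mem {U : Set (Fin n → ℂ)} {φ : (Fin n → ℂ) → (Fin m → ℂ)}
    (h : IsRegularOn U φ) (p : MvPolynomial (Fin m) ℂ) :
    (fun u => eval (φ u) p) ∈ regularFunctions U := by
  induction p using MvPolynomial.induction_on with
  | C a => simp only [eval_C]; exact (regularFunctions U).algebraMap_mem a
  | add p q hp hq => simp only [map_add]; exact add_mem hp hq
  | mul_X p i hp => simp only [map_mul, eval_X]; exact mul_mem hp (h.apply_mem i)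

theorem exists_pow_mul_eval_eq {U : Set (Fin n → ℂ)} {φ : (Fin n → ℂ) → (Fin m → ℂ)}
    {q : MvPolynomial (Fin n) ℂ}
    (h : ∀ j, ∃ p : MvPolynomial (Fin n) ℂ, ∀ u ∈ U, eval u q * φ u j = eval u p)
    (p : MvPolynomial (Fin m) ℂ) :
    ∃ (N : ℕ) (r : MvPolynomial (Fin n) ℂ), ∀ u ∈ U, eval u q ^ N * eval (φ u) p = eval u r := by
  induction p using MvPolynomial.induction_on with
  | C a => exact ⟨0, C a, fun u _ => by simp⟩
  | add p p' hp hp' =>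
    obtain ⟨N, r, hr⟩ := hp
    obtain ⟨N', r', hr'⟩ := hp'
    refine ⟨N + N', q ^ N' * r + q ^ N * r', fun u hu => ?_⟩
    simp only [map_add, map_mul, map_pow, ← hr u hu, ← hr' u hu]
    ring
  | mul_X p i hp =>
    obtain ⟨N, r, hr⟩ := hp
    obtain ⟨p', hp'⟩ := h i
    refine ⟨N + 1, r * p', fun u hu => ?_⟩
    simp only [map_mul, eval_X, ← hr u hu, ← hp' u hu]
    ring

/-- `q` is not a zero divisor among the polynomial functions on `X`. -/
def IsNonzerodivisorOn (X : Set (Fin n → ℂ)) (q : MvPolynomial (Fin n) ℂ) : Prop :=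
  ∀ g : MvPolynomial (Fin n) ℂ, (∀ x ∈ X, eval x q * eval x g = 0) → ∀ x ∈ X, eval x g = 0

theorem IsNonzerodivisorOn.pow {X : Set (Fin n → ℂ)} {q : MvPolynomial (Fin n) ℂ}
    (h : IsNonzerodivisorOn X q) (N : ℕ) : IsNonzerodivisorOn X (q ^ N) := by
  induction N with
  | zero => intro g hg; simpa using hg
  | succ N ih =>
    intro g hg
    refine h g fun x hx => ?_
    rw [← map_mul]
    refine ih (q * g) (fun x hx => ?_) x hx
    rw [← hg x hx]
    simp only [map_mul, map_pow]
    ring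

theorem IsZariskiOpenDense.subset {X U : Set (Fin n → ℂ)} (h : IsZariskiOpenDense X U) : U ⊆ X := by
  obtain ⟨⟨Z, -, rfl⟩, -⟩ := h
  exact Set.sdiff_subset

theorem IsZariskiOpenDense.exists_ne_zero {X U : Set (Fin n → ℂ)} (h : IsZariskiOpenDense X U)
    {u : Fin n → ℂ} (hu : u ∈ U) :
    ∃ z : MvPolynomial (Fin n) ℂ, eval u z ≠ 0 ∧ ∀ x ∈ X, x ∉ U → eval x z = 0 := by
  obtain ⟨⟨Z, ⟨I, rfl⟩, rfl⟩, -⟩ := h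
  have h1 := hu.2
  rw [mem_zeroLocus_iff] at h1
  push Not at h1
  obtain ⟨z, hz, hzu⟩ := h1
  refine ⟨z, by simpa [aeval_eq_eval] using hzu, fun x hx hxU => ?_⟩
  have hxZ : x ∈ zeroLocus ℂ I := by by_contra hn; exact hxU ⟨hx, hn⟩
  simpa [aeval_eq_eval] using hxZ z hz

theorem IsZariskiOpenDense.eq_zero_of_mul_eq_zero {X U : Set (Fin n → ℂ)}
    (h : IsZariskiOpenDense X U) {q : MvPolynomial (Fin n) ℂ} (hq : IsNonzerodivisorOn X q)
    {f : (Fin n → ℂ) → ℂ} (hf : f ∈ regularFunctions U) (h0 : ∀ u ∈ U, eval u q * f u = 0) :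
    ∀ u ∈ U, f u = 0 := by
  intro u hu
  obtain ⟨p, e, he, hpe⟩ := hf u hu
  have h1 : ∀ x ∈ X, eval x p = 0 := hq p fun x hx => by
    rw [← map_mul]
    refine h.2 hx (q * p) fun v hv => ?_
    rw [map_mul, ← hpe v hv, mul_left_comm, h0 v hv, mul_zero]
  have h2 := hpe u hu
  rw [h1 u (h.subset hu)] at h2
  exact (mul_eq_zero.1 h2).resolve_left he

/-- Finitely many regular functions on a dense open subset have a common denominator which is not
a zero divisor. -/
theorem IsZariskiOpenDense.exists_denominator {X U : Set (Fin n → ℂ)} (h : IsZariskiOpenDense X U)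
    {ι : Type*} [Fintype ι] (g : ι → (Fin n → ℂ) → ℂ) (hg : ∀ j, g j ∈ regularFunctions U) :
    ∃ q : MvPolynomial (Fin n) ℂ, IsNonzerodivisorOn X q ∧ (∀ x ∈ X, x ∉ U → eval x q = 0) ∧
      ∀ j, ∃ p : MvPolynomial (Fin n) ℂ, ∀ u ∈ U, eval u q * g j u = eval u p := by
  classical
  let I : Ideal (MvPolynomial (Fin n) ℂ) :=
    { carrier := {q | (∀ x ∈ X, x ∉ U → eval x q = 0) ∧
        ∀ j, ∃ p : MvPolynomial (Fin n) ℂ, ∀ u ∈ U, eval u q * g j u = eval u p}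
      add_mem' := by
        rintro a b ⟨ha, ha'⟩ ⟨hb, hb'⟩
        refine ⟨fun x hx hxU => by rw [map_add, ha x hx hxU, hb x hx hxU, add_zero], fun j => ?_⟩
        obtain ⟨p, hp⟩ := ha' j
        obtain ⟨p', hp'⟩ := hb' j
        exact ⟨p + p', fun u hu => by rw [map_add, map_add, add_mul, hp u hu, hp' u hu]⟩
      zero_mem' := ⟨fun x _ _ => map_zero _, fun j => ⟨0, fun u _ => by simp⟩⟩
      smul_mem' := by
        rintro c a ⟨ha, ha'⟩
        refine ⟨fun x hx hxU => by rw [smul_eq_mul, map_mul, ha x hx hxU, mul_zero], fun j => ?_⟩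
        obtain ⟨p, hp⟩ := ha' j
        exact ⟨c * p, fun u hu => by
          rw [smul_eq_mul, map_mul, map_mul, mul_assoc, hp u hu]⟩ }
  have hmem : ∀ u ∈ U, ∃ q ∈ I, eval u q ≠ 0 := by
    intro u hu
    obtain ⟨z, hz, hzU⟩ := h.exists_ne_zero hu
    choose p e he hpe using fun j => hg j u hu
    refine ⟨z * ∏ j, e j, ⟨fun x hx hxU => by rw [map_mul, hzU x hx hxU, zero_mul], fun j => ?_⟩, ?_⟩
    · refine ⟨z * (∏ i ∈ Finset.univ.erase j, e i) * p j, fun v hv => ?_⟩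
      rw [← Finset.prod_erase_mul _ _ (Finset.mem_univ j)]
      simp only [map_mul, ← hpe j v hv]
      ring
    · rw [map_mul, map_prod]
      exact mul_ne_zero hz (Finset.prod_ne_zero_iff.2 fun j _ => he j)
  let J : Ideal (CoordinateRing X) := I.map (Ideal.Quotient.mk _)
  -- An ideal of zero divisors in this Noetherian ring has a nonzero annihilator. But the ideal of
  -- denominators has no common zero on `U`, so an annihilating function vanishes on the dense set
  -- `U`.
  have hJ : ¬ Disjoint (J : Set (CoordinateRing X)) (nonZeroDivisors (CoordinateRing X)) := by
    intro hd
    obtain ⟨-, a, ha, ha0⟩ := SetLike.lt_iff_le_and_exists.1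
      (Ideal.bot_lt_annihilator_of_disjoint_nonZeroDivisors hd)
    obtain ⟨a, rfl⟩ := Ideal.Quotient.mk_surjective a
    refine ha0 ((Submodule.mem_bot _).2 (Ideal.Quotient.eq_zero_iff_mem.2 fun x hx => ?_))
    rw [aeval_eq_eval]
    refine h.2 hx a fun u hu => ?_
    obtain ⟨q, hq, hqu⟩ := hmem u hu
    have h1 := Submodule.mem_annihilator.1 ha _ (Ideal.mem_map_of_mem (Ideal.Quotient.mk _) hq)
    rw [smul_eq_mul, ← map_mul, Ideal.Quotient.eq_zero_iff_mem] at h1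
    have h2 := h1 u (h.subset hu)
    rw [aeval_eq_eval, map_mul] at h2
    exact (mul_eq_zero.1 h2).resolve_right hqu
  rw [Set.not_disjoint_iff] at hJ
  obtain ⟨_, hqJ, hq⟩ := hJ
  obtain ⟨q, hqI, rfl⟩ := (Ideal.mem_map_iff_of_surjective _ Ideal.Quotient.mk_surjective).1 hqJ
  refine ⟨q, fun f hf x hx => ?_, hqI.1, hqI.2⟩
  have h1 : (Ideal.Quotient.mk (vanishingIdeal ℂ X) f) * Ideal.Quotient.mk _ q = 0 := by
    rw [← map_mul, Ideal.Quotient.eq_zero_iff_mem]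
    intro x hx
    rw [aeval_eq_eval, map_mul, mul_comm]
    exact hf x hx
  have h2 := Ideal.Quotient.eq_zero_iff_mem.1
    ((mem_nonZeroDivisors_iff_right.1 hq) _ h1) x hx
  rwa [aeval_eq_eval] at h2

end

/-! ### A common localization of birational algebraic sets. -/

section
variable {n m : ℕ}

/-- The functions on a set with a map `a` to affine space that are quotients of a polynomial
function by a power of `h`. -/
def fractionFunctions {W : Type} (a : W → Fin n → ℂ) (h : MvPolynomial (Fin n) ℂ) :
    Subalgebra ℂ (W → ℂ) where
  carrier := {t | ∃ (N : ℕ) (p : MvPolynomial (Fin n) ℂ), ∀ w, eval (a w) h ^ N * t w = eval (a w) p}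
  mul_mem' := by
    rintro s t ⟨N, p, hp⟩ ⟨M, q, hq⟩
    refine ⟨N + M, p * q, fun w => ?_⟩
    rw [map_mul, ← hp w, ← hq w, Pi.mul_apply]; ring
  add_mem' := by
    rintro s t ⟨N, p, hp⟩ ⟨M, q, hq⟩
    refine ⟨N + M, h ^ M * p + h ^ N * q, fun w => ?_⟩
    simp only [map_add, map_mul, map_pow, ← hp w, ← hq w, Pi.add_apply]; ring
  algebraMap_mem' c := ⟨0, C c, fun w => by simp⟩

/-- The restriction of polynomial functions along a map. -/
noncomputable def restrictFunctions {W : Type} {X : Set (Fin n → ℂ)} (T : Subalgebra ℂ (W → ℂ))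
    (a : W → Fin n → ℂ) (ha : ∀ w, a w ∈ X)
    (hT : ∀ p : MvPolynomial (Fin n) ℂ, (fun w => eval (a w) p) ∈ T) : CoordinateRing X →ₐ[ℂ] T :=
  Ideal.Quotient.liftₐ _
    { toFun := fun p => ⟨fun w => eval (a w) p, hT p⟩
      map_one' := Subtype.ext (funext fun w => map_one _)
      map_mul' := fun p q => Subtype.ext (funext fun w => map_mul _ p q)
      map_zero' := Subtype.ext (funext fun w => map_zero _)
      map_add' := fun p q => Subtype.ext (funext fun w => map_add _ p q)
      commutes' := fun c => Subtype.ext (funext fun w => eval_C _) }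
    fun p hp => Subtype.ext (funext fun w => by
      have := hp (a w) (ha w)
      rwa [aeval_eq_eval] at this)

theorem isPrincipalLocalization_restrictFunctions {W : Type} {X : Set (Fin n → ℂ)}
    (T : Subalgebra ℂ (W → ℂ)) (a : W → Fin n → ℂ) (ha : ∀ w, a w ∈ X)
    (hT : ∀ p : MvPolynomial (Fin n) ℂ, (fun w => eval (a w) p) ∈ T) (h : MvPolynomial (Fin n) ℂ)
    (hinj : ∀ p : MvPolynomial (Fin n) ℂ, (∀ w, eval (a w) p = 0) → ∀ x ∈ X, eval x p = 0)
    (hunit : ∃ t ∈ T, ∀ w, eval (a w) h * t w = 1)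
    (hfrac : ∀ t ∈ T, ∃ (N : ℕ) (p : MvPolynomial (Fin n) ℂ),
      ∀ w, eval (a w) h ^ N * t w = eval (a w) p) :
    IsPrincipalLocalization (restrictFunctions T a ha hT) (Ideal.Quotient.mk _ h) := by
  refine ⟨?_, ?_, ?_⟩
  · rw [injective_iff_map_eq_zero]
    intro p hp
    obtain ⟨p, rfl⟩ := Ideal.Quotient.mk_surjective p
    refine Ideal.Quotient.eq_zero_iff_mem.2 fun x hx => ?_
    rw [aeval_eq_eval]
    exact hinj p (fun w => congrFun (congrArg Subtype.val hp) w) x hx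
  · obtain ⟨t, ht, hht⟩ := hunit
    exact IsUnit.of_mul_eq_one (⟨t, ht⟩ : T) (Subtype.ext (funext hht))
  · rintro ⟨t, ht⟩
    obtain ⟨N, p, hp⟩ := hfrac t ht
    exact ⟨N, Ideal.Quotient.mk _ p, Subtype.ext (funext hp)⟩

/-- A point of `T` restricts to a point of `X` where `h ≠ 0`, and it is determined by this
restriction. -/
theorem exists_eq_eval_of_isPrincipalLocalization {W : Type} {X : Set (Fin n → ℂ)}
    (hX : IsAlgebraicSet X) (T : Subalgebra ℂ (W → ℂ)) (a : W → Fin n → ℂ) (ha : ∀ w, a w ∈ X)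
    (hT : ∀ p : MvPolynomial (Fin n) ℂ, (fun w => eval (a w) p) ∈ T) (h : MvPolynomial (Fin n) ℂ)
    (hπ : IsPrincipalLocalization (restrictFunctions T a ha hT) (Ideal.Quotient.mk _ h))
    (hsurj : ∀ x ∈ X, eval x h ≠ 0 → ∃ w, a w = x) (w : T →ₐ[ℂ] ℂ) :
    ∃ w₀ : W, ∀ t : T, w t = t.1 w₀ := by
  have hx := hX.coord_mem (w.comp (restrictFunctions T a ha hT))
  set x : Fin n → ℂ := fun t => (w.comp (restrictFunctions T a ha hT)) (coord X t)
  have hwx : w.comp (restrictFunctions T a ha hT) = evalAt ⟨x, hx⟩ :=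
    coordinateRing_algHom_ext fun t => (evalAt_coord ⟨x, hx⟩ t).symm
  have hx0 : eval x h ≠ 0 := by
    have h1 := (hπ.isUnit.map w).ne_zero
    exact fun h0 => h1 (((AlgHom.congr_fun hwx _).trans (evalAt_mk _ _)).trans h0)
  obtain ⟨w₀, hw₀⟩ := hsurj x hx hx0
  have hw : w = (Pi.evalAlgHom ℂ (fun _ : W => ℂ) w₀).comp T.val :=
    hπ.algHom_ext (coordinateRing_algHom_ext fun t => by
      change x t = eval (a w₀) (MvPolynomial.X t)
      rw [eval_X, hw₀])
  exact ⟨w₀, fun t => by rw [hw]; rfl⟩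

/-- Birational algebraic sets have a common principal localization of their coordinate rings, all of
whose points lie in the given open sets. -/
theorem exists_common_principalLocalization {X : Set (Fin n → ℂ)} {Y : Set (Fin m → ℂ)}
    (hX : IsAlgebraicSet X) {U : Set (Fin n → ℂ)} {V : Set (Fin m → ℂ)}
    {φ : (Fin n → ℂ) → (Fin m → ℂ)} {ψ : (Fin m → ℂ) → (Fin n → ℂ)}
    (hU : IsZariskiOpenDense X U) (hV : IsZariskiOpenDense Y V) (hφ : IsRegularOn U φ)
    (hψ : IsRegularOn V ψ) (hφUV : Set.MapsTo φ U V) (hψVU : Set.MapsTo ψ V U)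
    (hψφ : ∀ u ∈ U, ψ (φ u) = u) (hφψ : ∀ v ∈ V, φ (ψ v) = v) :
    ∃ (T : Type) (_ : CommRing T) (_ : IsReduced T) (_ : Algebra ℂ T)
      (π : CoordinateRing X →ₐ[ℂ] T) (π' : CoordinateRing Y →ₐ[ℂ] T) (h : CoordinateRing X)
      (h' : CoordinateRing Y), IsPrincipalLocalization π h ∧ IsPrincipalLocalization π' h' ∧
      ∀ w : T →ₐ[ℂ] ℂ, ∃ u ∈ U, (∀ t, w (π (coord X t)) = u t) ∧
        ∀ j, w (π' (coord Y j)) = φ u j := by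
  obtain ⟨q, hq, hqU, hqφ⟩ := hU.exists_denominator (fun j u => φ u j) hφ.apply_mem
  obtain ⟨q', hq', hqV, hqψ⟩ := hV.exists_denominator (fun i v => ψ v i) hψ.apply_mem
  -- On `U`, `r = q ^ N * (q' ∘ φ)`. Hence `q * r ≠ 0` ensures that both `φ` at `u` and `ψ` at `φ u`
  -- have nonzero denominators.
  obtain ⟨N, r, hr⟩ := exists_pow_mul_eval_eq hqφ q'
  obtain ⟨M, h₁, hh₁⟩ := exists_pow_mul_eval_eq hqψ (q * r)
  -- If `q * r` kills `g`, then so does `r`. Transported by `ψ`, this says that `q'` kills `(q ^ N *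
  -- g) ∘ ψ`, so `q ^ N * g` vanishes on `U`, hence on `X`.
  have hh : IsNonzerodivisorOn X (q * r) := by
    intro g hg
    have hrg : ∀ x ∈ X, eval x r * eval x g = 0 := by
      intro x hx
      rw [← map_mul]
      refine hq (r * g) (fun x hx => ?_) x hx
      rw [map_mul, ← mul_assoc, ← map_mul]
      exact hg x hx
    refine hq.pow N g fun x hx => ?_
    rw [← map_mul]
    refine hU.2 hx _ fun u hu => ?_
    have h1 := hV.eq_zero_of_mul_eq_zero hq' (hψ.eval_mem (q ^ N * g)) (fun v hv => by
      have h2 := hrg _ (hU.subset (hψVU hv))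
      rw [← hr _ (hψVU hv), hφψ v hv] at h2
      rw [← h2, map_mul, map_pow]; ring) (φ u) (hφUV hu)
    rwa [hψφ u hu] at h1
  let W : Type := {u : Fin n → ℂ // u ∈ X ∧ eval u (q * r) ≠ 0}
  let a : W → Fin n → ℂ := Subtype.val
  have haU : ∀ w, a w ∈ U := fun w => by
    by_contra hn
    exact w.2.2 (by rw [map_mul, hqU _ w.2.1 hn, zero_mul])
  let T : Subalgebra ℂ (W → ℂ) := fractionFunctions a (q * r)
  have hTX : ∀ p : MvPolynomial (Fin n) ℂ, (fun w => eval (a w) p) ∈ T := fun p =>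
    ⟨0, p, fun w => by simp⟩
  have hTY : ∀ p : MvPolynomial (Fin m) ℂ, (fun w => eval (φ (a w)) p) ∈ T := fun p => by
    obtain ⟨L, p', hp'⟩ := exists_pow_mul_eval_eq hqφ p
    refine ⟨L, r ^ L * p', fun w => ?_⟩
    simp only [map_mul, map_pow, ← hp' _ (haU w)]
    ring
  have hinv : (fun w => (eval (a w) (q * r))⁻¹) ∈ T :=
    ⟨1, 1, fun w => by rw [pow_one, map_one, mul_inv_cancel₀ w.2.2]⟩
  -- The denominators on both sides have corresponding nonvanishing loci, since `q * r ≠ 0` implies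
  -- `q' ∘ φ ≠ 0`.
  have hh' : ∀ u ∈ U, eval (φ u) (q' * h₁) = eval (φ u) q' ^ (M + 1) * eval u (q * r) := by
    intro u hu
    rw [map_mul, ← hh₁ _ (hφUV hu), hψφ u hu]
    ring
  have hπ := isPrincipalLocalization_restrictFunctions T a (fun w => w.2.1) hTX (q * r)
    (fun p hp => hh p fun x hx => by
      by_cases hx0 : eval x (q * r) = 0
      · rw [hx0, zero_mul]
      · rw [show eval x p = 0 from hp ⟨x, hx, hx0⟩, mul_zero])
    ⟨_, hinv, fun w => mul_inv_cancel₀ w.2.2⟩ (fun t ht => ht)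
  have hπ' := isPrincipalLocalization_restrictFunctions T (fun w => φ (a w))
    (fun w => hV.subset (hφUV (haU w))) hTY (q' * h₁)
    (fun p hp y hy => hV.2 hy p fun v hv => by
      rw [← hφψ v hv]
      refine hU.eq_zero_of_mul_eq_zero hh (hφ.eval_mem p) (fun u hu => ?_) _ (hψVU hv)
      by_cases hx0 : eval u (q * r) = 0
      · rw [hx0, zero_mul]
      · rw [show eval (φ u) p = 0 from hp ⟨u, hU.subset hu, hx0⟩, mul_zero])
    (by
      -- Here `q ^ (N + 1) / (q * r)` is the inverse of `q' ∘ φ`.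
      refine ⟨_, mul_mem (pow_mem (mul_mem (hTX (q ^ (N + 1))) hinv) (M + 1)) hinv, fun w => ?_⟩
      have h1 : eval (φ (a w)) q' * (eval (a w) q ^ (N + 1) * (eval (a w) (q * r))⁻¹) = 1 := by
        have h2 : eval (φ (a w)) q' * eval (a w) q ^ (N + 1) = eval (a w) (q * r) := by
          rw [map_mul, ← hr _ (haU w)]; ring
        rw [← mul_assoc, h2, mul_inv_cancel₀ w.2.2]
      have h3 : eval (a w) (q * r) * (eval (a w) (q * r))⁻¹ = 1 := mul_inv_cancel₀ w.2.2
      rw [hh' _ (haU w)]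
      simp only [Pi.mul_apply, Pi.pow_apply, map_pow]
      rw [mul_mul_mul_comm, ← mul_pow, h1, h3, one_pow, one_mul])
    (by
      rintro t ⟨L, p, hp⟩
      obtain ⟨L', p', hp'⟩ := exists_pow_mul_eval_eq hqψ p
      refine ⟨L + L', h₁ ^ L' * q' ^ ((M + 1) * L) * p', fun w => ?_⟩
      have h1 := hp' _ (hφUV (haU w))
      rw [hψφ _ (haU w)] at h1
      rw [map_mul _ _ p', ← h1, ← hp w, pow_add]
      nth_rewrite 1 [hh' _ (haU w)]
      simp only [map_mul, map_pow]
      ring)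
  refine ⟨T, inferInstance, isReduced_of_injective T.subtype Subtype.val_injective, inferInstance,
    _, _, _, _, hπ, hπ', fun w => ?_⟩
  obtain ⟨w₀, hw₀⟩ := exists_eq_eval_of_isPrincipalLocalization hX T a _ hTX _ hπ
    (fun x hx hx0 => ⟨⟨x, hx, hx0⟩, rfl⟩) w
  exact ⟨a w₀, haU w₀, fun t => (hw₀ _).trans (eval_X t), fun j => (hw₀ _).trans (eval_X j)⟩

end

/-! ### From the bi-Lipschitz condition to linear growth. -/

/-- The equation `e * y j = p` holds on the graph, hence on its closure, and `e` does not vanish at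
`u`. -/
theorem IsRegularOn.eq_of_mem_zariskiClosure {n m : ℕ} {U : Set (Fin n → ℂ)}
    {φ : (Fin n → ℂ) → (Fin m → ℂ)} (hφ : IsRegularOn U φ) {u : Fin n → ℂ} (hu : u ∈ U)
    {y : Fin m → ℂ} (h : Sum.elim u y ∈ zariskiClosure ((fun u => Sum.elim u (φ u)) '' U)) :
    y = φ u := by
  funext j
  obtain ⟨p, e, he, hpe⟩ := hφ.apply_mem j u hu
  have h1 := h (rename Sum.inl e * X (Sum.inr j) - rename Sum.inl p) (by
    rintro _ ⟨v, hv, rfl⟩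
    simp only [map_sub, map_mul, eval_rename, eval_X, Sum.elim_inr, Sum.elim_comp_inl, ← hpe v hv,
      sub_self])
  simp only [map_sub, map_mul, eval_rename, eval_X, Sum.elim_inr, Sum.elim_comp_inl, ← hpe u hu,
    ← mul_sub] at h1
  exact sub_eq_zero.1 ((mul_eq_zero.1 h1).resolve_left he)

theorem IsRegularOn.eq_of_mem_zariskiClosure_inverse {n m : ℕ} {U : Set (Fin n → ℂ)}
    {V : Set (Fin m → ℂ)} {φ : (Fin n → ℂ) → (Fin m → ℂ)} {ψ : (Fin m → ℂ) → (Fin n → ℂ)}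
    (hψ : IsRegularOn V ψ) (hφUV : Set.MapsTo φ U V) (hψφ : ∀ u ∈ U, ψ (φ u) = u)
    {v : Fin m → ℂ} (hv : v ∈ V) {x : Fin n → ℂ}
    (h : Sum.elim x v ∈ zariskiClosure ((fun u => Sum.elim u (φ u)) '' U)) : x = ψ v := by
  funext i
  obtain ⟨p, e, he, hpe⟩ := hψ.apply_mem i v hv
  have h1 := h (rename Sum.inr e * X (Sum.inl i) - rename Sum.inr p) (by
    rintro _ ⟨u, hu, rfl⟩
    simp only [map_sub, map_mul, eval_rename, eval_X, Sum.elim_inl, Sum.elim_comp_inr,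
      ← hpe _ (hφUV hu), hψφ u hu, sub_self])
  simp only [map_sub, map_mul, eval_rename, eval_X, Sum.elim_inl, Sum.elim_comp_inr, ← hpe v hv,
    ← mul_sub] at h1
  exact sub_eq_zero.1 ((mul_eq_zero.1 h1).resolve_left he)

theorem norm_sub_le_euclideanDist {n : ℕ} (x y : Fin n → ℂ) : ‖x - y‖ ≤ euclideanDist x y := by
  rw [← dist_eq_norm]
  have h := (PiLp.lipschitzWith_ofLp 2 (fun _ : Fin n => ℂ)).dist_le_mul
    (WithLp.toLp 2 x) (WithLp.toLp 2 y)
  simpa [euclideanDist] using h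

theorem exists_euclideanDist_le (n : ℕ) :
    ∃ c : ℝ, 0 ≤ c ∧ ∀ x y : Fin n → ℂ, euclideanDist x y ≤ c * ‖x - y‖ := by
  obtain ⟨c, hc⟩ : ∃ c, AntilipschitzWith c (@WithLp.ofLp 2 (Fin n → ℂ)) :=
    ⟨_, PiLp.antilipschitzWith_ofLp 2 (fun _ : Fin n => ℂ)⟩
  refine ⟨c, c.coe_nonneg, fun x y => ?_⟩
  rw [← dist_eq_norm]
  exact hc.le_mul_dist (WithLp.toLp 2 x) (WithLp.toLp 2 y)

theorem exists_norm_le_of_euclideanDist_le {α : Type*} {n m : ℕ} (A : Set α) (F : α → Fin m → ℂ)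
    (G : α → Fin n → ℂ) (C : ℝ) (hC : 0 ≤ C) (h : ∀ x ∈ A, ∀ x' ∈ A,
      euclideanDist (F x) (F x') ≤ C * euclideanDist (G x) (G x')) :
    ∃ c : ℝ, 0 ≤ c ∧ ∀ x ∈ A, ‖F x‖ ≤ c * (1 + ‖G x‖) := by
  rcases A.eq_empty_or_nonempty with rfl | ⟨x₀, hx₀⟩
  · exact ⟨0, le_rfl, by simp⟩
  obtain ⟨c, hc, hcd⟩ := exists_euclideanDist_le n
  refine ⟨‖F x₀‖ + C * c * ‖G x₀‖ + C * c, by positivity, fun x hx => ?_⟩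
  have h1 : ‖F x‖ ≤ ‖F x₀‖ + ‖F x - F x₀‖ := by
    simpa using norm_add_le (F x₀) (F x - F x₀)
  have h2 : ‖F x - F x₀‖ ≤ C * (c * ‖G x - G x₀‖) :=
    (norm_sub_le_euclideanDist _ _).trans ((h x hx x₀ hx₀).trans
      (mul_le_mul_of_nonneg_left (hcd _ _) hC))
  have h3 : C * (c * ‖G x - G x₀‖) ≤ C * (c * (‖G x‖ + ‖G x₀‖)) := by
    gcongr
    exact norm_sub_le _ _
  have h4 : 0 ≤ (‖F x₀‖ + C * c * ‖G x₀‖) * ‖G x‖ := by positivity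
  have h5 : 0 ≤ C * c := by positivity
  nlinarith

/-- A birational correspondence which is bi-Lipschitz outside of compact sets grows linearly, and so
does its inverse. -/
theorem exists_linear_growth {n m : ℕ} {X U : Set (Fin n → ℂ)} {Y V : Set (Fin m → ℂ)}
    {φ : (Fin n → ℂ) → (Fin m → ℂ)} {ψ : (Fin m → ℂ) → (Fin n → ℂ)}
    (hU : IsZariskiOpenDense X U) (hV : IsZariskiOpenDense Y V) (hφ : IsRegularOn U φ)
    (hψ : IsRegularOn V ψ) (hφUV : Set.MapsTo φ U V) (hψφ : ∀ u ∈ U, ψ (φ u) = u)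
    {K : Set (Fin n → ℂ)} {K' : Set (Fin m → ℂ)} (hK : IsCompact K) (hK' : IsCompact K')
    {f : (Fin n → ℂ) → (Fin m → ℂ)}
    (hfΓ : ∀ x ∈ X \ K, Sum.elim x (f x) ∈ zariskiClosure ((fun u => Sum.elim u (φ u)) '' U))
    (hf : IsBiLipschitzOnto f (X \ K) (Y \ K')) :
    (∃ c : ℝ, 0 ≤ c ∧ ∀ u ∈ U, ‖φ u‖ ≤ c * (1 + ‖u‖)) ∧
      ∃ c : ℝ, 0 ≤ c ∧ ∀ u ∈ U, ‖u‖ ≤ c * (1 + ‖φ u‖) := by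
  obtain ⟨hbij, C, hC, hL⟩ := hf
  have hfφ : ∀ u ∈ U, u ∉ K → f u = φ u := fun u hu huK =>
    hφ.eq_of_mem_zariskiClosure hu (hfΓ u ⟨hU.subset hu, huK⟩)
  -- A value `φ u` outside `K'` is `f x` with `x` outside `K`; since `(x, φ u)` lies in the closure
  -- of the graph, `x = ψ (φ u) = u`.
  have hφK : ∀ u ∈ U, u ∈ K → φ u ∈ K' := by
    intro u hu huK
    by_contra hn
    obtain ⟨x, hx, hxu⟩ := hbij.surjOn ⟨hV.subset (hφUV hu), hn⟩
    have h1 := hψ.eq_of_mem_zariskiClosure_inverse hφUV hψφ (hφUV hu) (hxu ▸ hfΓ x hx)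
    rw [hψφ u hu] at h1
    exact hx.2 (h1 ▸ huK)
  obtain ⟨b, hb⟩ := hK.isBounded.exists_norm_le
  obtain ⟨b', hb'⟩ := hK'.isBounded.exists_norm_le
  obtain ⟨c, hc, hcf⟩ := exists_norm_le_of_euclideanDist_le (X \ K) f id C hC.le
    fun x hx x' hx' => (hL x hx x' hx').1
  obtain ⟨c', hc', hcf'⟩ := exists_norm_le_of_euclideanDist_le (X \ K) id f C hC.le
    fun x hx x' hx' => (hL x hx x' hx').2
  constructor
  · refine ⟨c + |b'|, by positivity, fun u hu => ?_⟩
    have h0 := norm_nonneg u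
    by_cases huK : u ∈ K
    · have h1 := (hb' _ (hφK u hu huK)).trans (le_abs_self b')
      nlinarith [abs_nonneg b', mul_nonneg hc h0, mul_nonneg (abs_nonneg b') h0]
    · have h1 := hcf u ⟨hU.subset hu, huK⟩
      rw [hfφ u hu huK, id] at h1
      nlinarith [abs_nonneg b', mul_nonneg (abs_nonneg b') h0]
  · refine ⟨c' + |b|, by positivity, fun u hu => ?_⟩
    have h0 := norm_nonneg (φ u)
    by_cases huK : u ∈ K
    · have h1 := (hb _ huK).trans (le_abs_self b)
      nlinarith [abs_nonneg b, mul_nonneg hc' h0, mul_nonneg (abs_nonneg b) h0]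
    · have h1 := hcf' u ⟨hU.subset hu, huK⟩
      rw [hfφ u hu huK, id] at h1
      nlinarith [abs_nonneg b, mul_nonneg (abs_nonneg b) h0]

/-! ### Assembly of the proof. -/

theorem map_linForms {R T : Type*} [CommRing R] [Algebra ℂ R] [CommRing T] [Algebra ℂ T]
    {k n : ℕ} (π : R →ₐ[ℂ] T) (A : Matrix (Fin k) (Fin n) ℂ) (x : Fin n → R) :
    (fun i => π (linForms A x i)) = linForms A fun t => π (x t) := by
  funext i
  simp [linForms]

/-- Linear bounds are chained: the forms in `x` by `x`, then `x` by `y`, then `y` by the forms in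
`y`. -/
theorem generic_rank_linForms_le {T : Type*} [CommRing T] [Algebra ℂ T] {n m k : ℕ} (x : Fin n → T)
    (y : Fin m → T) (A : Matrix (Fin k) (Fin n) ℂ) (B : Matrix (Fin k) (Fin m) ℂ)
    (hB : IsPointwiseAlgebraic (linForms B y)) {D D' : ℕ} (e : Fin D → T) (e' : Fin D' → T)
    (Q Q' : MvPolynomial (Fin k) ℂ) (he : IsGenericBasisOver (linForms A x) e Q)
    (he' : IsGenericBasisOver (linForms B y) e' Q') (c c' : ℝ) (hc : 0 ≤ c)
    (h : ∀ w : T →ₐ[ℂ] ℂ, ‖fun t => w (x t)‖ ≤ c * (1 + ‖fun j => w (y j)‖))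
    (h' : ∀ w : T →ₐ[ℂ] ℂ, ‖fun j => w (y j)‖ ≤ c' * (1 + ‖fun i => w (linForms B y i)‖)) :
    D ≤ D' := by
  refine generic_rank_le _ _ hB e e' Q Q' he he' ((∑ i, ∑ t, ‖A i t‖) * (c * (1 + c')))
    fun w i => ?_
  set z := ‖fun i => w (linForms B y i)‖ with hz
  have hz0 : 0 ≤ z := norm_nonneg _
  have h1 : ‖w (linForms A x i)‖ ≤ (∑ t, ‖A i t‖) * ‖fun t => w (x t)‖ := by
    rw [linForms, map_sum, Finset.sum_mul]
    refine (norm_sum_le _ _).trans (Finset.sum_le_sum fun t _ => ?_)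
    rw [map_smul, norm_smul]
    exact mul_le_mul_of_nonneg_left (norm_le_pi_norm (fun t => w (x t)) t) (norm_nonneg _)
  have h2 : ∑ t, ‖A i t‖ ≤ ∑ i, ∑ t, ‖A i t‖ :=
    Finset.single_le_sum (f := fun i => ∑ t, ‖A i t‖)
      (fun i _ => Finset.sum_nonneg fun t _ => norm_nonneg _) (Finset.mem_univ i)
  have h3 : ‖fun t => w (x t)‖ ≤ c * (1 + c') * (1 + z) := by
    refine (h w).trans ?_
    rw [mul_assoc]
    refine mul_le_mul_of_nonneg_left ?_ hc
    have := h' w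
    nlinarith
  calc _ ≤ (∑ t, ‖A i t‖) * ‖fun t => w (x t)‖ := h1
    _ ≤ (∑ i, ∑ t, ‖A i t‖) * (c * (1 + c') * (1 + z)) :=
      mul_le_mul h2 h3 (norm_nonneg _) (h2.trans' (Finset.sum_nonneg fun t _ => norm_nonneg _))
    _ = _ := by ring

/-- The generic number of points in a linear section, and one set of linear forms for which it can
be computed in the coordinate ring. -/
theorem exists_degree_data {n : ℕ} {X : Set (Fin n → ℂ)} (hX : IsAlgebraicSet X)
    (hne : X.Nonempty) : ∃ (k d : ℕ) (A : Matrix (Fin k) (Fin n) ℂ) (p : MvPolynomial (Fin k) ℂ),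
      HasDegree X d ∧ p ≠ 0 ∧ (∀ b, eval b p ≠ 0 → {x ∈ X | A.mulVec x = b}.encard = d) ∧
      (aeval (linForms A (coord X)) :
        MvPolynomial (Fin k) ℂ →ₐ[ℂ] CoordinateRing X).toRingHom.IsIntegral ∧
      AlgebraicIndependent ℂ (linForms A (coord X)) ∧
      ∃ c : ℝ, 0 ≤ c ∧ ∀ w : CoordinateRing X →ₐ[ℂ] ℂ,
        ‖fun t => w (coord X t)‖ ≤ c * (1 + ‖fun j => w (linForms A (coord X) j)‖) := by
  have := nontrivial_coordinateRing hne
  obtain ⟨k, δ, hk, hδ, hint, hA⟩ := exists_generic_noether_normalization (coord X) (adjoin_coord X)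
  obtain ⟨d, P, hP, hd⟩ := exists_hasDegreeOfDim hX δ hδ hint
  have hdim : algDim X = k := by rw [algDim, hk]; rfl
  have hδ' : rename Sum.inl δ ≠ (0 : MvPolynomial (Fin k × Fin n ⊕ Fin k) ℂ) := by
    rw [Ne, map_eq_zero_iff _ (rename_injective _ Sum.inl_injective)]; exact hδ
  -- A pair `(A, b)` outside both exceptional sets: its `A` is a good projection, and its `b` shows
  -- that `P(A, ·)` is not zero.
  obtain ⟨z, hz⟩ := MvPolynomial.exists_eval_ne_zero (mul_ne_zero hδ' hP)
  rw [map_mul, eval_rename] at hz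
  let A : Matrix (Fin k) (Fin n) ℂ := Matrix.of fun i j => z (Sum.inl (i, j))
  obtain ⟨h1, h2, h3⟩ := hA A (left_ne_zero_of_mul hz)
  let p : MvPolynomial (Fin k) ℂ := aeval (Sum.elim (fun ij => C (A ij.1 ij.2)) MvPolynomial.X) P
  have hp : ∀ b, eval b p = eval (Sum.elim (fun ij => A ij.1 ij.2) b) P := by
    intro b
    rw [← aeval_eq_eval, ← aeval_eq_eval]
    change ((aeval b).comp (aeval _)) P = _
    rw [comp_aeval]
    congr 2
    funext i
    rcases i with i | i <;> simp
  refine ⟨k, d, A, p, ?_, fun h0 => right_ne_zero_of_mul hz ?_, fun b hb => hd A b (hp b ▸ hb), h1,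
    h2, h3⟩
  · subst hdim
    exact ⟨P, hP, hd⟩
  · have h4 := hp (z ∘ Sum.inr)
    rw [h0, map_zero] at h4
    rw [h4]
    congr 2
    funext i
    rcases i with i | i <;> rfl

theorem hasDegree_empty (n : ℕ) : HasDegree (∅ : Set (Fin n → ℂ)) 0 :=
  ⟨1, one_ne_zero, fun _ _ _ => by simp⟩

theorem IsZariskiOpenDense.eq_empty {n : ℕ} {X : Set (Fin n → ℂ)} (h : IsZariskiOpenDense X ∅) :
    X = ∅ := by
  refine Set.eq_empty_of_forall_notMem fun x hx => ?_
  simpa using h.2 hx 1 (by simp)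

theorem mainTheorem5 {n m : ℕ} (X : Set (Fin n → ℂ)) (Y : Set (Fin m → ℂ))
    (hX : IsAlgebraicSet X) (hY : IsAlgebraicSet Y)
    (Γ : Set (Fin n ⊕ Fin m → ℂ)) (hΓ : IsBirationalCorrespondence X Y Γ)
    (K : Set (Fin n → ℂ)) (K' : Set (Fin m → ℂ)) (hK : IsCompact K) (hK' : IsCompact K')
    (f : (Fin n → ℂ) → (Fin m → ℂ))
    (hfΓ : ∀ x ∈ X \ K, Sum.elim x (f x) ∈ Γ)
    (hf : IsBiLipschitzOnto f (X \ K) (Y \ K')) :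
    ∃ d : ℕ, HasDegree X d ∧ HasDegree Y d := by
  obtain ⟨U, V, φ, ψ, hU, hV, hφ, hψ, hφUV, hψVU, hψφ, hφψ, rfl⟩ := hΓ
  rcases X.eq_empty_or_nonempty with rfl | hXne
  · have hU0 : U = ∅ := Set.subset_empty_iff.1 hU.subset
    have hV0 : V = ∅ := Set.eq_empty_of_forall_notMem fun v hv => by simpa [hU0] using hψVU hv
    subst hV0
    rw [hV.eq_empty]
    exact ⟨0, hasDegree_empty n, hasDegree_empty m⟩
  have hYne : Y.Nonempty := by
    rcases U.eq_empty_or_nonempty with rfl | ⟨u, hu⟩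
    · exact absurd hU.eq_empty hXne.ne_empty
    · exact ⟨_, hV.subset (hφUV hu)⟩
  have := nontrivial_coordinateRing hXne
  have := nontrivial_coordinateRing hYne
  obtain ⟨⟨c, hc, hcφ⟩, c', hc', hcφ'⟩ :=
    exists_linear_growth hU hV hφ hψ hφUV hψφ hK hK' hfΓ hf
  obtain ⟨k, d, A, p, hd, hp, hdp, hA, hAi, a, ha, haw⟩ := exists_degree_data hX hXne
  obtain ⟨k', d', B, p', hd', hp', hdp', hB, hBi, b, hb, hbw⟩ := exists_degree_data hY hYne
  obtain ⟨T, _, _, _, π, π', h, h', hπ, hπ', hpt⟩ := exists_common_principalLocalization hX hU hV hφ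
    hψ hφUV hψVU hψφ hφψ
  have hl := hπ.isPointwiseAlgebraic hA
  have hl' := hπ'.isPointwiseAlgebraic hB
  -- In `T` each family of forms is independent and the other one is algebraically spanning.
  obtain rfl : k = k' := le_antisymm (hl'.card_le (hπ.algebraicIndependent hAi))
    (hl.card_le (hπ'.algebraicIndependent hBi))
  obtain ⟨e, Q, he⟩ := hπ.exists_isGenericBasisOver hX A hA d p hp hdp
  obtain ⟨e', Q', he'⟩ := hπ'.exists_isGenericBasisOver hY B hB d' p' hp' hdp'
  rw [map_linForms] at hl hl' he he'
  have hX1 : ∀ w : T →ₐ[ℂ] ℂ, ‖fun t => w (π (coord X t))‖ ≤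
      c' * (1 + ‖fun j => w (π' (coord Y j))‖) := fun w => by
    obtain ⟨u, hu, hx, hy⟩ := hpt w
    simp only [hx, hy]
    exact hcφ' u hu
  have hY1 : ∀ w : T →ₐ[ℂ] ℂ, ‖fun j => w (π' (coord Y j))‖ ≤
      c * (1 + ‖fun t => w (π (coord X t))‖) := fun w => by
    obtain ⟨u, hu, hx, hy⟩ := hpt w
    simp only [hx, hy]
    exact hcφ u hu
  have hX2 : ∀ w : T →ₐ[ℂ] ℂ, ‖fun t => w (π (coord X t))‖ ≤
      a * (1 + ‖fun i => w (linForms A (fun t => π (coord X t)) i)‖) := fun w => by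
    rw [← map_linForms]; exact haw (w.comp π)
  have hY2 : ∀ w : T →ₐ[ℂ] ℂ, ‖fun j => w (π' (coord Y j))‖ ≤
      b * (1 + ‖fun i => w (linForms B (fun j => π' (coord Y j)) i)‖) := fun w => by
    rw [← map_linForms]; exact hbw (w.comp π')
  obtain rfl : d = d' := le_antisymm
    (generic_rank_linForms_le _ _ A B hl' e e' Q Q' he he' c' b hc' hX1 hY2)
    (generic_rank_linForms_le _ _ B A hl e' e Q' Q he' he c a hc hY1 hX2)
  exact ⟨d, hd, hd'⟩
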